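/- Let $M$ be a Hausdorff finite-dimensional smooth manifold with a (pseudo-)Riemannian metric $T_2$ (smooth, non-degenerate, of arbitrary signature), let $\nabla$ be its Levi-Civita connection, let $\Delta=\operatorname{div}\operatorname{grad}$ be its Laplacian, and let $\hbar\neq0$ be a real constant. Let $C^\infty(M)$ be the ring of smooth complex-valued functions on $M$, and for $x\in M$ let $\mathfrak m_x\subset C^\infty(M)$ be the ideal of functions vanishing at $x$. A linear differential operator on $M$ is a $\mathbb C$-linear map $P\colon C^\infty(M)\to C^\infty(M)$ for which there is an $r\ge0$ with $P(\mathfrak m_x^{r+1})\subseteq\mathfrak m_x$ for all $x\in M$. The quantization of a symmetric contravariant tensor field $\Phi$ of order $r$ on $M$ (with complex coefficients) is the operator $\widehat\Phi(f)=(-i\hbar)^r\langle\Phi,\nabla^r_{\mathrm{sym}}f\rangle$, where $\nabla^r_{\mathrm{sym}}f$ is the symmetrized $r$-th iterated covariant differential of $f$ and $\langle\,,\,\rangle$ is the tensor contraction; the quantization of a non-homogeneous tensor $\Phi=\Phi_r+\dots+\Phi_0$ is $\widehat\Phi_r+\dots+\widehat\Phi_0$. Each linear differential operator $P$ is $\widehat\Phi$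 for exactly one symmetric contravariant tensor field $\Phi=\Phi_r+\dots+\Phi_0$ (its dequantization); the Hamiltonian of $P$ is the function $F(\alpha)=\sum_k\langle\Phi_k,\alpha\otimes\dots\otimes\alpha\rangle$ on $T^*M$, and $D_P$ is the tangent field on $T^*M$ (with complex coefficients) with $D_P\,\lrcorner\,\omega_2+dF=0$, where $\omega_2=d\theta$ and $\theta$ is the Liouville form (in canonical coordinates, $\omega_2=dp_j\wedge dx^j$). A tangent field $D$ on $TM$ is a second order differential equation if $D(f\circ\pi)(u)=df(u)$ for all $f\in C^\infty(M)$ and $u\in TM$, where $\pi\colon TM\to M$ is the projection. Then: (1) The contravariant form $g^{jk}\,\partial_j\otimes\partial_k$ of the metric tensor is a smooth symmetric tensor field, and its quantization is $-\hbar^2\Delta$. (2) For each linear differential operator $P$ on $M$, the field $D_P$, transported to $TM$ by the isomorphism $TM\simeq T^*M$, $u\mapsto T_2(u,\cdot)$, is a second order differential equation if and only if there is a function $U\in C^\infty(M)$ with $$P=-\frac{\hbar^2}{2}\Delta+U .$$ -/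

import Mathlib

open scoped Manifold ContDiff Bundle TensorProduct

noncomputable section

namespace Dequantization

variable {E : Type*} [NormedAddCommGroup E] [NormedSpace ℝ E]
  {M : Type*} [TopologicalSpace M] [ChartedSpace E M]

/-! ### Functions and differential operators -/

variable (E M) in
/-- The ring `C^∞(M)` of smooth complex-valued functions on `M`. -/
def SmoothFn : Subalgebra ℂ (M → ℂ) where
  carrier := {f | ContMDiff 𝓘(ℝ, E) 𝓘(ℝ, ℂ) ∞ f}
  mul_mem' {f g} hf hg := by
    have h : ContDiff ℝ ∞ (fun p : ℂ × ℂ => p.1 * p.2) := contDiff_fst.mul contDiff_snd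
    exact h.contMDiff.comp (ContMDiff.prodMk_space hf hg)
  add_mem' hf hg := ContMDiff.add hf hg
  algebraMap_mem' _ := contMDiff_const

/-- The ideal `𝔪ₓ` of the smooth functions vanishing at `x`. -/
def maxIdeal (x : M) : Ideal (SmoothFn E M) :=
  RingHom.ker ((Pi.evalRingHom (fun _ : M => ℂ) x).comp (SmoothFn E M).val.toRingHom)

/-- A linear differential operator of order at most `r`: a `ℂ`-linear endomorphism of `C^∞(M)`
which maps `𝔪ₓ ^ (r + 1)` into `𝔪ₓ` for every point `x`. -/
def IsDiffOpOfOrder (r : ℕ) (P : SmoothFn E M →ₗ[ℂ] SmoothFn E M) : Prop :=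
  ∀ x : M, ∀ f ∈ (maxIdeal x : Ideal (SmoothFn E M)) ^ (r + 1), P f ∈ maxIdeal x

/-- A linear differential operator (of some finite order). -/
def IsDiffOp (P : SmoothFn E M →ₗ[ℂ] SmoothFn E M) : Prop :=
  ∃ r, IsDiffOpOfOrder r P

/-! ### Symmetric contravariant tensor fields and their Hamiltonians -/

variable (E M) in
/-- The cotangent bundle `T^*M`, as a smooth manifold. -/
abbrev CotangentBundle : Type _ :=
  Bundle.TotalSpace (E →L[ℝ] ℝ) (fun x : M => TangentSpace 𝓘(ℝ, E) x →L[ℝ] ℝ)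

variable (E) in
/-- The model with corners of the manifold `T^*M`. -/
abbrev cotangentModel :
    ModelWithCorners ℝ (E × (E →L[ℝ] ℝ)) (ModelProd E (E →L[ℝ] ℝ)) :=
  𝓘(ℝ, E).prod 𝓘(ℝ, E →L[ℝ] ℝ)

variable (E M) in
/-- Contravariant tensor fields of order `k` with complex values, not necessarily smooth or
symmetric: at each point, a multilinear form in `k` covectors. -/
abbrev ContravariantField (k : ℕ) : Type _ :=
  Π x : M, MultilinearMap ℝ (fun _ : Fin k => TangentSpace 𝓘(ℝ, E) x →L[ℝ] ℝ) ℂ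

variable (E M) in
/-- The smooth symmetric contravariant tensor fields of order `k`. Smoothness is smoothness of the
components in the charts: the covector `β ∘ d(φ_{x₀})ₓ` is the pull-back of the constant covector
`β` of `E` by the chart `φ_{x₀}`. -/
def SymTensorField (k : ℕ) : Submodule ℂ (ContravariantField E M k) where
  carrier := {Φ |
    (∀ (x : M) (α : Fin k → (TangentSpace 𝓘(ℝ, E) x →L[ℝ] ℝ)) (σ : Equiv.Perm (Fin k)),
      Φ x (α ∘ σ) = Φ x α) ∧
    ∀ (x₀ : M) (β : Fin k → (E →L[ℝ] ℝ)),
      ContMDiffOn 𝓘(ℝ, E) 𝓘(ℝ, ℂ) ∞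
        (fun x => Φ x fun i => (β i).comp (mvfderiv 𝓘(ℝ, E) (extChartAt 𝓘(ℝ, E) x₀) x))
        (chartAt E x₀).source}
  add_mem' {Φ Ψ} hΦ hΨ :=
    ⟨fun x α σ => by simp [hΦ.1 x α σ, hΨ.1 x α σ], fun x₀ β => (hΦ.2 x₀ β).add (hΨ.2 x₀ β)⟩
  zero_mem' := ⟨fun _ _ _ => rfl, fun _ _ => contMDiffOn_const⟩
  smul_mem' c Φ hΦ :=
    ⟨fun x α σ => by simp [hΦ.1 x α σ], fun x₀ β => by
      have h : ContDiff ℝ ∞ (fun z : ℂ => c * z) := contDiff_const.mul contDiff_id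
      exact h.contMDiff.comp_contMDiffOn (hΦ.2 x₀ β)⟩

variable (E M) in
/-- Symmetric contravariant tensor fields `Φ = Φ_r + ⋯ + Φ_1 + Φ_0`, not necessarily
homogeneous. -/
abbrev SymTensor : Type _ := DirectSum ℕ fun k => SymTensorField E M k

/-- The Hamiltonian associated with `Φ`: the function `F(α) = ∑ₖ ⟨Φₖ, α ⊗ ⋯ ⊗ α⟩` on `T^*M`,
polynomial along the fibres. -/
def hamiltonian (Φ : SymTensor E M) (α : CotangentBundle E M) : ℂ :=
  ∑ᶠ k : ℕ, (Φ k : ContravariantField E M k) α.proj (fun _ => α.snd)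

/-! ### Quantization defined by a linear connection -/

section Quantization

variable [IsManifold 𝓘(ℝ, E) ∞ M]

/-- The iterated covariant differential `∇^k f`, evaluated on `k` vector fields:
`(∇^{k+1} f)(X₀, …, X_k) =
  X₀((∇^k f)(X₁, …, X_k)) - ∑ᵢ (∇^k f)(X₁, …, ∇_{X₀} Xᵢ, …, X_k)`. In Mathlib the field `∇_X Y` is
written `x ↦ cov Y x (X x)`. -/
def iterCovDiff (cov : CovariantDerivative 𝓘(ℝ, E) E (TangentSpace 𝓘(ℝ, E) : M → Type _))
    (f : M → ℂ) : (k : ℕ) → (Fin k → Π x : M, TangentSpace 𝓘(ℝ, E) x) → M → ℂ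
  | 0, _ => f
  | k + 1, X => fun x =>
      mvfderiv 𝓘(ℝ, E) (iterCovDiff cov f k (Fin.tail X)) x (X 0 x) -
        ∑ i : Fin k, iterCovDiff cov f k
          (Function.update (Fin.tail X) i fun y => cov (Fin.tail X i) y (X 0 y)) x

/-- The value at `x` of the covariant tensor field `∇^k f` on `k` tangent vectors at `x`, computed
by extending the vectors to vector fields that are smooth near `x`. -/
def covDiffAt (cov : CovariantDerivative 𝓘(ℝ, E) E (TangentSpace 𝓘(ℝ, E) : M → Type _))
    (f : M → ℂ) (k : ℕ) (x : M) (v : Fin k → TangentSpace 𝓘(ℝ, E) x) : ℂ :=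
  iterCovDiff cov f k (fun i => FiberBundle.extend E (v i)) x

/-- The symmetrized iterated covariant differential `∇^k_sym f` at `x`. -/
def symCovDiffAt (cov : CovariantDerivative 𝓘(ℝ, E) E (TangentSpace 𝓘(ℝ, E) : M → Type _))
    (f : M → ℂ) (k : ℕ) (x : M) (v : Fin k → TangentSpace 𝓘(ℝ, E) x) : ℂ :=
  (k.factorial : ℂ)⁻¹ * ∑ σ : Equiv.Perm (Fin k), covDiffAt cov f k x (v ∘ σ)

variable [FiniteDimensional ℝ E]

/-- A basis of the tangent space `TₓM`. -/
def tangentBasis (x : M) :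
    Module.Basis (Fin (Module.finrank ℝ E)) ℝ (TangentSpace 𝓘(ℝ, E) x) :=
  Module.finBasis ℝ E

/-- The dual basis of the cotangent space. -/
def cotangentBasis (x : M) (j : Fin (Module.finrank ℝ E)) : TangentSpace 𝓘(ℝ, E) x →L[ℝ] ℝ :=
  (LinearMap.toContinuousLinearMap ((Module.finBasis ℝ E).coord j) : E →L[ℝ] ℝ)

/-- The tensor contraction `⟨Φ, B⟩ = ∑ Φ^{j₁ … j_k} B_{j₁ … j_k}` at a point `x`. -/
def contraction {k : ℕ} {x : M}
    (Φ : MultilinearMap ℝ (fun _ : Fin k => TangentSpace 𝓘(ℝ, E) x →L[ℝ] ℝ) ℂ)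
    (B : (Fin k → TangentSpace 𝓘(ℝ, E) x) → ℂ) : ℂ :=
  ∑ j : Fin k → Fin (Module.finrank ℝ E),
    Φ (fun i => cotangentBasis x (j i)) * B (fun i => tangentBasis x (j i))

/-- The quantization `f ↦ (-iħ)^k ⟨Φ, ∇^k_sym f⟩` of a tensor field of order `k`. -/
def quantizeHom (cov : CovariantDerivative 𝓘(ℝ, E) E (TangentSpace 𝓘(ℝ, E) : M → Type _))
    (ħ : ℝ) {k : ℕ} (Φ : ContravariantField E M k) (f : M → ℂ) (x : M) : ℂ :=
  (-Complex.I * ħ) ^ k * contraction (Φ x) (symCovDiffAt cov f k x)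

/-- The quantization of a non-homogeneous tensor: the sum of the quantizations of its
homogeneous components. -/
def quantize (cov : CovariantDerivative 𝓘(ℝ, E) E (TangentSpace 𝓘(ℝ, E) : M → Type _))
    (ħ : ℝ) (Φ : SymTensor E M) (f : M → ℂ) (x : M) : ℂ :=
  ∑ᶠ k : ℕ, quantizeHom cov ħ (Φ k : ContravariantField E M k) f x

/-- `Φ` is the dequantization of the operator `P`, that is, `P` is the quantization of `Φ`. -/
def IsDequantization
    (cov : CovariantDerivative 𝓘(ℝ, E) E (TangentSpace 𝓘(ℝ, E) : M → Type _)) (ħ : ℝ)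
    (P : SmoothFn E M →ₗ[ℂ] SmoothFn E M) (Φ : SymTensor E M) : Prop :=
  ∀ f : SmoothFn E M, (P f : M → ℂ) = quantize cov ħ Φ f

open Classical in
/-- The dequantization of a differential operator `P`. For a smooth connection and `ħ ≠ 0`, every linear differential operator has exactly one dequantization, so that the last clause (which
makes the function total) concerns only maps `P` which are not differential operators. -/
def dequantize (cov : CovariantDerivative 𝓘(ℝ, E) E (TangentSpace 𝓘(ℝ, E) : M → Type _)) (ħ : ℝ)
    (P : SmoothFn E M →ₗ[ℂ] SmoothFn E M) : SymTensor E M :=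
  if h : ∃ Φ, IsDequantization cov ħ P Φ then h.choose else 0

end Quantization

/-! ### Complex vector fields, the symplectic form and Hamiltonian fields -/

section Symplectic

variable {F H N : Type*} [NormedAddCommGroup F] [NormedSpace ℝ F] [TopologicalSpace H]
  [TopologicalSpace N] [ChartedSpace H N]

/-- Tangent fields with complex coefficients (derivations of the complex-valued functions):
sections of the complexified tangent bundle. -/
abbrev ComplexField (J : ModelWithCorners ℝ F H) (N : Type*) [TopologicalSpace N]
    [ChartedSpace H N] : Type _ :=
  Π p : N, ℂ ⊗[ℝ] TangentSpace J p

/-- The derivative `D G` of a complex-valued function `G` along `D`. -/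
def ComplexField.deriv {J : ModelWithCorners ℝ F H} (D : ComplexField J N) (G : N → ℂ) (p : N) :
    ℂ :=
  LinearMap.liftBaseChange ℂ (mvfderiv J G p).toLinearMap (D p)

/-- The exterior derivative of a `1`-form: `dθ(u, v) = u(θ(v)) - v(θ(u))` for vectors `u`, `v` that
are constant in the chart around `p` (the tangent space `TangentSpace J p` is, in Mathlib, the model
space, seen through that chart). -/
def extDerivOneForm {J : ModelWithCorners ℝ F H} (θ : Π p : N, TangentSpace J p →L[ℝ] ℝ) (p : N) :
    TangentSpace J p →L[ℝ] TangentSpace J p →L[ℝ] ℝ :=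
  let φ := extChartAt J p
  let θ' : F → F →L[ℝ] ℝ := fun y => (θ (φ.symm y)).comp (mfderiv 𝓘(ℝ, F) J φ.symm y)
  let dθ' : F →L[ℝ] F →L[ℝ] ℝ := fderiv ℝ θ' (φ p) - (fderiv ℝ θ' (φ p)).flip
  dθ'

end Symplectic

section Hamiltonian

variable [IsManifold 𝓘(ℝ, E) ∞ M]

variable (E M) in
/-- The Liouville form `θ` on `T^*M`: `θ_α = π^* α`. -/
def liouville (α : CotangentBundle E M) : TangentSpace (cotangentModel E) α →L[ℝ] ℝ :=
  α.snd.comp (mfderiv (cotangentModel E) 𝓘(ℝ, E)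
    (Bundle.TotalSpace.proj : CotangentBundle E M → M) α)

variable (E M) in
/-- The symplectic form `ω₂ = dθ` of `T^*M`; in canonical coordinates `ω₂ = dpⱼ ∧ dxʲ`. -/
def symplecticForm (α : CotangentBundle E M) :
    TangentSpace (cotangentModel E) α →L[ℝ] TangentSpace (cotangentModel E) α →L[ℝ] ℝ :=
  extDerivOneForm (liouville E M) α

/-- The contraction `(D ⌟ ω₂)(v) = ω₂(D, v)` of a complex tangent field `D` on `T^*M` with the
symplectic form, extended complex-linearly in `D`. -/
def contractSymplectic (D : ComplexField (cotangentModel E) (CotangentBundle E M))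
    (α : CotangentBundle E M) (v : TangentSpace (cotangentModel E) α) : ℂ :=
  LinearMap.liftBaseChange ℂ
    ({ toFun := fun u => (symplecticForm E M α u v : ℂ)
       map_add' := fun u w => by
         rw [ContinuousLinearMap.map_add, add_apply, Complex.ofReal_add]
       map_smul' := fun c u => by
         rw [ContinuousLinearMap.map_smul, smul_apply, smul_eq_mul,
           Complex.ofReal_mul, RingHom.id_apply, Complex.real_smul] } : TangentSpace (cotangentModel E) α →ₗ[ℝ] ℂ) (D α)

/-- `D` satisfies `D ⌟ ω₂ + dF = 0`. -/
def IsHamiltonianField (F : CotangentBundle E M → ℂ)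
    (D : ComplexField (cotangentModel E) (CotangentBundle E M)) : Prop :=
  ∀ (α : CotangentBundle E M) (v : TangentSpace (cotangentModel E) α),
    contractSymplectic D α v + mvfderiv (cotangentModel E) F α v = 0

open Classical in
/-- The tangent field `D` on `T^*M` with `D ⌟ ω₂ + dF = 0`. As `ω₂` is non-degenerate and `T^*M` is
finite-dimensional, there is exactly one. -/
def hamiltonianField (F : CotangentBundle E M → ℂ) :
    ComplexField (cotangentModel E) (CotangentBundle E M) :=
  if h : ∃ D, IsHamiltonianField F D then h.choose else 0

/-- The Hamiltonian field `D_P` on `T^*M` associated with a differential operator `P`: it is given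
by `D_P ⌟ ω₂ + dF = 0`, where `F` is the Hamiltonian of the dequantization of `P`. -/
def associatedField [FiniteDimensional ℝ E]
    (cov : CovariantDerivative 𝓘(ℝ, E) E (TangentSpace 𝓘(ℝ, E) : M → Type _)) (ħ : ℝ)
    (P : SmoothFn E M →ₗ[ℂ] SmoothFn E M) :
    ComplexField (cotangentModel E) (CotangentBundle E M) :=
  hamiltonianField (hamiltonian (dequantize cov ħ P))

end Hamiltonian

/-! ### Second order differential equations -/

section SecondOrder

variable [IsManifold 𝓘(ℝ, E) ∞ M]

/-- A tangent field `D` on `TM` is a second order differential equation if, as a derivation, it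
takes each `f ∈ C^∞(M)` to the function `ḟ(u) = df(u)` on `TM`. -/
def IsSecondOrder (D : ComplexField 𝓘(ℝ, E).tangent (TangentBundle 𝓘(ℝ, E) M)) : Prop :=
  ∀ (f : SmoothFn E M) (u : TangentBundle 𝓘(ℝ, E) M),
    D.deriv (fun w => (f : M → ℂ) w.proj) u = mvfderiv 𝓘(ℝ, E) (f : M → ℂ) u.proj u.snd

end SecondOrder

/-! ### Pseudo-Riemannian metrics -/

variable (E M) in
/-- A smooth (pseudo-)Riemannian metric on `M`: a smooth field of non-degenerate symmetric bilinear
forms, of arbitrary signature, on the tangent spaces. -/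
structure PseudoMetric [IsManifold 𝓘(ℝ, E) ∞ M] where
  /-- The bilinear form on the tangent space at a point. -/
  inner (x : M) : TangentSpace 𝓘(ℝ, E) x →L[ℝ] TangentSpace 𝓘(ℝ, E) x →L[ℝ] ℝ
  symm (x : M) (v w : TangentSpace 𝓘(ℝ, E) x) : inner x v w = inner x w v
  nondegenerate (x : M) (v : TangentSpace 𝓘(ℝ, E) x) (hv : ∀ w, inner x v w = 0) : v = 0
  contMDiff : ContMDiff 𝓘(ℝ, E) (𝓘(ℝ, E).prod 𝓘(ℝ, E →L[ℝ] E →L[ℝ] ℝ)) ∞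
    (fun x => Bundle.TotalSpace.mk' (E →L[ℝ] E →L[ℝ] ℝ)
      (E := fun x : M => TangentSpace 𝓘(ℝ, E) x →L[ℝ] TangentSpace 𝓘(ℝ, E) x →L[ℝ] ℝ) x (inner x))

namespace PseudoMetric

variable [IsManifold 𝓘(ℝ, E) ∞ M]

/-- The isomorphism of bundles `TM ≃ T^*M` determined by the metric, `u ↦ g(u, ·)`. -/
def flat (g : PseudoMetric E M) (u : TangentBundle 𝓘(ℝ, E) M) : CotangentBundle E M :=
  ⟨u.proj, g.inner u.proj u.snd⟩

/-- The transport to `TM` of a tangent field on `T^*M` by the isomorphism `TM ≃ T^*M`. -/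
def transport (g : PseudoMetric E M)
    (D : ComplexField (cotangentModel E) (CotangentBundle E M)) :
    ComplexField 𝓘(ℝ, E).tangent (TangentBundle 𝓘(ℝ, E) M) :=
  fun u => LinearMap.baseChange ℂ
    ((mfderiv 𝓘(ℝ, E).tangent (cotangentModel E) g.flat u).inverse).toLinearMap (D (g.flat u))

/-- `∇` is the Levi-Civita connection of the metric: a smooth linear connection on `TM` which has
no torsion and is compatible with the metric. -/
structure IsLeviCivita (g : PseudoMetric E M)
    (cov : CovariantDerivative 𝓘(ℝ, E) E (TangentSpace 𝓘(ℝ, E) : M → Type _)) : Prop where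
  smooth : CovariantDerivative.ContMDiffCovariantDerivative cov ∞
  torsion_free : ∀ (X Y : Π x : M, TangentSpace 𝓘(ℝ, E) x) (x : M),
    MDiffAt (T% X) x → MDiffAt (T% Y) x →
      cov Y x (X x) - cov X x (Y x) = VectorField.mlieBracket 𝓘(ℝ, E) X Y x
  metric : ∀ (X Y Z : Π x : M, TangentSpace 𝓘(ℝ, E) x) (x : M),
    MDiffAt (T% X) x → MDiffAt (T% Y) x → MDiffAt (T% Z) x →
      mvfderiv 𝓘(ℝ, E) (fun y => g.inner y (Y y) (Z y)) x (X x) =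
        g.inner x (cov Y x (X x)) (Z x) + g.inner x (Y x) (cov Z x (X x))

variable [FiniteDimensional ℝ E]

/-- The linear isomorphism `TₓM ≃ Tₓ^*M`, `v ↦ g(v, ·)`. -/
def flatEquiv (g : PseudoMetric E M) (x : M) :
    TangentSpace 𝓘(ℝ, E) x ≃ₗ[ℝ] (TangentSpace 𝓘(ℝ, E) x →L[ℝ] ℝ) :=
  LinearEquiv.ofBijective (g.inner x).toLinearMap (by
    have hinj : Function.Injective (g.inner x).toLinearMap :=
      (injective_iff_map_eq_zero _).2 fun v hv =>
        g.nondegenerate x v fun w => congrArg (fun l => l w) hv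
    have : FiniteDimensional ℝ (TangentSpace 𝓘(ℝ, E) x) := inferInstanceAs (FiniteDimensional ℝ E)
    have hdim : Module.finrank ℝ (TangentSpace 𝓘(ℝ, E) x) =
        Module.finrank ℝ (TangentSpace 𝓘(ℝ, E) x →L[ℝ] ℝ) := by
      have h := (LinearMap.toContinuousLinearMap : (E →ₗ[ℝ] ℝ) ≃ₗ[ℝ] E →L[ℝ] ℝ).finrank_eq
      exact (Subspace.dual_finrank_eq (K := ℝ) (V := E)).symm.trans h
    exact ⟨hinj, (LinearMap.injective_iff_surjective_of_finrank_eq_finrank hdim).1 hinj⟩)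

/-- The tangent vector `α^♯` which corresponds to a covector `α`. -/
def sharp (g : PseudoMetric E M) (x : M) (α : TangentSpace 𝓘(ℝ, E) x →L[ℝ] ℝ) :
    TangentSpace 𝓘(ℝ, E) x :=
  (g.flatEquiv x).symm α

/-- The contravariant form of the metric tensor, `(α, β) ↦ g(α^♯, β^♯)`; in coordinates `gʲᵏ`. -/
def contravariant (g : PseudoMetric E M) : ContravariantField E M 2 := fun x =>
  { toFun := fun α => (g.inner x (g.sharp x (α 0)) (g.sharp x (α 1)) : ℂ)
    map_update_add' := by
      intro _ m i a b
      fin_cases i <;> simp [Function.update, sharp]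
    map_update_smul' := by
      intro _ m i c a
      fin_cases i <;> simp [Function.update, sharp] }

/-- The gradient of a real function. -/
def grad (g : PseudoMetric E M) (u : M → ℝ) (x : M) : TangentSpace 𝓘(ℝ, E) x :=
  g.sharp x (mvfderiv 𝓘(ℝ, E) u x)

/-- The Laplacian `Δu = div grad u` of a real function, where `div X` is the trace of
`v ↦ ∇_v X`. -/
def realLaplacian (g : PseudoMetric E M)
    (cov : CovariantDerivative 𝓘(ℝ, E) E (TangentSpace 𝓘(ℝ, E) : M → Type _)) (u : M → ℝ) (x : M) :
    ℝ :=
  LinearMap.trace ℝ (TangentSpace 𝓘(ℝ, E) x) (cov (g.grad u) x).toLinearMap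

/-- The Laplacian of a complex function, `Δ(u + iv) = Δu + iΔv`. -/
def laplacian (g : PseudoMetric E M)
    (cov : CovariantDerivative 𝓘(ℝ, E) E (TangentSpace 𝓘(ℝ, E) : M → Type _)) (f : M → ℂ) (x : M) :
    ℂ :=
  g.realLaplacian cov (fun y => (f y).re) x + g.realLaplacian cov (fun y => (f y).im) x * Complex.I

end PseudoMetric

end Dequantization

end

open scoped Manifold ContDiff

open scoped Manifold ContDiff Bundle TensorProduct

noncomputable section


/-! Claim (1) is a computation. Compatibility of `cov` with the metric turns the second covariant
differential of a real function into the Hessian g(∇_v grad u, w) (`covDiffAt_two`). Contracting it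
with gʲᵏ gives the trace of v ↦ ∇_v grad u, which is Δu (`contraction_contravariant`), and the
factor is (-iħ)² = -ħ². The components gʲᵏ are smooth by Cramer's rule.

For claim (2), write D_P in canonical coordinates: the equation D ⌟ (dp ∧ dx) + dF = 0 says that the
base component of D_P is ∂F/∂p. Hence the transported field is a second order equation exactly when
the derivative of F at α along the vertical vector β is β(α♯) (`isSecondOrder_transport_iff`). As F
is polynomial on the fibres, restricting this to the rays s ↦ sα leaves only the components of
degree 2 and 0, with F = g(α♯, α♯)/2 + U (`diagonal_of_hasDerivAt`). Polarization then gives Φ = g/2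
+ U, whose quantization is known from (1).

To return from Φ to P one needs existence and uniqueness of the dequantization. Both rest on two
facts about f ∈ 𝔪ₓ: the differential ∇^k kills 𝔪ₓⁿ at x when k < n (`covDiffAt_eq_zero`), and
∇^k(f^k) = k! df ⊗ ⋯ ⊗ df at x (`covDiffAt_pow`). Uniqueness: if a quantization is zero, its top
component vanishes on the diagonal, hence vanishes. Existence: P(f₁⋯fₙ)(x), for P of order at most n
and fᵢ ∈ 𝔪ₓ, depends only on the differentials of the fᵢ at x, since by Hadamard's lemma 𝔪ₓ²
consists of the elements of 𝔪ₓ with zero differential. Suitably normalized, this symbol is a tensor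
field whose quantization agrees with P to top order (`exists_sub_quantizeHomOp`); subtract it and
induct on the order. -/

namespace Dequantization

variable {E : Type*} [NormedAddCommGroup E] [NormedSpace ℝ E]
  {M : Type*} [TopologicalSpace M] [ChartedSpace E M]

set_option linter.unusedSectionVars false

/-! ### Smooth functions, vector fields and connections on open sets. -/

section Calculus

open Set Filter Topology

variable {F : Type*} [NormedAddCommGroup F] [NormedSpace ℝ F]

/-- Smoothness on `U` of a function with values in a normed space. -/
abbrev SmoothOn (f : M → F) (U : Set M) : Prop := ContMDiffOn 𝓘(ℝ, E) 𝓘(ℝ, F) ∞ f U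

variable [IsManifold 𝓘(ℝ, E) ∞ M]

/-- Smoothness on `U` of a vector field. -/
abbrev SmoothFieldOn (X : Π x : M, TangentSpace 𝓘(ℝ, E) x) (U : Set M) : Prop :=
  ContMDiffOn 𝓘(ℝ, E) 𝓘(ℝ, E).tangent ∞ (fun x => (⟨x, X x⟩ : TangentBundle 𝓘(ℝ, E) M)) U

theorem SmoothOn.mdifferentiableAt {f : M → F} {U : Set M} (hU : IsOpen U)
    (hf : SmoothOn (E := E) f U) {x : M} (hx : x ∈ U) :
    MDifferentiableAt 𝓘(ℝ, E) 𝓘(ℝ, F) f x :=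
  (hf.contMDiffAt (hU.mem_nhds hx)).mdifferentiableAt (by simp)

theorem SmoothFieldOn.mdifferentiableAt {X : Π x : M, TangentSpace 𝓘(ℝ, E) x} {U : Set M}
    (hU : IsOpen U) (hX : SmoothFieldOn X U) {x : M} (hx : x ∈ U) :
    MDiffAt (T% X) x :=
  (hX.contMDiffAt (hU.mem_nhds hx)).mdifferentiableAt (by simp)

theorem SmoothOn.mvfderiv_apply {f : M → F} {X : Π x : M, TangentSpace 𝓘(ℝ, E) x} {U : Set M}
    (hU : IsOpen U) (hf : SmoothOn (E := E) f U) (hX : SmoothFieldOn X U) :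
    SmoothOn (E := E) (fun x => mvfderiv 𝓘(ℝ, E) f x (X x)) U := by
  have h1 := hf.contMDiffOn_tangentMapWithin (m := ∞) (by simp) hU.uniqueMDiffOn
  have h2 := h1.comp hX (fun x hx => hx)
  have h3 := (contMDiff_snd_tangentBundle_modelSpace F 𝓘(ℝ, F) (n := ∞)).comp_contMDiffOn h2
  refine h3.congr fun x hx => ?_
  simp only [Function.comp, tangentMapWithin, mfderivWithin_of_isOpen hU hx]
  rfl

theorem SmoothFieldOn.add {X Y : Π x : M, TangentSpace 𝓘(ℝ, E) x} {U : Set M}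
    (hX : SmoothFieldOn X U) (hY : SmoothFieldOn Y U) : SmoothFieldOn (X + Y) U :=
  ContMDiffOn.add_section hX hY

theorem SmoothFieldOn.smul {X : Π x : M, TangentSpace 𝓘(ℝ, E) x} {h : M → ℝ} {U : Set M}
    (hh : SmoothOn (E := E) h U) (hX : SmoothFieldOn X U) : SmoothFieldOn (h • X) U :=
  ContMDiffOn.smul_section hh hX

variable [FiniteDimensional ℝ E]

/-- The extension has constant coordinates in the trivialization at `x`, so the whole chart domain
serves as a common open set for all fields extended from `x`. -/
theorem smoothFieldOn_extend {x : M} (v : TangentSpace 𝓘(ℝ, E) x) :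
    SmoothFieldOn (FiberBundle.extend E v) (chartAt E x).source := by
  intro y hy
  set t := trivializationAt E (TangentSpace 𝓘(ℝ, E) : M → Type _) x with ht
  have hy' : y ∈ t.baseSet := hy
  rw [t.contMDiffWithinAt_section _ hy']
  have : ContMDiffOn 𝓘(ℝ, E) 𝓘(ℝ, E) ∞ (fun _ : M => (t ⟨x, v⟩).2) t.baseSet := contMDiffOn_const
  exact (this.congr fun z hz => by simp [FiberBundle.extend, ← ht, hz]) y hy

variable [T2Space M] {cov : CovariantDerivative 𝓘(ℝ, E) E (TangentSpace 𝓘(ℝ, E) : M → Type _)}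

theorem exists_smoothBump {U : Set M} {x : M} (hU : U ∈ 𝓝 x) :
    ∃ χ : M → ℝ, ContMDiff 𝓘(ℝ, E) 𝓘(ℝ, ℝ) ∞ χ ∧ tsupport χ ⊆ U ∧ ∀ᶠ y in 𝓝 x, χ y = 1 := by
  obtain ⟨f, hf, -⟩ := (SmoothBumpFunction.nhds_basis_support (I := 𝓘(ℝ, E)) hU).mem_iff.1 hU
  exact ⟨f, f.contMDiff, hf, f.eventuallyEq_one⟩

/-- The smoothness of `cov` is applied to globally smooth fields, whereas `Y` is smooth only on `U`.
Multiplying `Y` by a bump function equal to 1 near the point makes it global, and locality of the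
connection shows that nothing changes near the point. -/
theorem SmoothFieldOn.covariantDerivative {X Y : Π x : M, TangentSpace 𝓘(ℝ, E) x} {U : Set M}
    (hcov : CovariantDerivative.ContMDiffCovariantDerivative cov ∞)
    (hU : IsOpen U) (hX : SmoothFieldOn X U) (hY : SmoothFieldOn Y U) :
    SmoothFieldOn (fun x => cov Y x (X x)) U := by
  intro x hx
  obtain ⟨χ, hχ, hχU, hχ1⟩ := exists_smoothBump (E := E) (hU.mem_nhds hx)
  have hY' : ContMDiff 𝓘(ℝ, E) 𝓘(ℝ, E).tangent ∞ (T% (χ • Y)) :=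
    ContMDiffOn.smul_section_of_tsupport hχ.contMDiffOn hU hχU hY
  have h1 := (hcov.contMDiff.contMDiff (σ := χ • Y) (by simpa using! hY'.contMDiffOn))
  have h2 := (h1.mono (subset_univ U)).clm_bundle_apply hX
  have h3 := h2.contMDiffAt (hU.mem_nhds hx)
  refine (h3.congr_of_eventuallyEq ?_).contMDiffWithinAt
  filter_upwards [hχ1.eventually_nhds, hU.mem_nhds hx] with y hy hyU
  have : cov Y y = cov (χ • Y) y :=
    cov.isCovariantDerivativeOnUniv.congr_of_eventuallyEq (hY.mdifferentiableAt hU hyU)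
      (hY'.mdifferentiableAt (by simp) ) univ_mem (by
        filter_upwards [hy] with z hz
        simp [hz])
  rw [this]

end Calculus

/-! ### Iterated covariant differentials: smoothness, locality, linearity over functions. -/

section IteratedDifferential

open Set Filter Topology

theorem mvfderiv_congr {F : Type*} [NormedAddCommGroup F] [NormedSpace ℝ F] {f g : M → F} {x : M}
    (h : f =ᶠ[𝓝 x] g) : mvfderiv 𝓘(ℝ, E) f x = mvfderiv 𝓘(ℝ, E) g x := by
  have h1 : mfderiv 𝓘(ℝ, E) 𝓘(ℝ, F) f x = mfderiv 𝓘(ℝ, E) 𝓘(ℝ, F) g x := h.mfderiv_eq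
  ext v
  exact congrArg (fun l : E →L[ℝ] F => l v) h1

variable [IsManifold 𝓘(ℝ, E) ∞ M] [FiniteDimensional ℝ E] [T2Space M]
  {cov : CovariantDerivative 𝓘(ℝ, E) E (TangentSpace 𝓘(ℝ, E) : M → Type _)}

theorem SmoothFieldOn.update {k : ℕ} {X : Fin k → Π x : M, TangentSpace 𝓘(ℝ, E) x} {U : Set M}
    (hX : ∀ i, SmoothFieldOn (X i) U) {Y : Π x : M, TangentSpace 𝓘(ℝ, E) x}
    (hY : SmoothFieldOn Y U) (i : Fin k) : ∀ j, SmoothFieldOn (Function.update X i Y j) U := by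
  intro j
  rcases eq_or_ne j i with rfl | h
  · simpa using hY
  · simpa [h] using hX j

theorem SmoothOn.iterCovDiff (hcov : CovariantDerivative.ContMDiffCovariantDerivative cov ∞)
    {U : Set M} (hU : IsOpen U) {f : M → ℂ} (hf : SmoothOn (E := E) f U) :
    ∀ (k : ℕ) {X : Fin k → Π x : M, TangentSpace 𝓘(ℝ, E) x}, (∀ i, SmoothFieldOn (X i) U) →
      SmoothOn (E := E) (iterCovDiff cov f k X) U
  | 0, _, _ => hf
  | k + 1, X, hX => by
      have hT : ∀ i, SmoothFieldOn (Fin.tail X i) U := fun i => hX i.succ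
      have h1 := (SmoothOn.iterCovDiff hcov hU hf k hT).mvfderiv_apply hU (hX 0)
      have h2 : ∀ i : Fin k, SmoothOn (E := E) (Dequantization.iterCovDiff cov f k
          (Function.update (Fin.tail X) i fun y => cov (Fin.tail X i) y (X 0 y))) U := fun i =>
        SmoothOn.iterCovDiff hcov hU hf k
          (SmoothFieldOn.update hT (.covariantDerivative hcov hU (hX 0) (hT i)) i)
      exact h1.sub (contMDiffOn_finsetSum fun i _ => h2 i)

/-- Equality on an open set, rather than at a point, is what the induction can carry, because each
stage differentiates the previous one. -/
theorem iterCovDiff_congr (hcov : CovariantDerivative.ContMDiffCovariantDerivative cov ∞)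
    {U : Set M} (hU : IsOpen U) (f : M → ℂ) :
    ∀ (k : ℕ) {X Y : Fin k → Π x : M, TangentSpace 𝓘(ℝ, E) x}, (∀ i, SmoothFieldOn (X i) U) →
      (∀ i, SmoothFieldOn (Y i) U) → (∀ i, ∀ x ∈ U, X i x = Y i x) →
      EqOn (iterCovDiff cov f k X) (iterCovDiff cov f k Y) U
  | 0, _, _, _, _, _ => fun _ _ => rfl
  | k + 1, X, Y, hX, hY, h => by
      intro x hx
      have hTX : ∀ i, SmoothFieldOn (Fin.tail X i) U := fun i => hX i.succ
      have hTY : ∀ i, SmoothFieldOn (Fin.tail Y i) U := fun i => hY i.succ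
      have h1 : iterCovDiff cov f k (Fin.tail X) =ᶠ[𝓝 x] iterCovDiff cov f k (Fin.tail Y) :=
        (iterCovDiff_congr hcov hU f k hTX hTY fun i => h i.succ).eventuallyEq_of_mem
          (hU.mem_nhds hx)
      have h2 : ∀ i : Fin k, ∀ y ∈ U, cov (Fin.tail X i) y (X 0 y) =
          cov (Fin.tail Y i) y (Y 0 y) := by
        intro i y hy
        have : cov (Fin.tail X i) y = cov (Fin.tail Y i) y :=
          cov.isCovariantDerivativeOn.congr_of_eqOn ((hTX i).mdifferentiableAt hU hy)
            ((hTY i).mdifferentiableAt hU hy) (hU.mem_nhds hy) (h i.succ)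
        rw [this, h 0 y hy]
      simp only [iterCovDiff]
      rw [mvfderiv_congr h1, h 0 x hx]
      congr 1
      refine Finset.sum_congr rfl fun i _ => ?_
      refine iterCovDiff_congr hcov hU f k
        (SmoothFieldOn.update hTX (.covariantDerivative hcov hU (hX 0) (hTX i)) i)
        (SmoothFieldOn.update hTY (.covariantDerivative hcov hU (hY 0) (hTY i)) i) ?_ hx
      intro j
      rcases eq_or_ne j i with rfl | hj
      · simpa using h2 j
      · intro y hy
        rw [Function.update_of_ne hj, Function.update_of_ne hj]
        exact h j.succ y hy

/-- The Leibniz term dh(X₀) coming from the derivative of h·(∇^k f)(…, Y, …) cancels against the one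
in ∇_{X₀}(hY). Additivity and homogeneity are treated together so that a single induction suffices.
-/
theorem iterCovDiff_update_smul_add
    (hcov : CovariantDerivative.ContMDiffCovariantDerivative cov ∞)
    {U : Set M} (hU : IsOpen U) {f : M → ℂ} (hf : SmoothOn (E := E) f U) :
    ∀ (k : ℕ) {X : Fin k → Π x : M, TangentSpace 𝓘(ℝ, E) x}, (∀ i, SmoothFieldOn (X i) U) →
      ∀ (i : Fin k) {Y Z : Π x : M, TangentSpace 𝓘(ℝ, E) x} {h : M → ℝ}, SmoothFieldOn Y U →
      SmoothFieldOn Z U → SmoothOn (E := E) h U → ∀ x ∈ U,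
      iterCovDiff cov f k (Function.update X i (h • Y + Z)) x =
        h x • iterCovDiff cov f k (Function.update X i Y) x +
          iterCovDiff cov f k (Function.update X i Z) x
  | 0, _, _, i, _, _, _, _, _, _ => i.elim0
  | k + 1, X, hX, i, Y, Z, h, hY, hZ, hh => by
      intro x hx
      have hT : ∀ i, SmoothFieldOn (Fin.tail X i) U := fun i => hX i.succ
      have IH := @iterCovDiff_update_smul_add hcov U hU f hf k
      -- Slot 0 is the direction of differentiation, where linearity is immediate; the cancellation
      -- occurs in the other slots.
      refine Fin.cases ?_ (fun i => ?_) i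
      · simp only [iterCovDiff, Fin.tail_update_zero, Function.update_self]
        have h1 : ∀ j : Fin k, iterCovDiff cov f k (Function.update (Fin.tail X) j
            fun y => cov (Fin.tail X j) y ((h • Y + Z) y)) x =
            h x • iterCovDiff cov f k (Function.update (Fin.tail X) j
              fun y => cov (Fin.tail X j) y (Y y)) x +
            iterCovDiff cov f k (Function.update (Fin.tail X) j
              fun y => cov (Fin.tail X j) y (Z y)) x := by
          intro j
          rw [← IH hT j (.covariantDerivative hcov hU hY (hT j))
            (.covariantDerivative hcov hU hZ (hT j)) hh x hx]
          congr 2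
          funext y
          simp
        simp only [h1, Finset.sum_add_distrib, ← Finset.smul_sum]
        simp only [Pi.add_apply, Pi.smul_apply', map_add, map_smul, smul_sub]
        abel
      · have hYZ : SmoothFieldOn (h • Y + Z) U := (hY.smul hh).add hZ
        set W := Fin.tail X with hW
        set A := iterCovDiff cov f k (Function.update W i Y) with hA
        set B := iterCovDiff cov f k (Function.update W i Z) with hB
        have hAs : SmoothOn (E := E) A U :=
          SmoothOn.iterCovDiff hcov hU hf k (SmoothFieldOn.update hT hY i)
        have hBs : SmoothOn (E := E) B U :=
          SmoothOn.iterCovDiff hcov hU hf k (SmoothFieldOn.update hT hZ i)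
        have hd : mvfderiv 𝓘(ℝ, E) (iterCovDiff cov f k (Function.update W i (h • Y + Z))) x (X 0 x) =
            h x • mvfderiv 𝓘(ℝ, E) A x (X 0 x) + mvfderiv 𝓘(ℝ, E) h x (X 0 x) • A x +
              mvfderiv 𝓘(ℝ, E) B x (X 0 x) := by
          have h1 : iterCovDiff cov f k (Function.update W i (h • Y + Z)) =ᶠ[𝓝 x] h • A + B := by
            filter_upwards [hU.mem_nhds hx] with y hy
            exact IH hT i hY hZ hh y hy
          have h2 := SmoothOn.mdifferentiableAt hU hAs hx
          have h3 := SmoothOn.mdifferentiableAt hU hBs hx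
          have h4 := SmoothOn.mdifferentiableAt hU hh hx
          rw [mvfderiv_congr h1, mvfderiv_add (h4.smul h2) h3, mvfderiv_smul h4 h2]
          simp
        -- Only the correction term that differentiates the modified slot, j = i, produces the extra
        -- dh(X₀) term.
        have hsum : ∀ j : Fin k, iterCovDiff cov f k (Function.update
            (Function.update W i (h • Y + Z)) j
              fun y => cov (Function.update W i (h • Y + Z) j) y (X 0 y)) x =
            h x • iterCovDiff cov f k (Function.update
              (Function.update W i Y) j fun y => cov (Function.update W i Y j) y (X 0 y)) x +
            iterCovDiff cov f k (Function.update
              (Function.update W i Z) j fun y => cov (Function.update W i Z j) y (X 0 y)) x +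
            if j = i then mvfderiv 𝓘(ℝ, E) h x (X 0 x) • A x else 0 := by
          intro j
          rcases eq_or_ne j i with rfl | hj
          · simp only [Function.update_self, Function.update_idem, if_true]
            have hcY := SmoothFieldOn.covariantDerivative hcov hU (hX 0) hY
            have hcZ := SmoothFieldOn.covariantDerivative hcov hU (hX 0) hZ
            have hcYZ := SmoothFieldOn.covariantDerivative hcov hU (hX 0) hYZ
            have hdh := SmoothOn.mvfderiv_apply hU hh (hX 0)
            have e : ∀ y ∈ U, cov (h • Y + Z) y (X 0 y) =
                h y • cov Y y (X 0 y) +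
                  (mvfderiv 𝓘(ℝ, E) h y (X 0 y) • Y y + cov Z y (X 0 y)) := by
              intro y hy
              have e1 := cov.isCovariantDerivativeOnUniv.add
                ((hY.smul hh).mdifferentiableAt hU hy) (hZ.mdifferentiableAt hU hy) (mem_univ _)
              have e2 := cov.isCovariantDerivativeOnUniv.leibniz
                (hY.mdifferentiableAt hU hy) (hh.mdifferentiableAt hU hy) (mem_univ _)
              rw [e1, e2, ← add_assoc]
              rfl
            rw [iterCovDiff_congr hcov hU f k (SmoothFieldOn.update hT hcYZ j)
              (SmoothFieldOn.update hT ((hcY.smul hh).add ((hY.smul hdh).add hcZ)) j) _ hx,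
              IH hT j hcY ((hY.smul hdh).add hcZ) hh x hx, IH hT j hY hcZ hdh x hx]
            · simp only [hA]
              abel
            · intro l
              rcases eq_or_ne l j with rfl | hl
              · simpa using e
              · intro y _
                rw [Function.update_of_ne hl, Function.update_of_ne hl]
          · simp only [hj, if_false, add_zero]
            simp only [Function.update_of_ne hj, Function.update_comm (Ne.symm hj)]
            exact IH (SmoothFieldOn.update hT (.covariantDerivative hcov hU (hX 0) (hT j)) j)
              i hY hZ hh x hx
        have h0 : ∀ V : Π x : M, TangentSpace 𝓘(ℝ, E) x, Function.update X i.succ V 0 = X 0 :=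
          fun V => Function.update_of_ne (Fin.succ_ne_zero i).symm _ _
        simp only [iterCovDiff, Fin.tail_update_succ, h0]
        rw [hd, Finset.sum_congr rfl fun j _ => hsum j]
        simp only [Finset.sum_add_distrib, ← Finset.smul_sum, Finset.sum_ite_eq',
          Finset.mem_univ, if_true, smul_sub]
        abel

end IteratedDifferential

/-! ### Tensoriality: the value at a point depends only on the vectors there. -/

section Tensoriality

open Set Filter Topology

theorem mvfderiv_mul_complex {f g : M → ℂ} {x : M}
    (hf : MDifferentiableAt 𝓘(ℝ, E) 𝓘(ℝ, ℂ) f x) (hg : MDifferentiableAt 𝓘(ℝ, E) 𝓘(ℝ, ℂ) g x)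
    (v : TangentSpace 𝓘(ℝ, E) x) :
    mvfderiv 𝓘(ℝ, E) (f * g) x v = f x * mvfderiv 𝓘(ℝ, E) g x v + g x * mvfderiv 𝓘(ℝ, E) f x v := by
  have h := (hf.hasMFDerivAt.mul hg.hasMFDerivAt).mfderiv
  exact congrArg (fun l : E →L[ℝ] ℂ => l v) h

theorem mvfderiv_const_mul_complex (c : ℂ) {f : M → ℂ} {x : M}
    (hf : MDifferentiableAt 𝓘(ℝ, E) 𝓘(ℝ, ℂ) f x) (v : TangentSpace 𝓘(ℝ, E) x) :
    mvfderiv 𝓘(ℝ, E) (fun y => c * f y) x v = c * mvfderiv 𝓘(ℝ, E) f x v := by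
  have := mvfderiv_mul_complex (f := fun _ : M => c) mdifferentiableAt_const hf v
  rw [mvfderiv_const] at this
  simpa using! this

theorem SmoothOn.mul {f g : M → ℂ} {U : Set M} (hf : SmoothOn (E := E) f U)
    (hg : SmoothOn (E := E) g U) : SmoothOn (E := E) (f * g) U := by
  have h : ContDiff ℝ ∞ (fun p : ℂ × ℂ => p.1 * p.2) := contDiff_fst.mul contDiff_snd
  exact h.contMDiff.comp_contMDiffOn (hf.prodMk_space hg)

theorem SmoothOn.const_mul (c : ℂ) {f : M → ℂ} {U : Set M} (hf : SmoothOn (E := E) f U) :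
    SmoothOn (E := E) (fun y => c * f y) U :=
  SmoothOn.mul (f := fun _ => c) contMDiffOn_const hf

variable [IsManifold 𝓘(ℝ, E) ∞ M] [FiniteDimensional ℝ E] [T2Space M]
  {cov : CovariantDerivative 𝓘(ℝ, E) E (TangentSpace 𝓘(ℝ, E) : M → Type _)}

theorem iterCovDiff_smul_add_fun (hcov : CovariantDerivative.ContMDiffCovariantDerivative cov ∞)
    {U : Set M} (hU : IsOpen U) {f g : M → ℂ} (c : ℂ) (hf : SmoothOn (E := E) f U)
    (hg : SmoothOn (E := E) g U) :
    ∀ (k : ℕ) {X : Fin k → Π x : M, TangentSpace 𝓘(ℝ, E) x}, (∀ i, SmoothFieldOn (X i) U) →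
      ∀ x ∈ U, iterCovDiff cov (fun y => c * f y + g y) k X x =
        c * iterCovDiff cov f k X x + iterCovDiff cov g k X x
  | 0, _, _, _, _ => rfl
  | k + 1, X, hX, x, hx => by
      have hT : ∀ i, SmoothFieldOn (Fin.tail X i) U := fun i => hX i.succ
      have hA := SmoothOn.iterCovDiff hcov hU hf k hT
      have hB := SmoothOn.iterCovDiff hcov hU hg k hT
      have h1 : iterCovDiff cov (fun y => c * f y + g y) k (Fin.tail X) =ᶠ[𝓝 x]
          (fun y => c * iterCovDiff cov f k (Fin.tail X) y) + iterCovDiff cov g k (Fin.tail X) := by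
        filter_upwards [hU.mem_nhds hx] with y hy
        exact iterCovDiff_smul_add_fun hcov hU c hf hg k hT y hy
      simp only [iterCovDiff]
      rw [mvfderiv_congr h1, mvfderiv_add
        ((hA.const_mul c).mdifferentiableAt hU hx) (hB.mdifferentiableAt hU hx), add_apply,
        mvfderiv_const_mul_complex c (hA.mdifferentiableAt hU hx),
        Finset.sum_congr rfl fun i _ => iterCovDiff_smul_add_fun hcov hU c hf hg k
          (SmoothFieldOn.update hT (.covariantDerivative hcov hU (hX 0) (hT i)) i) x hx,
        Finset.sum_add_distrib, ← Finset.mul_sum]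
      ring

theorem smoothFieldOn_zero {U : Set M} :
    SmoothFieldOn (0 : Π x : M, TangentSpace 𝓘(ℝ, E) x) U :=
  (Bundle.contMDiff_zeroSection ℝ (TangentSpace 𝓘(ℝ, E) : M → Type _)).contMDiffOn

theorem iterCovDiff_update_zero (hcov : CovariantDerivative.ContMDiffCovariantDerivative cov ∞)
    {U : Set M} (hU : IsOpen U) {f : M → ℂ} (hf : SmoothOn (E := E) f U) {k : ℕ}
    {X : Fin k → Π x : M, TangentSpace 𝓘(ℝ, E) x} (hX : ∀ i, SmoothFieldOn (X i) U) (i : Fin k)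
    {x : M} (hx : x ∈ U) : iterCovDiff cov f k (Function.update X i 0) x = 0 := by
  have := iterCovDiff_update_smul_add hcov hU hf k hX i (Y := 0) (Z := 0) (h := fun _ => 1)
    smoothFieldOn_zero smoothFieldOn_zero contMDiffOn_const x hx
  simpa using this

theorem iterCovDiff_update_sum (hcov : CovariantDerivative.ContMDiffCovariantDerivative cov ∞)
    {U : Set M} (hU : IsOpen U) {f : M → ℂ} (hf : SmoothOn (E := E) f U) {k : ℕ}
    {X : Fin k → Π x : M, TangentSpace 𝓘(ℝ, E) x} (hX : ∀ i, SmoothFieldOn (X i) U) (i : Fin k)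
    {ι : Type*} (s : Finset ι) {c : ι → M → ℝ} {Y : ι → Π x : M, TangentSpace 𝓘(ℝ, E) x}
    (hc : ∀ j, SmoothOn (E := E) (c j) U) (hY : ∀ j, SmoothFieldOn (Y j) U)
    {x : M} (hx : x ∈ U) :
    SmoothFieldOn (∑ j ∈ s, c j • Y j) U ∧
    iterCovDiff cov f k (Function.update X i (∑ j ∈ s, c j • Y j)) x =
      ∑ j ∈ s, c j x • iterCovDiff cov f k (Function.update X i (Y j)) x := by
  classical
  induction s using Finset.induction_on with
  | empty => exact ⟨by simpa using! smoothFieldOn_zero,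
      by simpa using iterCovDiff_update_zero hcov hU hf hX i hx⟩
  | insert a s ha ih =>
      rw [Finset.sum_insert ha, Finset.sum_insert ha]
      exact ⟨((hY a).smul (hc a)).add ih.1, by
        rw [iterCovDiff_update_smul_add hcov hU hf k hX i (hY a) ih.1 (hc a) x hx, ih.2]⟩

/-- Expand `V` in a local frame: linearity over functions takes out the coefficients, and these
vanish at `x`. -/
theorem iterCovDiff_update_eq_zero (hcov : CovariantDerivative.ContMDiffCovariantDerivative cov ∞)
    {U : Set M} (hU : IsOpen U) {f : M → ℂ} (hf : SmoothOn (E := E) f U) {k : ℕ}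
    {X : Fin k → Π x : M, TangentSpace 𝓘(ℝ, E) x} (hX : ∀ i, SmoothFieldOn (X i) U) (i : Fin k)
    {V : Π x : M, TangentSpace 𝓘(ℝ, E) x} (hV : SmoothFieldOn V U)
    {x : M} (hx : x ∈ U) (hVx : V x = 0) :
    iterCovDiff cov f k (Function.update X i V) x = 0 := by
  set t := trivializationAt E (TangentSpace 𝓘(ℝ, E) : M → Type _) x
  let b := Module.finBasis ℝ E
  set W := U ∩ t.baseSet
  have hW : IsOpen W := hU.inter t.open_baseSet
  have hWU : W ⊆ U := inter_subset_left
  have hxW : x ∈ W := ⟨hx, FiberBundle.mem_baseSet_trivializationAt' x⟩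
  have hc : ∀ j, SmoothOn (E := E) (fun y => t.localFrameCoeff 𝓘(ℝ, E) b j y (V y)) W := fun j =>
    contMDiffOn_localFrameCoeff b hW inter_subset_right (hV.mono hWU) j
  have hY : ∀ j, SmoothFieldOn (t.localFrame b j) W := fun j =>
    (t.contMDiffOn_localFrame_baseSet ∞ b j).mono inter_subset_right
  have h := iterCovDiff_update_sum hcov hW (hf.mono hWU) (fun i => (hX i).mono hWU) i
    Finset.univ hc hY hxW
  rw [iterCovDiff_congr hcov hW f k (SmoothFieldOn.update (fun i => (hX i).mono hWU)
    (hV.mono hWU) i) (SmoothFieldOn.update (fun i => (hX i).mono hWU) h.1 i) _ hxW, h.2]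
  · simp [hVx]
  · intro l y hy
    rcases eq_or_ne l i with rfl | hl
    · simpa using t.eq_sum_localFrameCoeff_smul (I := 𝓘(ℝ, E)) (b := b) (s := V) hy.2
    · rw [Function.update_of_ne hl, Function.update_of_ne hl]

/-- The value of `∇^k f` at `x` depends only on the values of the vector fields at `x`. -/
theorem iterCovDiff_eq_of_apply_eq
    (hcov : CovariantDerivative.ContMDiffCovariantDerivative cov ∞)
    {U : Set M} (hU : IsOpen U) {f : M → ℂ} (hf : SmoothOn (E := E) f U) {k : ℕ}
    {X Y : Fin k → Π x : M, TangentSpace 𝓘(ℝ, E) x} (hX : ∀ i, SmoothFieldOn (X i) U)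
    (hY : ∀ i, SmoothFieldOn (Y i) U) {x : M} (hx : x ∈ U) (h : ∀ i, X i x = Y i x) :
    iterCovDiff cov f k X x = iterCovDiff cov f k Y x := by
  classical
  -- The fields are exchanged one slot at a time; each exchange alters the argument by Y a - X a,
  -- which vanishes at `x`.
  suffices H : ∀ s : Finset (Fin k), iterCovDiff cov f k (s.piecewise Y X) x =
      iterCovDiff cov f k X x by
    rw [← H Finset.univ, Finset.piecewise_univ]
  intro s
  induction s using Finset.induction_on with
  | empty => rw [Finset.piecewise_empty]
  | insert a s ha ih =>
      have hs : ∀ i, SmoothFieldOn (s.piecewise Y X i) U := fun i => by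
        by_cases hi : i ∈ s
        · simpa [hi] using hY i
        · simpa [hi] using hX i
      have hneg : SmoothFieldOn ((fun _ : M => (-1 : ℝ)) • X a) U := (hX a).smul contMDiffOn_const
      have hd : SmoothFieldOn (Y a + (fun _ : M => (-1 : ℝ)) • X a) U := (hY a).add hneg
      have e : Y a = (fun _ : M => (1 : ℝ)) • (Y a + (fun _ : M => (-1 : ℝ)) • X a) + X a := by
        funext y
        simp
      rw [Finset.piecewise_insert, e, iterCovDiff_update_smul_add hcov hU hf k hs a hd (hX a)
        contMDiffOn_const x hx, iterCovDiff_update_eq_zero hcov hU hf hs a hd hx (by simp [h a])]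
      have : Function.update (s.piecewise Y X) a (X a) = s.piecewise Y X := by
        rw [Function.update_eq_self_iff, Finset.piecewise_eq_of_notMem _ _ _ ha]
      rw [this, ih]
      simp

/-- This frees `covDiffAt` from the particular extension in its definition: later the value is
computed with a chart frame, which is smooth in the base point. -/
theorem covDiffAt_eq (hcov : CovariantDerivative.ContMDiffCovariantDerivative cov ∞)
    {U : Set M} (hU : IsOpen U) {f : M → ℂ} (hf : SmoothOn (E := E) f U) {k : ℕ}
    {X : Fin k → Π x : M, TangentSpace 𝓘(ℝ, E) x} (hX : ∀ i, SmoothFieldOn (X i) U)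
    {x : M} (hx : x ∈ U) (v : Fin k → TangentSpace 𝓘(ℝ, E) x) (h : ∀ i, X i x = v i) :
    covDiffAt cov f k x v = iterCovDiff cov f k X x := by
  have hW : IsOpen (U ∩ (chartAt E x).source) := hU.inter (chartAt E x).open_source
  exact iterCovDiff_eq_of_apply_eq hcov hW (hf.mono inter_subset_left)
    (fun i => (smoothFieldOn_extend (v i)).mono inter_subset_right)
    (fun i => (hX i).mono inter_subset_left) ⟨hx, mem_chart_source E x⟩ (fun i => by simp [h i])

theorem covDiffAt_update (hcov : CovariantDerivative.ContMDiffCovariantDerivative cov ∞)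
    {f : M → ℂ} (hf : ContMDiff 𝓘(ℝ, E) 𝓘(ℝ, ℂ) ∞ f) {k : ℕ} {x : M}
    (m : Fin k → TangentSpace 𝓘(ℝ, E) x) (i : Fin k) {V : Π x : M, TangentSpace 𝓘(ℝ, E) x}
    (hV : SmoothFieldOn V (chartAt E x).source) :
    covDiffAt cov f k x (Function.update m i (V x)) = iterCovDiff cov f k
      (Function.update (fun j => FiberBundle.extend E (m j)) i V) x := by
  refine covDiffAt_eq hcov (chartAt E x).open_source hf.contMDiffOn
    (SmoothFieldOn.update (fun j => smoothFieldOn_extend (m j)) hV i) (mem_chart_source E x) _ ?_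
  intro j
  rcases eq_or_ne j i with rfl | hj
  · simp
  · simp [hj]

theorem covDiffAt_update_smul_add
    (hcov : CovariantDerivative.ContMDiffCovariantDerivative cov ∞)
    {f : M → ℂ} (hf : ContMDiff 𝓘(ℝ, E) 𝓘(ℝ, ℂ) ∞ f) {k : ℕ} {x : M}
    (m : Fin k → TangentSpace 𝓘(ℝ, E) x) (i : Fin k) (c : ℝ) (a b : TangentSpace 𝓘(ℝ, E) x) :
    covDiffAt cov f k x (Function.update m i (c • a + b)) =
      c • covDiffAt cov f k x (Function.update m i a) +
        covDiffAt cov f k x (Function.update m i b) := by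
  have ha := smoothFieldOn_extend a
  have hb := smoothFieldOn_extend b
  have key := iterCovDiff_update_smul_add hcov (chartAt E x).open_source
    (hf.contMDiffOn (s := (chartAt E x).source)) k (fun j => smoothFieldOn_extend (m j)) i ha hb
    (h := fun _ => c) contMDiffOn_const x (mem_chart_source E x)
  rw [← covDiffAt_update hcov hf m i ha, ← covDiffAt_update hcov hf m i hb,
    ← covDiffAt_update hcov hf m i ((ha.smul contMDiffOn_const).add hb)] at key
  simpa using key

/-- The covariant tensor `∇^k f` at `x`, as a multilinear map. -/
def covDiffMultilinear (hcov : CovariantDerivative.ContMDiffCovariantDerivative cov ∞)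
    {f : M → ℂ} (hf : ContMDiff 𝓘(ℝ, E) 𝓘(ℝ, ℂ) ∞ f) (k : ℕ) (x : M) :
    MultilinearMap ℝ (fun _ : Fin k => TangentSpace 𝓘(ℝ, E) x) ℂ where
  toFun v := covDiffAt cov f k x v
  map_update_add' := by
    intro inst m i a b
    obtain rfl : inst = instDecidableEqFin k := Subsingleton.elim _ _
    simpa using covDiffAt_update_smul_add hcov hf m i 1 a b
  map_update_smul' := by
    intro inst m i c a
    obtain rfl : inst = instDecidableEqFin k := Subsingleton.elim _ _
    have h0 : covDiffAt cov f k x (Function.update m i 0) = 0 := by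
      simpa using covDiffAt_update_smul_add hcov hf m i 1 0 0
    simpa [h0] using covDiffAt_update_smul_add hcov hf m i c a 0

end Tensoriality

/-! ### Order of vanishing at a point, and covariant differentials of powers. -/

section VanishingOrder

open Set Filter Topology

variable [IsManifold 𝓘(ℝ, E) ∞ M]

/-- The functions, smooth on `U`, all of whose iterated derivatives along smooth vector fields, of
order less than `n`, vanish at `x`. -/
def VanishesToOrder (U : Set M) (x : M) : ℕ → (M → ℂ) → Prop
  | 0, f => SmoothOn (E := E) f U
  | n + 1, f => SmoothOn (E := E) f U ∧ f x = 0 ∧ ∀ X : Π x : M, TangentSpace 𝓘(ℝ, E) x,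
      SmoothFieldOn X U → VanishesToOrder U x n fun y => mvfderiv 𝓘(ℝ, E) f y (X y)

namespace VanishesToOrder

variable {U : Set M} {x : M}

theorem smoothOn {n : ℕ} {f : M → ℂ} (h : VanishesToOrder (E := E) U x n f) :
    SmoothOn (E := E) f U := by
  cases n with
  | zero => exact h
  | succ n => exact h.1

theorem apply_eq_zero {n : ℕ} (hn : 0 < n) {f : M → ℂ} (h : VanishesToOrder (E := E) U x n f) :
    f x = 0 := by
  cases n with
  | zero => exact absurd hn (lt_irrefl _)
  | succ n => exact h.2.1

theorem deriv (hU : IsOpen U) {n : ℕ} {f : M → ℂ} (h : VanishesToOrder (E := E) U x n f)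
    {X : Π x : M, TangentSpace 𝓘(ℝ, E) x} (hX : SmoothFieldOn X U) :
    VanishesToOrder (E := E) U x (n - 1) fun y => mvfderiv 𝓘(ℝ, E) f y (X y) := by
  cases n with
  | zero => exact SmoothOn.mvfderiv_apply hU h hX
  | succ n => exact h.2.2 X hX

theorem congr (hU : IsOpen U) (hx : x ∈ U) : ∀ {n : ℕ} {f g : M → ℂ},
    VanishesToOrder (E := E) U x n f → EqOn g f U → VanishesToOrder (E := E) U x n g
  | 0, _, _, h, e => ContMDiffOn.congr h e
  | n + 1, f, g, h, e => ⟨h.1.congr e, by rw [e hx, h.2.1], fun X hX =>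
      congr hU hx (h.2.2 X hX) fun y hy => by
        have : g =ᶠ[𝓝 y] f := e.eventuallyEq_of_mem (hU.mem_nhds hy)
        simp only [mvfderiv_congr this]⟩

theorem mul_add_const (hU : IsOpen U) (hx : x ∈ U) : ∀ {n : ℕ} {f g : M → ℂ} (c : ℂ),
    VanishesToOrder (E := E) U x n f → VanishesToOrder (E := E) U x n g →
    VanishesToOrder (E := E) U x n (fun y => c * f y + g y)
  | 0, f, g, c, hf, hg => (SmoothOn.const_mul (E := E) c hf).add hg
  | n + 1, f, g, c, hf, hg => ⟨(hf.1.const_mul c).add hg.1, by simp [hf.2.1, hg.2.1], fun X hX =>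
      congr hU hx (mul_add_const hU hx c (hf.2.2 X hX) (hg.2.2 X hX)) fun y hy => by
        have h1 := hf.1.mdifferentiableAt hU hy
        have h2 := hg.1.mdifferentiableAt hU hy
        have h3 := (hf.1.const_mul c).mdifferentiableAt hU hy
        have := mvfderiv_add h3 h2
        simp only [← mvfderiv_const_mul_complex c h1, ← add_apply, ← this]
        rfl⟩

theorem zero (hU : IsOpen U) (hx : x ∈ U) : ∀ n, VanishesToOrder (E := E) U x n (fun _ => 0)
  | 0 => contMDiffOn_const
  | n + 1 => ⟨contMDiffOn_const, rfl, fun X hX =>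
      congr hU hx (zero hU hx n) fun y hy => by simp [mvfderiv_const]⟩

theorem add (hU : IsOpen U) (hx : x ∈ U) {n : ℕ} {f g : M → ℂ}
    (hf : VanishesToOrder (E := E) U x n f) (hg : VanishesToOrder (E := E) U x n g) :
    VanishesToOrder (E := E) U x n (fun y => f y + g y) := by
  simpa using mul_add_const hU hx 1 hf hg

theorem sub (hU : IsOpen U) (hx : x ∈ U) {n : ℕ} {f g : M → ℂ}
    (hf : VanishesToOrder (E := E) U x n f) (hg : VanishesToOrder (E := E) U x n g) :
    VanishesToOrder (E := E) U x n (fun y => f y - g y) := by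
  simpa [neg_add_eq_sub] using mul_add_const hU hx (-1) hg hf

theorem sum (hU : IsOpen U) (hx : x ∈ U) {n : ℕ} {ι : Type*} (s : Finset ι) {f : ι → M → ℂ}
    (hf : ∀ i, VanishesToOrder (E := E) U x n (f i)) :
    VanishesToOrder (E := E) U x n (fun y => ∑ i ∈ s, f i y) := by
  classical
  induction s using Finset.induction_on with
  | empty => simpa using zero hU hx n
  | insert a s ha ih =>
      simp only [Finset.sum_insert ha]
      exact (hf a).add hU hx ih

theorem of_succ : ∀ {n : ℕ} {f : M → ℂ}, VanishesToOrder (E := E) U x (n + 1) f →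
    VanishesToOrder (E := E) U x n f
  | 0, _, h => h.1
  | _ + 1, _, h => ⟨h.1, h.2.1, fun X hX => of_succ (h.2.2 X hX)⟩

theorem mono {m n : ℕ} (hmn : m ≤ n) {f : M → ℂ} (h : VanishesToOrder (E := E) U x n f) :
    VanishesToOrder (E := E) U x m f := by
  induction hmn with
  | refl => exact h
  | step _ ih => exact ih h.of_succ

theorem mul (hU : IsOpen U) (hx : x ∈ U) {a b : ℕ} {f g : M → ℂ}
    (hf : VanishesToOrder (E := E) U x a f) (hg : VanishesToOrder (E := E) U x b g) :
    VanishesToOrder (E := E) U x (a + b) (fun y => f y * g y) := by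
  induction hn : a + b generalizing a b f g with
  | zero => exact SmoothOn.mul hf.smoothOn hg.smoothOn
  | succ n ih =>
      refine ⟨SmoothOn.mul hf.smoothOn hg.smoothOn, ?_, fun X hX => ?_⟩
      · rcases Nat.eq_zero_or_pos a with ha | ha
        · simp [hg.apply_eq_zero (by omega)]
        · simp [hf.apply_eq_zero ha]
      -- By the product rule each summand loses one order in one factor. If the differentiated
      -- factor has order 0, truncated subtraction loses nothing, and the missing unit is taken from
      -- the other factor, which has order n + 1.
      · have h1 : VanishesToOrder (E := E) U x n
            (fun y => f y * mvfderiv 𝓘(ℝ, E) g y (X y)) := by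
          rcases Nat.eq_zero_or_pos b with hb | hb
          · exact ih (hf.mono (m := n) (by omega)) ((hg.deriv hU hX).mono (m := 0) (by omega)) rfl
          · exact ih hf (hg.deriv hU hX) (by omega)
        have h2 : VanishesToOrder (E := E) U x n
            (fun y => g y * mvfderiv 𝓘(ℝ, E) f y (X y)) := by
          rcases Nat.eq_zero_or_pos a with ha | ha
          · exact ih (hg.mono (m := n) (by omega)) ((hf.deriv hU hX).mono (m := 0) (by omega)) rfl
          · exact ih hg (hf.deriv hU hX) (by omega)
        exact (h1.add hU hx h2).congr hU hx fun y hy => mvfderiv_mul_complex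
          (hf.smoothOn.mdifferentiableAt hU hy) (hg.smoothOn.mdifferentiableAt hU hy) _

theorem pow (hU : IsOpen U) (hx : x ∈ U) {f : M → ℂ}
    (hf : VanishesToOrder (E := E) U x 1 f) :
    ∀ n : ℕ, VanishesToOrder (E := E) U x n (fun y => f y ^ n)
  | 0 => by simpa using! (contMDiffOn_const : SmoothOn (E := E) (fun _ : M => (1 : ℂ)) U)
  | n + 1 => by simpa [pow_succ] using (pow hU hx hf n).mul hU hx hf

theorem of_mem_maxIdeal {f : SmoothFn E M} (hU : IsOpen U) (hf : f ∈ maxIdeal x) :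
    VanishesToOrder (E := E) U x 1 f :=
  ⟨f.2.contMDiffOn, hf, fun _ hX => SmoothOn.mvfderiv_apply hU f.2.contMDiffOn hX⟩

/-- The link between the algebraic filtration by powers of 𝔪ₓ, which defines differential operators,
and the analytic one by derivatives. -/
theorem of_mem_maxIdeal_pow (hU : IsOpen U) (hx : x ∈ U) {n : ℕ} {f : SmoothFn E M}
    (hf : f ∈ (maxIdeal x : Ideal (SmoothFn E M)) ^ n) : VanishesToOrder (E := E) U x n f := by
  induction n generalizing f with
  | zero => exact f.2.contMDiffOn
  | succ n ih =>
      rw [pow_succ] at hf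
      refine Submodule.mul_induction_on hf (fun a ha b hb => ?_) fun a b ha hb => ?_
      · exact (ih ha).mul hU hx (of_mem_maxIdeal hU hb)
      · exact ha.add hU hx hb

variable [FiniteDimensional ℝ E] [T2Space M]
  {cov : CovariantDerivative 𝓘(ℝ, E) E (TangentSpace 𝓘(ℝ, E) : M → Type _)}

theorem iterCovDiff (hcov : CovariantDerivative.ContMDiffCovariantDerivative cov ∞)
    (hU : IsOpen U) (hx : x ∈ U) {n : ℕ} {f : M → ℂ} (hf : VanishesToOrder (E := E) U x n f) :
    ∀ (k : ℕ) {X : Fin k → Π x : M, TangentSpace 𝓘(ℝ, E) x}, (∀ i, SmoothFieldOn (X i) U) →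
      VanishesToOrder (E := E) U x (n - k) (iterCovDiff cov f k X)
  | 0, _, _ => hf
  | k + 1, X, hX => by
      have hT : ∀ i, SmoothFieldOn (Fin.tail X i) U := fun i => hX i.succ
      refine (((iterCovDiff hcov hU hx hf k hT).deriv hU (hX 0)).mono (by omega)).sub hU hx
        (sum hU hx _ fun i => ?_)
      exact (iterCovDiff hcov hU hx hf k
        (SmoothFieldOn.update hT (.covariantDerivative hcov hU (hX 0) (hT i)) i)).mono (by omega)

/-- The leading term of ∇^k(fⁿ) is n(n-1)⋯(n-k+1) f^{n-k} df ⊗ ⋯ ⊗ df. Everything else contains more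
factors of f, hence vanishes to one order higher; the case m = 0 gives the exact value at `x`. -/
theorem iterCovDiff_pow_sub (hcov : CovariantDerivative.ContMDiffCovariantDerivative cov ∞)
    (hU : IsOpen U) (hx : x ∈ U) {n : ℕ} {f : M → ℂ} (hf : VanishesToOrder (E := E) U x 1 f) :
    ∀ (k m : ℕ), k + m = n → ∀ {X : Fin k → Π x : M, TangentSpace 𝓘(ℝ, E) x},
      (∀ i, SmoothFieldOn (X i) U) → VanishesToOrder (E := E) U x (m + 1)
        (fun y => Dequantization.iterCovDiff cov (fun z => f z ^ n) k X y -
          (n.descFactorial k * ∏ i, mvfderiv 𝓘(ℝ, E) f y (X i y)) * f y ^ m)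
  | 0, m, hm, X, _ => by
      obtain rfl : m = n := by omega
      simpa [Dequantization.iterCovDiff] using zero hU hx (m + 1)
  | k + 1, m, hm, X, hX => by
      have hT : ∀ i, SmoothFieldOn (Fin.tail X i) U := fun i => hX i.succ
      have hR := iterCovDiff_pow_sub hcov hU hx (n := n) hf k (m + 1) (by omega) hT
      set G : M → ℂ := fun y => n.descFactorial k * ∏ i, mvfderiv 𝓘(ℝ, E) f y (Fin.tail X i y)
        with hG
      have hGs : SmoothOn (E := E) G U := by
        have : ∀ s : Finset (Fin k), SmoothOn (E := E)
            (fun y => ∏ i ∈ s, mvfderiv 𝓘(ℝ, E) f y (Fin.tail X i y)) U := by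
          classical
          intro s
          induction s using Finset.induction_on with
          | empty => simpa using contMDiffOn_const
          | insert a s ha ih =>
              simp only [Finset.prod_insert ha]
              exact SmoothOn.mul (hf.smoothOn.mvfderiv_apply hU (hT a)) ih
        exact (this Finset.univ).const_mul _
      set A := Dequantization.iterCovDiff cov (fun z => f z ^ n) k (Fin.tail X) with hA
      have hP : ∀ l, VanishesToOrder (E := E) U x l (fun y => f y ^ l) := hf.pow hU hx
      have hD : ∀ l : ℕ, ∀ y ∈ U, mvfderiv 𝓘(ℝ, E) (fun z => f z ^ (l + 1)) y (X 0 y) =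
          (l + 1) * f y ^ l * mvfderiv 𝓘(ℝ, E) f y (X 0 y) := by
        intro l y hy
        have hfy := hf.smoothOn.mdifferentiableAt hU hy
        induction l with
        | zero => simp
        | succ l ih =>
            have h1 := mvfderiv_mul_complex ((hP (l + 1)).smoothOn.mdifferentiableAt hU hy)
              hfy (X 0 y)
            have h2 : (fun z => f z ^ (l + 1)) * f = fun z => f z ^ (l + 1 + 1) := by
              funext z
              simp [pow_succ]
            rw [h2, ih] at h1
            rw [h1]
            push_cast
            ring
      have h1 : VanishesToOrder (E := E) U x (m + 1)
          (fun y => mvfderiv 𝓘(ℝ, E) (fun y => A y - G y * f y ^ (m + 1)) y (X 0 y)) :=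
        (hR.deriv hU (hX 0)).mono (by omega)
      have hG0 : VanishesToOrder (E := E) U x 0 (fun y => mvfderiv 𝓘(ℝ, E) G y (X 0 y)) :=
        hGs.mvfderiv_apply hU (hX 0)
      have h2 := (hP (m + 1)).mul hU hx hG0
      have hfn := hf.pow hU hx n
      have h3 : VanishesToOrder (E := E) U x (m + 1) (fun y => ∑ i : Fin k,
          Dequantization.iterCovDiff cov (fun z => f z ^ n) k
            (Function.update (Fin.tail X) i fun y => cov (Fin.tail X i) y (X 0 y)) y) :=
        sum hU hx _ fun i => (hfn.iterCovDiff hcov hU hx k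
          (SmoothFieldOn.update hT (.covariantDerivative hcov hU (hX 0) (hT i)) i)).mono (by omega)
      -- The new remainder is the derivative of the old one, plus f^{m+1} dG(X₀), minus the
      -- connection terms; each vanishes to order m + 1.
      refine ((h1.add hU hx h2).sub hU hx h3).congr hU hx fun y hy => ?_
      have hAy := (SmoothOn.iterCovDiff hcov hU hfn.smoothOn k hT).mdifferentiableAt hU hy
      have hPy := (hP (m + 1)).smoothOn.mdifferentiableAt hU hy
      have hGy := hGs.mdifferentiableAt hU hy
      have e1 : mvfderiv 𝓘(ℝ, E) (fun y => A y - G y * f y ^ (m + 1)) y (X 0 y) =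
          mvfderiv 𝓘(ℝ, E) A y (X 0 y) - (G y * ((m + 1) * f y ^ m *
            mvfderiv 𝓘(ℝ, E) f y (X 0 y)) + f y ^ (m + 1) * mvfderiv 𝓘(ℝ, E) G y (X 0 y)) := by
        rw [← hD m y hy, ← mvfderiv_mul_complex hGy hPy]
        have := mvfderiv_sub hAy (hGy.mul hPy)
        exact congrArg (fun l => l (X 0 y)) this
      have e2 : (n.descFactorial (k + 1) : ℂ) = (m + 1) * n.descFactorial k := by
        rw [Nat.descFactorial_succ]
        push_cast [show n - k = m + 1 by omega]
        ring
      have e3 : ∏ i, mvfderiv 𝓘(ℝ, E) f y (X i y) = mvfderiv 𝓘(ℝ, E) f y (X 0 y) *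
          ∏ i, mvfderiv 𝓘(ℝ, E) f y (Fin.tail X i y) := Fin.prod_univ_succ _
      have e4 : G y = n.descFactorial k * ∏ i, mvfderiv 𝓘(ℝ, E) f y (Fin.tail X i y) := rfl
      simp only [e1, e2, e3, e4, Dequantization.iterCovDiff, ← hA]
      ring

theorem iterCovDiff_pow (hcov : CovariantDerivative.ContMDiffCovariantDerivative cov ∞)
    (hU : IsOpen U) (hx : x ∈ U) {f : M → ℂ} (hf : VanishesToOrder (E := E) U x 1 f) {k : ℕ}
    {X : Fin k → Π x : M, TangentSpace 𝓘(ℝ, E) x} (hX : ∀ i, SmoothFieldOn (X i) U) :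
    Dequantization.iterCovDiff cov (fun z => f z ^ k) k X x =
      k.factorial * ∏ i, mvfderiv 𝓘(ℝ, E) f x (X i x) := by
  have := (iterCovDiff_pow_sub hcov hU hx hf k 0 rfl hX).2.1
  simpa [sub_eq_zero, Nat.descFactorial_self] using this

end VanishesToOrder

variable [FiniteDimensional ℝ E] [T2Space M]
  {cov : CovariantDerivative 𝓘(ℝ, E) E (TangentSpace 𝓘(ℝ, E) : M → Type _)}

theorem covDiffAt_eq_zero (hcov : CovariantDerivative.ContMDiffCovariantDerivative cov ∞)
    {x : M} {n : ℕ} {f : SmoothFn E M} (hf : f ∈ (maxIdeal x : Ideal (SmoothFn E M)) ^ n)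
    {k : ℕ} (hk : k < n) (v : Fin k → TangentSpace 𝓘(ℝ, E) x) : covDiffAt cov f k x v = 0 :=
  ((VanishesToOrder.of_mem_maxIdeal_pow (chartAt E x).open_source (mem_chart_source E x)
    hf).iterCovDiff hcov (chartAt E x).open_source (mem_chart_source E x) k
    (fun i => smoothFieldOn_extend (v i))).apply_eq_zero (by omega)

theorem covDiffAt_pow (hcov : CovariantDerivative.ContMDiffCovariantDerivative cov ∞)
    {x : M} {f : SmoothFn E M} (hf : f ∈ maxIdeal x)
    {k : ℕ} (v : Fin k → TangentSpace 𝓘(ℝ, E) x) :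
    covDiffAt cov (f ^ k : SmoothFn E M) k x v =
      k.factorial * ∏ i, mvfderiv 𝓘(ℝ, E) (f : M → ℂ) x (v i) := by
  have := (VanishesToOrder.of_mem_maxIdeal (chartAt E x).open_source hf).iterCovDiff_pow hcov
    (chartAt E x).open_source (mem_chart_source E x) (fun i => smoothFieldOn_extend (v i))
  simpa using! this

end VanishingOrder

/-! ### Contraction of contravariant with covariant tensors. -/

section Contraction

open Set Filter Topology

variable [FiniteDimensional ℝ E]

theorem sum_cotangentBasis_smul_tangentBasis {x : M} (v : TangentSpace 𝓘(ℝ, E) x) :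
    ∑ j, cotangentBasis x j v • tangentBasis x j = v :=
  (Module.finBasis ℝ E).sum_repr v

theorem sum_apply_tangentBasis_smul {x : M} (α : TangentSpace 𝓘(ℝ, E) x →L[ℝ] ℝ) :
    ∑ j, α (tangentBasis x j) • cotangentBasis x j = α := by
  ext v
  conv_rhs => rw [← sum_cotangentBasis_smul_tangentBasis v, map_sum]
  simp only [sum_apply, map_smul, smul_apply, smul_eq_mul, mul_comm]

theorem map_sum_smul_univ {R V N ι κ : Type*} [CommSemiring R] [AddCommMonoid V] [Module R V]
    [AddCommMonoid N] [Module R N] [Fintype ι] [DecidableEq ι] [Fintype κ]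
    (Φ : MultilinearMap R (fun _ : ι => V) N) (c : ι → κ → R) (e : κ → V) :
    Φ (fun i => ∑ j, c i j • e j) = ∑ J : ι → κ, (∏ i, c i (J i)) • Φ (fun i => e (J i)) := by
  rw [MultilinearMap.map_sum]
  exact Finset.sum_congr rfl fun J _ => Φ.map_smul_univ _ _

/-- The contraction does not depend on the pair of dual bases. The completeness relation `h` alone
is enough, and it lets the fixed basis of `E` be replaced by a frame adapted to a chart. -/
theorem contraction_eq_of_dual {k : ℕ} {x : M} {κ : Type*} [Fintype κ]
    (Φ : MultilinearMap ℝ (fun _ : Fin k => TangentSpace 𝓘(ℝ, E) x →L[ℝ] ℝ) ℂ)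
    (B : MultilinearMap ℝ (fun _ : Fin k => TangentSpace 𝓘(ℝ, E) x) ℂ)
    (b : κ → TangentSpace 𝓘(ℝ, E) x) (β : κ → TangentSpace 𝓘(ℝ, E) x →L[ℝ] ℝ)
    (h : ∀ v, ∑ j, β j v • b j = v) :
    contraction Φ B = ∑ J : Fin k → κ, Φ (fun i => β (J i)) * B (fun i => b (J i)) := by
  have h1 : ∀ J : Fin k → Fin (Module.finrank ℝ E), B (fun i => tangentBasis x (J i)) =
      ∑ I : Fin k → κ, (∏ i, β (I i) (tangentBasis x (J i))) • B (fun i => b (I i)) := by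
    intro J
    rw [← map_sum_smul_univ B (fun i j => β j (tangentBasis x (J i))) b]
    simp only [h]
  have h2 : ∀ I : Fin k → κ, Φ (fun i => β (I i)) = ∑ J : Fin k → Fin (Module.finrank ℝ E),
      (∏ i, β (I i) (tangentBasis x (J i))) • Φ (fun i => cotangentBasis x (J i)) := by
    intro I
    rw [← map_sum_smul_univ Φ (fun i j => β (I i) (tangentBasis x j)) (cotangentBasis x)]
    simp only [sum_apply_tangentBasis_smul]
  simp only [contraction, h1, h2, Finset.mul_sum, Finset.sum_mul]
  rw [Finset.sum_comm]
  exact Finset.sum_congr rfl fun _ _ => Finset.sum_congr rfl fun _ _ => by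
    simp only [Complex.real_smul]
    ring

theorem contraction_mul_prod {k : ℕ} {x : M}
    (Φ : MultilinearMap ℝ (fun _ : Fin k => TangentSpace 𝓘(ℝ, E) x →L[ℝ] ℝ) ℂ)
    (α : TangentSpace 𝓘(ℝ, E) x →L[ℝ] ℝ) (c : ℂ) :
    contraction Φ (fun v => c * ∏ i, (α (v i) : ℂ)) = c * Φ (fun _ => α) := by
  have h : Φ (fun _ => α) = ∑ J : Fin k → Fin (Module.finrank ℝ E),
      (∏ i, α (tangentBasis x (J i))) • Φ (fun i => cotangentBasis x (J i)) := by
    rw [← map_sum_smul_univ Φ (fun _ j => α (tangentBasis x j)) (cotangentBasis x)]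
    simp only [sum_apply_tangentBasis_smul]
  rw [h, contraction, Finset.mul_sum]
  refine Finset.sum_congr rfl fun J _ => ?_
  rw [Complex.real_smul]
  push_cast
  ring

/-- Reindexing the sum by a permutation moves it from the covariant factor to the symmetric one,
where it has no effect. So the symmetrization in `quantizeHom` can be ignored. -/
theorem contraction_symmetrize {k : ℕ} {x : M}
    {Φ : MultilinearMap ℝ (fun _ : Fin k => TangentSpace 𝓘(ℝ, E) x →L[ℝ] ℝ) ℂ}
    (hΦ : ∀ (α : Fin k → (TangentSpace 𝓘(ℝ, E) x →L[ℝ] ℝ)) (σ : Equiv.Perm (Fin k)),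
      Φ (α ∘ σ) = Φ α) (B : (Fin k → TangentSpace 𝓘(ℝ, E) x) → ℂ) :
    contraction Φ (fun v => (k.factorial : ℂ)⁻¹ * ∑ σ : Equiv.Perm (Fin k), B (v ∘ σ)) =
      contraction Φ B := by
  have h : ∀ σ : Equiv.Perm (Fin k), contraction Φ (fun v => B (v ∘ σ)) = contraction Φ B := by
    intro σ
    simp only [contraction]
    refine Fintype.sum_equiv (σ.symm.arrowCongr (Equiv.refl _)) _ _ fun J => ?_
    have : Φ (fun i => cotangentBasis x (J (σ i))) = Φ (fun i => cotangentBasis x (J i)) :=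
      hΦ (fun i => cotangentBasis x (J i)) σ
    simp only [Equiv.arrowCongr_apply, Equiv.symm_symm, Equiv.coe_refl, Function.comp_apply,
      id_eq, this]
    rfl
  have hk : (k.factorial : ℂ) ≠ 0 := by exact_mod_cast k.factorial_ne_zero
  have : contraction Φ (fun v => (k.factorial : ℂ)⁻¹ * ∑ σ : Equiv.Perm (Fin k), B (v ∘ σ)) =
      (k.factorial : ℂ)⁻¹ * ∑ σ : Equiv.Perm (Fin k), contraction Φ (fun v => B (v ∘ σ)) := by
    simp only [contraction, Finset.mul_sum]
    rw [Finset.sum_comm]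
    refine Finset.sum_congr rfl fun _ _ => Finset.sum_congr rfl fun _ _ => by ring
  rw [this]
  simp only [h, Finset.sum_const, Finset.card_univ, Fintype.card_perm, Fintype.card_fin,
    nsmul_eq_mul]
  rw [← mul_assoc, inv_mul_cancel₀ hk, one_mul]

end Contraction

/-! ### Quantization as an operator on smooth functions. -/

section Quantization

open Set Filter Topology

variable [FiniteDimensional ℝ E] [IsManifold 𝓘(ℝ, E) ∞ M]
  {cov : CovariantDerivative 𝓘(ℝ, E) E (TangentSpace 𝓘(ℝ, E) : M → Type _)}

theorem quantizeHom_eq (ħ : ℝ) {k : ℕ} (Φ : SymTensorField E M k) (f : M → ℂ) (x : M) :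
    quantizeHom cov ħ (Φ : ContravariantField E M k) f x =
      (-Complex.I * ħ) ^ k * contraction (Φ.1 x) (covDiffAt cov f k x) := by
  rw [quantizeHom]
  congr 1
  exact contraction_symmetrize (Φ.2.1 x) _

variable [T2Space M]

theorem quantizeHom_smul_add (hcov : CovariantDerivative.ContMDiffCovariantDerivative cov ∞)
    (ħ : ℝ) {k : ℕ} (Φ : SymTensorField E M k) (c : ℂ) (f g : SmoothFn E M) (x : M) :
    quantizeHom cov ħ (Φ : ContravariantField E M k) (c • f + g : SmoothFn E M) x =
      c * quantizeHom cov ħ (Φ : ContravariantField E M k) f x +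
        quantizeHom cov ħ (Φ : ContravariantField E M k) g x := by
  have h : ∀ v, covDiffAt cov (c • f + g : SmoothFn E M) k x v =
      c * covDiffAt cov f k x v + covDiffAt cov g k x v := fun v =>
    iterCovDiff_smul_add_fun hcov (chartAt E x).open_source c f.2.contMDiffOn g.2.contMDiffOn k
      (fun i => smoothFieldOn_extend (v i)) x (mem_chart_source E x)
  simp only [quantizeHom_eq, contraction, h, mul_add, Finset.sum_add_distrib, Finset.mul_sum]
  congr 1
  refine Finset.sum_congr rfl fun _ _ => by ring

theorem quantizeHom_eq_zero (hcov : CovariantDerivative.ContMDiffCovariantDerivative cov ∞)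
    (ħ : ℝ) {k : ℕ} (Φ : SymTensorField E M k) {n : ℕ} (hk : k < n) {f : SmoothFn E M} {x : M}
    (hf : f ∈ (maxIdeal x : Ideal (SmoothFn E M)) ^ n) :
    quantizeHom cov ħ (Φ : ContravariantField E M k) f x = 0 := by
  simp only [quantizeHom_eq, contraction, covDiffAt_eq_zero hcov hf hk, mul_zero,
    Finset.sum_const_zero]

theorem quantizeHom_pow (hcov : CovariantDerivative.ContMDiffCovariantDerivative cov ∞)
    (ħ : ℝ) {k : ℕ} (Φ : SymTensorField E M k) {f : SmoothFn E M} {x : M} (hf : f ∈ maxIdeal x) :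
    quantizeHom cov ħ (Φ : ContravariantField E M k) (f ^ k : SmoothFn E M) x =
      (-Complex.I * ħ) ^ k * contraction (Φ.1 x) (fun v =>
        k.factorial * ∏ i, mvfderiv 𝓘(ℝ, E) (f : M → ℂ) x (v i)) := by
  simp only [quantizeHom_eq, contraction, covDiffAt_pow hcov hf]

/-- The coordinate differentials of the chart at `x₀` are dual to the frame of the trivialization at
`x₀`. The left factors match the components in `SymTensorField`, the right ones are smooth fields.
-/
theorem extChartAt_dual_frame (x₀ : M) {x : M} (hx : x ∈ (chartAt E x₀).source)
    (v : TangentSpace 𝓘(ℝ, E) x) :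
    ∑ j, ((LinearMap.toContinuousLinearMap ((Module.finBasis ℝ E).coord j) : E →L[ℝ] ℝ).comp
      (mvfderiv 𝓘(ℝ, E) (extChartAt 𝓘(ℝ, E) x₀) x)) v •
      (trivializationAt E (TangentSpace 𝓘(ℝ, E) : M → Type _) x₀).localFrame
        (Module.finBasis ℝ E) j x = v := by
  set t := trivializationAt E (TangentSpace 𝓘(ℝ, E) : M → Type _) x₀
  have hx' : x ∈ t.baseSet := hx
  have h2 := TangentBundle.continuousLinearMapAt_trivializationAt (I := 𝓘(ℝ, E)) hx
  have h3 : mvfderiv 𝓘(ℝ, E) (extChartAt 𝓘(ℝ, E) x₀) x v = t.linearEquivAt ℝ x hx' v := by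
    have := congrArg (fun l => l v) h2
    exact this.symm.trans (congrFun (t.coe_linearMapAt_of_mem (R := ℝ) hx') v)
  have h4 := (t.basisAt (Module.finBasis ℝ E) hx').sum_repr v
  conv_rhs => rw [← h4]
  refine Finset.sum_congr rfl fun j _ => ?_
  rw [t.localFrame_apply_of_mem_baseSet _ hx']
  congr 1
  simp only [ContinuousLinearMap.comp_apply, h3]
  rfl

theorem quantizeHom_smooth (hcov : CovariantDerivative.ContMDiffCovariantDerivative cov ∞)
    (ħ : ℝ) {k : ℕ} (Φ : SymTensorField E M k) (f : SmoothFn E M) :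
    quantizeHom cov ħ (Φ : ContravariantField E M k) f ∈ SmoothFn E M := by
  intro x₀
  set b := Module.finBasis ℝ E
  set t := trivializationAt E (TangentSpace 𝓘(ℝ, E) : M → Type _) x₀ with ht
  set β : Fin (Module.finrank ℝ E) → E →L[ℝ] ℝ :=
    fun j => LinearMap.toContinuousLinearMap (b.coord j) with hβ
  set U := (chartAt E x₀).source
  have hU : IsOpen U := (chartAt E x₀).open_source
  have hY : ∀ j, SmoothFieldOn (t.localFrame b j) U := fun j => t.contMDiffOn_localFrame_baseSet ∞ b j
  have key : ∀ x ∈ U, quantizeHom cov ħ (Φ : ContravariantField E M k) f x =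
      (-Complex.I * ħ) ^ k * ∑ J : Fin k → Fin (Module.finrank ℝ E),
        Φ.1 x (fun i => (β (J i)).comp (mvfderiv 𝓘(ℝ, E) (extChartAt 𝓘(ℝ, E) x₀) x)) *
          iterCovDiff cov f k (fun i => t.localFrame b (J i)) x := by
    intro x hx
    rw [quantizeHom_eq]
    have := contraction_eq_of_dual (Φ.1 x) (covDiffMultilinear hcov f.2 k x)
      (fun j => t.localFrame b j x) (fun j => (β j).comp (mvfderiv 𝓘(ℝ, E) (extChartAt 𝓘(ℝ, E) x₀) x))
      (extChartAt_dual_frame x₀ hx)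
    refine congrArg _ (this.trans (Finset.sum_congr rfl fun J _ => ?_))
    congr 1
    exact covDiffAt_eq hcov hU f.2.contMDiffOn (fun i => hY (J i)) hx _ fun i => rfl
  have hs : SmoothOn (E := E) (quantizeHom cov ħ (Φ : ContravariantField E M k) f) U := by
    refine ContMDiffOn.congr (SmoothOn.const_mul _ (contMDiffOn_finsetSum fun J _ => ?_)) key
    exact SmoothOn.mul (Φ.2.2 x₀ fun i => β (J i))
      (SmoothOn.iterCovDiff hcov hU f.2.contMDiffOn k fun i => hY (J i))
  exact hs.contMDiffAt (hU.mem_nhds (mem_chart_source E x₀))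

/-- The quantization of a homogeneous tensor field, as an operator on `C^∞(M)`. -/
def quantizeHomOp (hcov : CovariantDerivative.ContMDiffCovariantDerivative cov ∞)
    (ħ : ℝ) {k : ℕ} (Φ : SymTensorField E M k) : SmoothFn E M →ₗ[ℂ] SmoothFn E M where
  toFun f := ⟨quantizeHom cov ħ (Φ : ContravariantField E M k) f, quantizeHom_smooth hcov ħ Φ f⟩
  map_add' f g := by
    ext x
    simpa using quantizeHom_smul_add hcov ħ Φ 1 f g x
  map_smul' c f := by
    ext x
    have h0 : quantizeHom cov ħ (Φ : ContravariantField E M k) (0 : SmoothFn E M) x = 0 :=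
      quantizeHom_eq_zero hcov ħ Φ (Nat.lt_succ_self k) (Ideal.zero_mem _)
    have := quantizeHom_smul_add hcov ħ Φ c f 0 x
    rw [h0, add_zero, add_zero] at this
    exact this

theorem finite_support_quantizeHom (ħ : ℝ) (Φ : SymTensor E M) (f : M → ℂ) (x : M) :
    (Function.support fun k =>
      quantizeHom cov ħ (Φ k : ContravariantField E M k) f x).Finite := by
  refine (DFinsupp.finite_support Φ).subset fun k hk h0 => hk ?_
  change Φ k = 0 at h0
  simp [h0, quantizeHom, contraction]

theorem quantize_add (ħ : ℝ) (Φ Ψ : SymTensor E M) (f : M → ℂ) (x : M) :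
    quantize cov ħ (Φ + Ψ) f x = quantize cov ħ Φ f x + quantize cov ħ Ψ f x := by
  rw [quantize, quantize, quantize, ← finsum_add_distrib (finite_support_quantizeHom ħ Φ f x)
    (finite_support_quantizeHom ħ Ψ f x)]
  refine finsum_congr fun k => ?_
  simp [quantizeHom, contraction, add_mul, mul_add, Finset.sum_add_distrib]

theorem quantize_of (ħ : ℝ) {k : ℕ} (Φ : SymTensorField E M k) (f : M → ℂ) (x : M) :
    quantize cov ħ (DirectSum.of (fun k => SymTensorField E M k) k Φ) f x =
      quantizeHom cov ħ (Φ : ContravariantField E M k) f x := by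
  rw [quantize, finsum_eq_single _ k, DirectSum.of_eq_same]
  intro l hl
  rw [DirectSum.of_eq_of_ne _ _ _ hl]
  simp [quantizeHom, contraction]

end Quantization

/-! ### Polarization of symmetric multilinear maps. -/

section Polarization

/-- A symmetric multilinear map which vanishes on the diagonal is zero. -/
theorem multilinear_apply_eq_zero_of_diagonal {V : Type*} [AddCommGroup V] [Module ℝ V] {k : ℕ}
    (Φ : MultilinearMap ℝ (fun _ : Fin k => V) ℂ)
    (hsymm : ∀ (v : Fin k → V) (σ : Equiv.Perm (Fin k)), Φ (v ∘ σ) = Φ v)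
    (hdiag : ∀ v, Φ (fun _ => v) = 0) (v : Fin k → V) : Φ v = 0 := by
  -- `V` has no topology, so the form is pulled back to ℝᵏ, where it is continuous and calculus
  -- applies.
  let L : (Fin k → ℝ) →ₗ[ℝ] V := Fintype.linearCombination ℝ v
  let G : ContinuousMultilinearMap ℝ (fun _ : Fin k => Fin k → ℝ) ℂ :=
    { Φ.compLinearMap (fun _ => L) with
      cont := by
        have : ∀ t : Fin k → Fin k → ℝ, Φ (fun i => L (t i)) =
            ∑ J : Fin k → Fin k, (∏ i, t i (J i)) • Φ (fun i => v (J i)) := by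
          intro t
          exact map_sum_smul_univ Φ t v
        change Continuous fun t : Fin k → Fin k → ℝ => Φ (fun i => L (t i))
        simp only [this]
        fun_prop }
  have hG : ∀ t, G t = Φ (fun i => L (t i)) := fun t => rfl
  -- The k-th derivative of the diagonal along the standard basis is the sum of Φ over all
  -- permutations of v, that is k!·Φ(v), while the diagonal is identically zero.
  have h := G.iteratedFDeriv_comp_diagonal 0 (fun i => Pi.single i 1)
  have h0 : (fun x => G fun _ => x) = fun _ => 0 := by
    funext x
    rw [hG, hdiag]
  have hL : ∀ i, L (Pi.single i 1) = v i := fun i => by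
    simp [L, Fintype.linearCombination_apply_single]
  rw [h0] at h
  simp only [hG, hL] at h
  have h1 : ∀ σ : Equiv.Perm (Fin k), Φ (fun i => v (σ i)) = Φ v := fun σ => hsymm v σ
  simp only [h1, Finset.sum_const, Finset.card_univ, Fintype.card_perm, Fintype.card_fin,
    nsmul_eq_mul] at h
  have h2 : iteratedFDeriv ℝ k (fun _ : Fin k → ℝ => (0 : ℂ)) 0 = 0 := by
    simp
  rw [h2] at h
  have hk : (k.factorial : ℂ) ≠ 0 := by exact_mod_cast k.factorial_ne_zero
  exact (mul_eq_zero.1 h.symm).resolve_left hk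

end Polarization

/-! ### Test functions with prescribed differential, and uniqueness of the dequantization. -/

section TestFunctions

open Set Filter Topology

variable [IsManifold 𝓘(ℝ, E) ∞ M]

theorem SmoothOn.contMDiff_bump_smul {F : Type*} [NormedAddCommGroup F] [NormedSpace ℝ F]
    {χ : M → ℝ} (hχ : ContMDiff 𝓘(ℝ, E) 𝓘(ℝ, ℝ) ∞ χ) {U : Set M} (hU : IsOpen U)
    (hχU : tsupport χ ⊆ U) {g : M → F} (hg : SmoothOn (E := E) g U) :
    ContMDiff 𝓘(ℝ, E) 𝓘(ℝ, F) ∞ (fun y => χ y • g y) := by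
  refine contMDiff_of_tsupport fun x hx => ?_
  have hxU : x ∈ U := hχU (tsupport_smul_subset_left _ _ hx)
  exact hχ.contMDiffAt.smul (hg.contMDiffAt (hU.mem_nhds hxU))

theorem smoothOn_clm_extChartAt {F : Type*} [NormedAddCommGroup F] [NormedSpace ℝ F]
    (L : E →L[ℝ] F) (c : F) (x₀ : M) :
    SmoothOn (E := E) (fun y => L (extChartAt 𝓘(ℝ, E) x₀ y) - c) (chartAt E x₀).source := by
  have h : ContMDiff 𝓘(ℝ, E) 𝓘(ℝ, F) ∞ (fun e : E => L e - c) := by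
    rw [contMDiff_iff_contDiff]
    fun_prop
  exact h.comp_contMDiffOn contMDiffOn_extChartAt

theorem mvfderiv_clm_extChartAt {F : Type*} [NormedAddCommGroup F] [NormedSpace ℝ F]
    (L : E →L[ℝ] F) (c : F) {x₀ x : M} (hx : x ∈ (chartAt E x₀).source) :
    mvfderiv 𝓘(ℝ, E) (fun y => L (extChartAt 𝓘(ℝ, E) x₀ y) - c) x =
      L.comp (mvfderiv 𝓘(ℝ, E) (extChartAt 𝓘(ℝ, E) x₀) x) := by
  have h1 : HasMFDerivAt 𝓘(ℝ, E) 𝓘(ℝ, E) (extChartAt 𝓘(ℝ, E) x₀) x _ :=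
    (mdifferentiableAt_extChartAt hx).hasMFDerivAt
  have h2 : HasFDerivAt (fun e : E => L e - c) L (extChartAt 𝓘(ℝ, E) x₀ x) :=
    L.hasFDerivAt.sub_const c
  exact (h2.hasMFDerivAt.comp x h1).mfderiv

variable [FiniteDimensional ℝ E] [T2Space M]

theorem exists_smoothFn_eventuallyEq {U : Set M} (hU : IsOpen U) {g : M → ℂ}
    (hg : SmoothOn (E := E) g U) {x : M} (hx : x ∈ U) :
    ∃ h : SmoothFn E M, ∀ᶠ y in 𝓝 x, (h : M → ℂ) y = g y := by
  obtain ⟨χ, hχ, hχU, hχ1⟩ := exists_smoothBump (E := E) (hU.mem_nhds hx)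
  exact ⟨⟨_, hg.contMDiff_bump_smul hχ hU hχU⟩, hχ1.mono fun y hy => by simp [hy]⟩

variable (E) in
/-- A smooth function which is equal to `1` near `x`, supported in the domain of the chart. -/
def bump (x : M) : M → ℝ :=
  (exists_smoothBump (E := E) ((chartAt E x).open_source.mem_nhds (mem_chart_source E x))).choose

theorem bump_spec (x : M) : ContMDiff 𝓘(ℝ, E) 𝓘(ℝ, ℝ) ∞ (bump E x) ∧
    tsupport (bump E x) ⊆ (chartAt E x).source ∧ ∀ᶠ y in 𝓝 x, bump E x y = 1 :=
  (exists_smoothBump (E := E)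
    ((chartAt E x).open_source.mem_nhds (mem_chart_source E x))).choose_spec

/-- A real linear form, with values in `ℂ`. -/
def ofRealComp (α : E →L[ℝ] ℝ) : E →L[ℝ] ℂ := Complex.ofRealCLM.comp α

theorem ofRealComp_apply (α : E →L[ℝ] ℝ) (e : E) : ofRealComp α e = (α e : ℂ) := rfl

/-- A smooth function vanishing at `x` with a given real differential there, depending linearly on
the differential. -/
def testFn (x : M) : (TangentSpace 𝓘(ℝ, E) x →L[ℝ] ℝ) →ₗ[ℝ] SmoothFn E M where
  toFun α := ⟨fun y => bump E x y •
      (ofRealComp (E := E) α (extChartAt 𝓘(ℝ, E) x y) -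
        ofRealComp (E := E) α (extChartAt 𝓘(ℝ, E) x x)),
    (smoothOn_clm_extChartAt _ _ x).contMDiff_bump_smul (bump_spec x).1
      (chartAt E x).open_source (bump_spec x).2.1⟩
  map_add' α β := by
    ext y
    have h : ∀ e : E, ofRealComp (E := E) (α + β) e = ofRealComp (E := E) α e +
        ofRealComp (E := E) β e := fun e => Complex.ofReal_add _ _
    simp only [h, Subalgebra.coe_add, Pi.add_apply, Complex.real_smul]
    ring
  map_smul' c α := by
    ext y
    have h : ∀ e : E, ofRealComp (E := E) (c • α) e = c * ofRealComp (E := E) α e :=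
      fun e => Complex.ofReal_mul _ _
    simp only [h, RingHom.id_apply, Subalgebra.coe_smul, Pi.smul_apply, Complex.real_smul]
    ring

theorem testFn_mem_maxIdeal (x : M) (α : TangentSpace 𝓘(ℝ, E) x →L[ℝ] ℝ) :
    testFn x α ∈ maxIdeal x := by
  change bump E x x • ((_ : ℂ) - _) = (0 : ℂ)
  rw [sub_self, smul_zero]

theorem mvfderiv_testFn (x : M) (α : TangentSpace 𝓘(ℝ, E) x →L[ℝ] ℝ)
    (v : TangentSpace 𝓘(ℝ, E) x) :
    mvfderiv 𝓘(ℝ, E) (testFn x α : M → ℂ) x v = α v := by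
  have h : (testFn x α : M → ℂ) =ᶠ[𝓝 x] fun y =>
      ofRealComp (E := E) α (extChartAt 𝓘(ℝ, E) x y) -
        ofRealComp (E := E) α (extChartAt 𝓘(ℝ, E) x x) := by
    filter_upwards [(bump_spec (E := E) x).2.2] with y hy
    change bump E x y • _ = _
    rw [hy, one_smul]
  rw [mvfderiv_congr h, mvfderiv_clm_extChartAt _ _ (mem_chart_source E x)]
  have := congrArg (fun l => l v) (mfderiv_extChartAt_self (I := 𝓘(ℝ, E)) (x := x))
  have h2 : mvfderiv 𝓘(ℝ, E) (extChartAt 𝓘(ℝ, E) x) x v = v := this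
  rw [ContinuousLinearMap.comp_apply, h2]
  rfl

variable {cov : CovariantDerivative 𝓘(ℝ, E) E (TangentSpace 𝓘(ℝ, E) : M → Type _)}

/-- Powers of test functions read off the diagonal values of Φ, and by polarization these determine
Φ. -/
theorem quantizeHom_testFn_pow (hcov : CovariantDerivative.ContMDiffCovariantDerivative cov ∞)
    (ħ : ℝ) {k : ℕ} (Φ : SymTensorField E M k) (x : M) (α : TangentSpace 𝓘(ℝ, E) x →L[ℝ] ℝ) :
    quantizeHom cov ħ (Φ : ContravariantField E M k) (testFn x α ^ k : SmoothFn E M) x =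
      (-Complex.I * ħ) ^ k * (k.factorial * Φ.1 x (fun _ => α)) := by
  rw [quantizeHom_pow hcov ħ Φ (testFn_mem_maxIdeal x α), ← contraction_mul_prod]
  simp only [mvfderiv_testFn]

theorem SymTensorField.eq_zero_of_diagonal {k : ℕ} (Φ : SymTensorField E M k)
    (h : ∀ (x : M) (α : TangentSpace 𝓘(ℝ, E) x →L[ℝ] ℝ), Φ.1 x (fun _ => α) = 0) : Φ = 0 := by
  ext x α
  exact multilinear_apply_eq_zero_of_diagonal (Φ.1 x) (Φ.2.1 x) (h x) α

/-- A tensor field whose quantization is zero is zero. -/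
theorem eq_zero_of_quantize_eq_zero
    (hcov : CovariantDerivative.ContMDiffCovariantDerivative cov ∞) {ħ : ℝ} (hħ : ħ ≠ 0)
    (Φ : SymTensor E M) (h : ∀ (f : SmoothFn E M) (x : M), quantize cov ħ Φ f x = 0) : Φ = 0 := by
  classical
  by_contra hne
  have hsupp : (DFinsupp.support Φ).Nonempty := by
    rwa [Finset.nonempty_iff_ne_empty, Ne, DFinsupp.support_eq_empty]
  -- Testing the top degree n on an n-th power isolates it: lower components do not see 𝔪ₓⁿ, and
  -- higher ones are zero.
  set n := (DFinsupp.support Φ).max' hsupp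
  have hn : Φ n ≠ 0 := DFinsupp.mem_support_iff.1 (Finset.max'_mem _ hsupp)
  have hgt : ∀ k, n < k → Φ k = 0 := fun k hk => by
    by_contra h0
    exact absurd (Finset.le_max' _ k (DFinsupp.mem_support_iff.2 h0)) (not_le.2 hk)
  refine hn (SymTensorField.eq_zero_of_diagonal _ fun x α => ?_)
  have h1 := h (testFn x α ^ n) x
  rw [quantize, finsum_eq_single _ n, quantizeHom_testFn_pow hcov] at h1
  · have hk : (n.factorial : ℂ) ≠ 0 := by exact_mod_cast n.factorial_ne_zero
    have hc : (-Complex.I * ħ) ^ n ≠ 0 := pow_ne_zero _ (by simp [hħ])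
    simpa [hk, hc, hħ] using h1
  · intro k hk
    rcases lt_or_gt_of_ne hk with hlt | hlt
    · exact quantizeHom_eq_zero hcov ħ _ hlt (Ideal.pow_mem_pow (testFn_mem_maxIdeal x α) n)
    · simp [hgt k hlt, quantizeHom, contraction]

theorem IsDequantization.unique
    (hcov : CovariantDerivative.ContMDiffCovariantDerivative cov ∞) {ħ : ℝ} (hħ : ħ ≠ 0)
    {P : SmoothFn E M →ₗ[ℂ] SmoothFn E M} {Φ Ψ : SymTensor E M}
    (hΦ : IsDequantization cov ħ P Φ) (hΨ : IsDequantization cov ħ P Ψ) : Φ = Ψ := by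
  rw [← sub_eq_zero]
  refine eq_zero_of_quantize_eq_zero hcov hħ _ fun f x => ?_
  have h1 := quantize_add (cov := cov) ħ (Φ - Ψ) Ψ f x
  rw [sub_add_cancel, ← hΦ f, ← hΨ f] at h1
  simpa using h1

end TestFunctions

/-! ### Hadamard's lemma and the square of the maximal ideal. -/

section Hadamard

open Set Filter Topology

universe u in
-- Differentiation under the integral sign yields an integral of the same shape with values in V →L
-- W. The induction therefore varies `W`, and the common universe keeps V →L W among the admissible
-- targets.
theorem contDiff_intervalIntegral_nat {V : Type u} [NormedAddCommGroup V] [NormedSpace ℝ V]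
    [FiniteDimensional ℝ V] (n : ℕ) : ∀ {W : Type u} [NormedAddCommGroup W] [NormedSpace ℝ W]
      {H : V × ℝ → W}, ContDiff ℝ ∞ H →
      ContDiff ℝ n (fun y => ∫ t in (0 : ℝ)..1, H (y, t)) := by
  induction n with
  | zero =>
      intro W _ _ H hH
      rw [Nat.cast_zero, contDiff_zero]
      have h : Continuous (Function.uncurry fun y t => H (y, t)) := hH.continuous
      exact intervalIntegral.continuous_parametric_intervalIntegral_of_continuous' h 0 1
  | succ n ih =>
      intro W _ _ H hH
      have hd : Differentiable ℝ H := hH.differentiable (by simp)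
      let H' : V × ℝ → V →L[ℝ] W := fun p =>
        (fderiv ℝ H p).comp (ContinuousLinearMap.inl ℝ V ℝ)
      have hH' : ContDiff ℝ ∞ H' := (hH.fderiv_right (m := ∞) (by simp)).clm_comp contDiff_const
      rw [Nat.cast_succ]
      refine contDiff_succ_iff_hasFDerivAt.2
        ⟨fun y => ∫ t in (0 : ℝ)..1, H' (y, t), ih hH', fun y => ?_⟩
      -- The dominating constant comes from compactness of closed ball × [0, 1].
      obtain ⟨C, hC⟩ := ((isCompact_closedBall y 1).prod
        (isCompact_Icc (a := (0 : ℝ)) (b := 1))).exists_bound_of_continuousOn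
        hH'.continuous.continuousOn
      have hc : ∀ z, Continuous fun t : ℝ => H (z, t) := fun z =>
        hH.continuous.comp (Continuous.prodMk_right z)
      have hc' : ∀ z, Continuous fun t : ℝ => H' (z, t) := fun z =>
        hH'.continuous.comp (Continuous.prodMk_right z)
      refine intervalIntegral.hasFDerivAt_integral_of_dominated_of_fderiv_le (bound := fun _ => C)
        (Metric.ball_mem_nhds y one_pos)
        (Eventually.of_forall fun z => (hc z).aestronglyMeasurable)
        ((hc y).intervalIntegrable _ _) (hc' y).aestronglyMeasurable
        (MeasureTheory.ae_of_all _ fun t ht z hz => hC (z, t)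
          ⟨Metric.ball_subset_closedBall hz, ?_⟩) intervalIntegrable_const
        (MeasureTheory.ae_of_all _ fun t _ z _ => ?_)
      · rw [uIoc_of_le zero_le_one] at ht
        exact ⟨ht.1.le, ht.2⟩
      · exact (hd (z, t)).hasFDerivAt.comp z (hasFDerivAt_prodMk_left z t)

universe u in
theorem contDiff_intervalIntegral {V W : Type u} [NormedAddCommGroup V] [NormedSpace ℝ V]
    [FiniteDimensional ℝ V] [NormedAddCommGroup W] [NormedSpace ℝ W]
    {H : V × ℝ → W} (hH : ContDiff ℝ ∞ H) :
    ContDiff ℝ ∞ (fun y => ∫ t in (0 : ℝ)..1, H (y, t)) :=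
  contDiff_infty.2 fun n => contDiff_intervalIntegral_nat n hH

/-- Hadamard's lemma. -/
theorem exists_contDiff_eq_apply_sub {V : Type*} [NormedAddCommGroup V] [NormedSpace ℝ V]
    [FiniteDimensional ℝ V] {F : V → ℂ} (hF : ContDiff ℝ ∞ F) (a : V) :
    ∃ G : V → V →L[ℝ] ℂ, ContDiff ℝ ∞ G ∧ G a = fderiv ℝ F a ∧
      ∀ y, F y = F a + G y (y - a) := by
  have hl : ContDiff ℝ ∞ (fun p : V × ℝ => a + p.2 • (p.1 - a)) := by fun_prop
  have hH : ContDiff ℝ ∞ (fun p : V × ℝ => fderiv ℝ F (a + p.2 • (p.1 - a))) :=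
    (hF.fderiv_right (m := ∞) (by simp)).comp hl
  -- Here G(y) = ∫₀¹ dF(a + t(y - a)) dt.
  refine ⟨_, contDiff_intervalIntegral hH, by simp, fun y => ?_⟩
  have hc : Continuous fun t : ℝ => fderiv ℝ F (a + t • (y - a)) :=
    hH.continuous.comp (Continuous.prodMk_right y)
  rw [ContinuousLinearMap.intervalIntegral_apply (hc.intervalIntegrable _ _)]
  have hderiv : ∀ t ∈ uIcc (0 : ℝ) 1, HasDerivAt (fun t : ℝ => F (a + t • (y - a)))
      (fderiv ℝ F (a + t • (y - a)) (y - a)) t := by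
    intro t _
    have h1 : HasDerivAt (fun t : ℝ => a + t • (y - a)) (y - a) t := by
      simpa using ((hasDerivAt_id t).smul_const (y - a)).const_add a
    exact ((hF.differentiable (by simp)) _).hasFDerivAt.comp_hasDerivAt t h1
  rw [intervalIntegral.integral_eq_sub_of_hasDerivAt hderiv
    ((hc.clm_apply continuous_const).intervalIntegrable _ _)]
  simp

variable [IsManifold 𝓘(ℝ, E) ∞ M] [FiniteDimensional ℝ E] [T2Space M]

theorem SmoothFn.exists_contDiff_eventuallyEq (f : SmoothFn E M) (x : M) :
    ∃ F : E → ℂ, ContDiff ℝ ∞ F ∧ ∀ᶠ y in 𝓝 x, (f : M → ℂ) y = F (extChartAt 𝓘(ℝ, E) x y) := by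
  set φ := extChartAt 𝓘(ℝ, E) x
  have ht : φ.target ∈ 𝓝 (φ x) := extChartAt_target_mem_nhds x
  have hto : IsOpen φ.target := isOpen_extChartAt_target x
  obtain ⟨χ, hχ, hχU, hχ1⟩ := exists_smoothBump (E := E) (M := E) ht
  have hg : SmoothOn (E := E) (fun e => (f : M → ℂ) (φ.symm e)) φ.target :=
    f.2.comp_contMDiffOn (contMDiffOn_extChartAt_symm x)
  refine ⟨_, contMDiff_iff_contDiff.1 (hg.contMDiff_bump_smul hχ hto hχU), ?_⟩
  have hφ : ContinuousAt φ x := continuousAt_extChartAt x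
  filter_upwards [hφ.eventually hχ1, extChartAt_source_mem_nhds (I := 𝓘(ℝ, E)) x] with y hy hys
  rw [hy, one_smul, φ.left_inv hys]

theorem mem_maxIdeal_iff {x : M} {f : SmoothFn E M} : f ∈ maxIdeal x ↔ (f : M → ℂ) x = 0 :=
  Iff.rfl

/-- With χ = 1 near `x` and supported where f vanishes, f = (1 - χ)f is a product of two elements of
𝔪ₓ. -/
theorem mem_maxIdeal_sq_of_eventually_eq_zero {x : M} {f : SmoothFn E M}
    (h : ∀ᶠ y in 𝓝 x, (f : M → ℂ) y = 0) : f ∈ (maxIdeal x : Ideal (SmoothFn E M)) ^ 2 := by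
  obtain ⟨U, hUf, hU, hx⟩ := eventually_nhds_iff.1 h
  obtain ⟨χ, hχ, hχU, hχ1⟩ := exists_smoothBump (E := E) (hU.mem_nhds hx)
  let c : SmoothFn E M := ⟨fun y => 1 - χ y • (1 : ℂ),
    contMDiff_const.sub (hχ.smul contMDiff_const)⟩
  have hc : c ∈ maxIdeal x := by
    rw [mem_maxIdeal_iff]
    change 1 - χ x • (1 : ℂ) = 0
    rw [hχ1.self_of_nhds]
    simp
  have hf : f = c * f := by
    ext y
    change (f : M → ℂ) y = (1 - χ y • (1 : ℂ)) * (f : M → ℂ) y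
    by_cases hy : y ∈ U
    · simp [hUf y hy]
    · have : χ y = 0 := by
        by_contra h0
        exact hy (hχU (subset_tsupport _ h0))
      simp [this]
  rw [hf, sq]
  exact Ideal.mul_mem_mul hc h.self_of_nhds

/-- In a chart, Hadamard's lemma writes f as Σ (xʲ - xʲ(x)) Gⱼ with Gⱼ(x) = ∂ⱼf(x) = 0, a sum of
products of functions vanishing at `x`. This holds only near `x`; cutting the factors off leaves an
error that vanishes near `x`. -/
theorem mem_maxIdeal_sq {x : M} {f : SmoothFn E M} (hf : f ∈ maxIdeal x)
    (hd : ∀ v, mvfderiv 𝓘(ℝ, E) (f : M → ℂ) x v = 0) :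
    f ∈ (maxIdeal x : Ideal (SmoothFn E M)) ^ 2 := by
  obtain ⟨F, hF, hfF⟩ := SmoothFn.exists_contDiff_eventuallyEq f x
  set φ := extChartAt 𝓘(ℝ, E) x with hφ
  obtain ⟨G, hG, hGa, hFG⟩ := exists_contDiff_eq_apply_sub hF (φ x)
  have hFa : F (φ x) = 0 := by rw [← hfF.self_of_nhds]; exact hf
  have hdF : fderiv ℝ F (φ x) = 0 := by
    have h1 : HasMFDerivAt 𝓘(ℝ, E) 𝓘(ℝ, E) φ x _ :=
      (mdifferentiableAt_extChartAt (mem_chart_source E x)).hasMFDerivAt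
    have h2 := ((hF.differentiable (by simp)) (φ x)).hasFDerivAt.hasMFDerivAt.comp x h1
    rw [mfderiv_extChartAt_self] at h2
    have h3 : mvfderiv 𝓘(ℝ, E) (f : M → ℂ) x = mvfderiv 𝓘(ℝ, E) (F ∘ φ) x := mvfderiv_congr hfF
    ext v
    have h4 := hd v
    rw [h3] at h4
    have h5 := congrArg (fun l : E →L[ℝ] ℂ => l v) h2.mfderiv
    exact h5.symm.trans h4
  set b := Module.finBasis ℝ E
  set U := (chartAt E x).source
  have hU : IsOpen U := (chartAt E x).open_source
  have hx : x ∈ U := mem_chart_source E x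
  have hφs : SmoothOn (E := E) φ U := contMDiffOn_extChartAt
  have hg1 : ∀ j, SmoothOn (E := E) (fun y => G (φ y) (b j)) U := fun j =>
    (contMDiff_iff_contDiff.2 (hG.clm_apply contDiff_const)).comp_contMDiffOn hφs
  have hg2 : ∀ j, SmoothOn (E := E)
      (fun y => ofRealComp (LinearMap.toContinuousLinearMap (b.coord j)) (φ y) -
        ofRealComp (LinearMap.toContinuousLinearMap (b.coord j)) (φ x)) U := fun j =>
    smoothOn_clm_extChartAt _ _ x
  choose p hp using fun j => exists_smoothFn_eventuallyEq hU (hg1 j) hx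
  choose q hq using fun j => exists_smoothFn_eventuallyEq hU (hg2 j) hx
  have hpm : ∀ j, p j ∈ maxIdeal x := fun j => by
    rw [mem_maxIdeal_iff, (hp j).self_of_nhds, hGa, hdF]
    rfl
  have hqm : ∀ j, q j ∈ maxIdeal x := fun j => by
    rw [mem_maxIdeal_iff, (hq j).self_of_nhds, sub_self]
  have hsum : ∑ j, q j * p j ∈ (maxIdeal x : Ideal (SmoothFn E M)) ^ 2 := by
    rw [sq]
    exact Ideal.sum_mem _ fun j _ => Ideal.mul_mem_mul (hqm j) (hpm j)
  have hrest : f - ∑ j, q j * p j ∈ (maxIdeal x : Ideal (SmoothFn E M)) ^ 2 := by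
    refine mem_maxIdeal_sq_of_eventually_eq_zero ?_
    filter_upwards [hfF, eventually_all.2 hp, eventually_all.2 hq] with y hy hpy hqy
    have h1 : φ y - φ x = ∑ j, (b.coord j (φ y) - b.coord j (φ x)) • b j := by
      conv_lhs => rw [← b.sum_repr (φ y - φ x)]
      simp
    have h2 : ((f - ∑ j, q j * p j : SmoothFn E M) : M → ℂ) y =
        (f : M → ℂ) y - ∑ j, (q j : M → ℂ) y * (p j : M → ℂ) y := by
      simp
    rw [h2, hy, hFG, hFa, h1, map_sum, zero_add, sub_eq_zero]
    refine Finset.sum_congr rfl fun j _ => ?_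
    rw [hpy, hqy, map_smul, Complex.real_smul, ofRealComp_apply, ofRealComp_apply,
      ← Complex.ofReal_sub]
    rfl
  simpa using Ideal.add_mem _ hrest hsum

end Hadamard

/-! ### The principal symbol, and existence of the dequantization. -/

section Symbol

open Set Filter Topology

theorem prod_sub_prod_mem_pow {A ι : Type*} [CommRing A] {I : Ideal A} (s : Finset ι)
    {f g : ι → A} (hf : ∀ i ∈ s, f i ∈ I) (hg : ∀ i ∈ s, g i ∈ I)
    (hfg : ∀ i ∈ s, f i - g i ∈ I ^ 2) :
    ∏ i ∈ s, f i - ∏ i ∈ s, g i ∈ I ^ (s.card + 1) := by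
  classical
  induction s using Finset.induction_on with
  | empty => simp
  | insert a s ha ih =>
      rw [Finset.prod_insert ha, Finset.prod_insert ha, Finset.card_insert_of_notMem ha]
      -- The difference of the products is split as f_a(∏f - ∏g) + (f_a - g_a)∏g.
      have h1 : f a * (∏ i ∈ s, f i - ∏ i ∈ s, g i) ∈ I ^ (s.card + 1 + 1) := by
        rw [pow_succ' I (s.card + 1)]
        exact Ideal.mul_mem_mul (hf a (by simp)) (ih (fun i hi => hf i (by simp [hi]))
          (fun i hi => hg i (by simp [hi])) fun i hi => hfg i (by simp [hi]))
      have h2 : (f a - g a) * ∏ i ∈ s, g i ∈ I ^ (s.card + 1 + 1) := by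
        have h3 : ∏ i ∈ s, g i ∈ I ^ s.card := by
          rw [← Finset.prod_const]
          exact Ideal.prod_mem_prod fun i hi => hg i (by simp [hi])
        have h4 := Ideal.mul_mem_mul (hfg a (by simp)) h3
        rwa [← pow_add, show 2 + s.card = s.card + 1 + 1 by ring] at h4
      have h5 := Ideal.add_mem _ h1 h2
      ring_nf at h5 ⊢
      exact h5

variable [IsManifold 𝓘(ℝ, E) ∞ M]

theorem SmoothFn.mdifferentiableAt (f : SmoothFn E M) (x : M) :
    MDifferentiableAt 𝓘(ℝ, E) 𝓘(ℝ, ℂ) (f : M → ℂ) x :=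
  ContMDiffAt.mdifferentiableAt (n := ∞) (f.2 x) (by simp)

theorem mvfderiv_smul_add (c : ℂ) (f g : SmoothFn E M) (x : M) (v : TangentSpace 𝓘(ℝ, E) x) :
    mvfderiv 𝓘(ℝ, E) (c • f + g : SmoothFn E M) x v =
      c * mvfderiv 𝓘(ℝ, E) (f : M → ℂ) x v + mvfderiv 𝓘(ℝ, E) (g : M → ℂ) x v := by
  have h1 := SmoothFn.mdifferentiableAt (c • f) x
  have h2 := mvfderiv_const_mul_complex c (SmoothFn.mdifferentiableAt f x) v
  have h3 := (h1.hasMFDerivAt.add (SmoothFn.mdifferentiableAt g x).hasMFDerivAt).mfderiv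
  have h4 := congrArg (fun l : E →L[ℝ] ℂ => l v) h3
  refine h4.trans ?_
  rw [← h2]
  rfl

variable [FiniteDimensional ℝ E] [T2Space M]

theorem sub_mem_maxIdeal_sq {x : M} {f g : SmoothFn E M} (hf : f ∈ maxIdeal x)
    (hg : g ∈ maxIdeal x)
    (h : ∀ v, mvfderiv 𝓘(ℝ, E) (f : M → ℂ) x v = mvfderiv 𝓘(ℝ, E) (g : M → ℂ) x v) :
    f - g ∈ (maxIdeal x : Ideal (SmoothFn E M)) ^ 2 := by
  have e : f - g = (-1 : ℂ) • g + f := by rw [neg_one_smul]; ring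
  refine mem_maxIdeal_sq (Ideal.sub_mem _ hf hg) fun v => ?_
  rw [e, mvfderiv_smul_add, h]
  ring

/-- The complex subspace spanned by the functions `testFn x α`. -/
def testSpan (x : M) : Submodule ℂ (SmoothFn E M) := Submodule.span ℂ (range (testFn x))

theorem testSpan_le (x : M) :
    testSpan x ≤ (maxIdeal x : Ideal (SmoothFn E M)).restrictScalars ℂ := by
  refine Submodule.span_le.2 ?_
  rintro _ ⟨α, rfl⟩
  exact testFn_mem_maxIdeal x α

/-- Subtract from f the test functions built on the real and imaginary parts of its differential:
the rest has zero differential, hence lies in 𝔪ₓ². -/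
theorem maxIdeal_le_testSpan_sup (x : M) :
    (maxIdeal x : Ideal (SmoothFn E M)).restrictScalars ℂ ≤
      testSpan x ⊔ (maxIdeal x : Ideal (SmoothFn E M)).restrictScalars ℂ ^ 2 := by
  intro f hf
  let α : TangentSpace 𝓘(ℝ, E) x →L[ℝ] ℝ :=
    Complex.reCLM.comp (mvfderiv 𝓘(ℝ, E) (f : M → ℂ) x)
  let β : TangentSpace 𝓘(ℝ, E) x →L[ℝ] ℝ :=
    Complex.imCLM.comp (mvfderiv 𝓘(ℝ, E) (f : M → ℂ) x)
  have hg : Complex.I • testFn x β + testFn x α ∈ testSpan x :=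
    add_mem (Submodule.smul_mem _ _ (Submodule.subset_span ⟨β, rfl⟩))
      (Submodule.subset_span ⟨α, rfl⟩)
  have h : f - (Complex.I • testFn x β + testFn x α) ∈
      (maxIdeal x : Ideal (SmoothFn E M)) ^ 2 := by
    refine sub_mem_maxIdeal_sq hf (testSpan_le x hg) fun v => ?_
    rw [mvfderiv_smul_add, mvfderiv_testFn, mvfderiv_testFn]
    have := Complex.re_add_im (mvfderiv 𝓘(ℝ, E) (f : M → ℂ) x v)
    rw [← this, mul_comm, add_comm]
    rfl
  rw [← Submodule.restrictScalars_pow two_ne_zero]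
  have := Submodule.add_mem_sup hg
    (Submodule.restrictScalars_mem ℂ ((maxIdeal x : Ideal (SmoothFn E M)) ^ 2) _ |>.2 h)
  rwa [add_sub_cancel] at this

theorem maxIdeal_pow_le (x : M) (n : ℕ) :
    (maxIdeal x : Ideal (SmoothFn E M)).restrictScalars ℂ ^ n ≤
      testSpan x ^ n ⊔ (maxIdeal x : Ideal (SmoothFn E M)).restrictScalars ℂ ^ (n + 1) := by
  set N := (maxIdeal x : Ideal (SmoothFn E M)).restrictScalars ℂ
  have hT : testSpan x ≤ N := testSpan_le x
  induction n with
  | zero => simp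
  | succ n ih =>
      calc N ^ (n + 1) = N ^ n * N := pow_succ _ _
        _ ≤ (testSpan x ^ n ⊔ N ^ (n + 1)) * N := by gcongr
        _ = testSpan x ^ n * N ⊔ N ^ (n + 1 + 1) := by rw [Submodule.sup_mul, ← pow_succ]
        _ ≤ testSpan x ^ n * (testSpan x ⊔ N ^ 2) ⊔ N ^ (n + 1 + 1) := by
            gcongr
            exact maxIdeal_le_testSpan_sup x
        _ = testSpan x ^ (n + 1) ⊔ testSpan x ^ n * N ^ 2 ⊔ N ^ (n + 1 + 1) := by
            rw [Submodule.mul_sup, ← pow_succ]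
        _ ≤ testSpan x ^ (n + 1) ⊔ N ^ (n + 1 + 1) := by
            refine sup_le (sup_le le_sup_left (le_trans ?_ le_sup_right)) le_sup_right
            calc testSpan x ^ n * N ^ 2 ≤ N ^ n * N ^ 2 := by gcongr
              _ = _ := by rw [← pow_add]

/-- A map which vanishes on `𝔪ₓ ^ (n + 1)` and on the products of `n` test functions vanishes on
`𝔪ₓ ^ n`. -/
theorem eq_zero_on_maxIdeal_pow {x : M} {n : ℕ} {L : SmoothFn E M →ₗ[ℂ] ℂ}
    (h1 : ∀ f ∈ (maxIdeal x : Ideal (SmoothFn E M)) ^ (n + 1), L f = 0)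
    (h2 : ∀ α : Fin n → (TangentSpace 𝓘(ℝ, E) x →L[ℝ] ℝ), L (∏ i, testFn x (α i)) = 0)
    {f : SmoothFn E M} (hf : f ∈ (maxIdeal x : Ideal (SmoothFn E M)) ^ n) : L f = 0 := by
  have hT : testSpan x ^ n ≤ LinearMap.ker L := by
    rw [testSpan, Submodule.span_pow, Submodule.span_le]
    intro a ha
    obtain ⟨g, rfl⟩ := Set.mem_pow.1 ha
    choose α hα using fun i => (g i).2
    have := h2 α
    rw [← List.prod_ofFn] at this
    simpa [hα] using this
  have hN : (maxIdeal x : Ideal (SmoothFn E M)).restrictScalars ℂ ^ (n + 1) ≤ LinearMap.ker L := by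
    rw [← Submodule.restrictScalars_pow n.succ_ne_zero]
    exact fun f hf => h1 f hf
  have hle := (maxIdeal_pow_le x n).trans (sup_le hT hN)
  -- The zeroth power of a ℂ-submodule is ℂ·1 and not the whole ring, so for n = 0 the inclusion is
  -- too weak; there f - f(x) ∈ 𝔪ₓ is used instead.
  rcases Nat.eq_zero_or_pos n with rfl | hn
  · have hL1 : L 1 = 0 := hT (by rw [pow_zero]; exact Submodule.one_le.1 le_rfl)
    have hm : f - algebraMap ℂ (SmoothFn E M) ((f : M → ℂ) x) ∈ maxIdeal x := by
      rw [mem_maxIdeal_iff]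
      exact sub_self ((f : M → ℂ) x)
    have h3 := h1 _ (by simpa using hm)
    rw [map_sub, Algebra.algebraMap_eq_smul_one, map_smul, hL1, smul_zero, sub_zero] at h3
    exact h3
  · rw [← Submodule.restrictScalars_pow hn.ne'] at hle
    exact hle hf

/-- The value of a function at `x`, as a linear map. -/
def evalAt (x : M) : SmoothFn E M →ₗ[ℂ] ℂ := (LinearMap.proj x).comp (SmoothFn E M).val.toLinearMap

theorem evalAt_apply (x : M) (f : SmoothFn E M) : evalAt x f = (f : M → ℂ) x := rfl

variable (P : SmoothFn E M →ₗ[ℂ] SmoothFn E M)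

/-- The multilinear form `(α₁, …, αₙ) ↦ P(f₁ ⋯ fₙ)(x)`, where `fᵢ ∈ 𝔪ₓ` has the differential
`αᵢ`. -/
def symbolForm (n : ℕ) (x : M) :
    MultilinearMap ℝ (fun _ : Fin n => TangentSpace 𝓘(ℝ, E) x →L[ℝ] ℝ) ℂ :=
  (((evalAt x).comp P).restrictScalars ℝ).compMultilinearMap
    ((MultilinearMap.mkPiAlgebra ℝ (Fin n) (SmoothFn E M)).compLinearMap fun _ => testFn x)

theorem symbolForm_apply (n : ℕ) (x : M) (α : Fin n → (TangentSpace 𝓘(ℝ, E) x →L[ℝ] ℝ)) :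
    symbolForm P n x α = (P (∏ i, testFn x (α i)) : M → ℂ) x := rfl

variable {P}

/-- Other representatives of the same differentials change the product by an element of 𝔪ₓⁿ⁺¹, which
P does not see at `x`. Thus the `testFn x`, chosen separately at each point, can be traded for
functions varying smoothly with `x`. -/
theorem symbolForm_eq {n : ℕ} {x : M}
    (hP : ∀ f ∈ (maxIdeal x : Ideal (SmoothFn E M)) ^ (n + 1), P f ∈ maxIdeal x)
    (α : Fin n → (TangentSpace 𝓘(ℝ, E) x →L[ℝ] ℝ)) {f : Fin n → SmoothFn E M}
    (hf : ∀ i, f i ∈ maxIdeal x)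
    (hd : ∀ i v, mvfderiv 𝓘(ℝ, E) (f i : M → ℂ) x v = α i v) :
    symbolForm P n x α = (P (∏ i, f i) : M → ℂ) x := by
  have h1 := prod_sub_prod_mem_pow Finset.univ (fun i _ => testFn_mem_maxIdeal x (α i))
    (fun i _ => hf i) fun i _ => sub_mem_maxIdeal_sq (testFn_mem_maxIdeal x (α i)) (hf i)
      fun v => by rw [mvfderiv_testFn, hd]
  rw [Finset.card_univ, Fintype.card_fin] at h1
  have h2 := hP _ h1
  rw [mem_maxIdeal_iff, map_sub] at h2
  rw [symbolForm_apply]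
  exact sub_eq_zero.1 h2

theorem symbolForm_mem {n : ℕ} (hP : IsDiffOpOfOrder n P) :
    symbolForm P n ∈ SymTensorField E M n := by
  refine ⟨fun x α σ => ?_, fun x₀ β x₁ hx₁ => ?_⟩
  · rw [symbolForm_apply, symbolForm_apply]
    exact congrArg (fun f => (P f : M → ℂ) x) (Equiv.prod_comp σ fun i => testFn x (α i))
  · set U := (chartAt E x₀).source
    have hU : IsOpen U := (chartAt E x₀).open_source
    choose H hH using fun i => exists_smoothFn_eventuallyEq hU
      (smoothOn_clm_extChartAt (ofRealComp (β i)) 0 x₀) hx₁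
    -- Take Hᵢ - Hᵢ(x) as representatives and expand their product: P is then applied only to
    -- products of the fixed Hᵢ, and x enters through smooth coefficients.
    have key : ∀ᶠ x in 𝓝 x₁, symbolForm P n x
        (fun i => (β i).comp (mvfderiv 𝓘(ℝ, E) (extChartAt 𝓘(ℝ, E) x₀) x)) =
        ∑ s ∈ (Finset.univ : Finset (Fin n)).powerset, (∏ i ∈ Finset.univ \ s, -(H i : M → ℂ) x) *
          (P (∏ i ∈ s, H i) : M → ℂ) x := by
      filter_upwards [eventually_all.2 fun i => (hH i).eventually_nhds, hU.mem_nhds hx₁]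
        with x hx hxU
      let f : Fin n → SmoothFn E M := fun i => H i + algebraMap ℂ _ (-(H i : M → ℂ) x)
      have hf : ∀ i, f i ∈ maxIdeal x := fun i => by
        rw [mem_maxIdeal_iff]
        simp [f]
      rw [symbolForm_eq (hP x) _ hf]
      · simp only [f, Finset.prod_add, ← map_prod, map_sum]
        rw [← evalAt_apply, map_sum]
        refine Finset.sum_congr rfl fun s _ => ?_
        rw [mul_comm, ← Algebra.smul_def, map_smul, map_smul, smul_eq_mul, evalAt_apply]
      · intro i v
        have h1 : (f i : M → ℂ) =ᶠ[𝓝 x] fun y =>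
            ofRealComp (β i) (extChartAt 𝓘(ℝ, E) x₀ y) - (H i : M → ℂ) x := by
          filter_upwards [hx i] with y hy
          simp only [sub_zero] at hy
          simp [f, hy, sub_eq_add_neg]
        rw [mvfderiv_congr h1, mvfderiv_clm_extChartAt _ _ hxU]
        rfl
    refine ContMDiffAt.contMDiffWithinAt (ContMDiffAt.congr_of_eventuallyEq ?_ key)
    let S : SmoothFn E M := ∑ s ∈ (Finset.univ : Finset (Fin n)).powerset,
      (∏ i ∈ Finset.univ \ s, -H i) * P (∏ i ∈ s, H i)
    convert S.2 x₁ using 1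
    ext x
    simp [S]

variable {cov : CovariantDerivative 𝓘(ℝ, E) E (TangentSpace 𝓘(ℝ, E) : M → Type _)}

/-- The tensor is the symbol of P divided by (-iħ)ⁿ n!, the factor from `quantizeHom_testFn_pow`.
The difference then has a symbol vanishing on the diagonal, so by polarization it kills all products
of n test functions at `x`. -/
theorem exists_sub_quantizeHomOp (hcov : CovariantDerivative.ContMDiffCovariantDerivative cov ∞)
    {ħ : ℝ} (hħ : ħ ≠ 0) {n : ℕ} (hP : IsDiffOpOfOrder n P) :
    ∃ Φ : SymTensorField E M n, ∀ x : M, ∀ f ∈ (maxIdeal x : Ideal (SmoothFn E M)) ^ n,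
      (P - quantizeHomOp hcov ħ Φ) f ∈ maxIdeal x := by
  set c : ℂ := (-Complex.I * ħ) ^ n * n.factorial
  have hc : c ≠ 0 := mul_ne_zero (pow_ne_zero _ (by simp [hħ]))
    (by exact_mod_cast n.factorial_ne_zero)
  let Φ : SymTensorField E M n := c⁻¹ • ⟨_, symbolForm_mem hP⟩
  refine ⟨Φ, fun x f hf => ?_⟩
  set R := P - quantizeHomOp hcov ħ Φ with hR
  have hR1 : ∀ f ∈ (maxIdeal x : Ideal (SmoothFn E M)) ^ (n + 1), R f ∈ maxIdeal x := by
    intro f hf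
    refine Ideal.sub_mem _ (hP x f hf) ?_
    exact quantizeHom_eq_zero hcov ħ Φ n.lt_succ_self hf
  refine eq_zero_on_maxIdeal_pow (L := (evalAt x).comp R) hR1 (fun α => ?_) hf
  refine multilinear_apply_eq_zero_of_diagonal (symbolForm R n x) (fun v σ => ?_) (fun α => ?_) α
  · rw [symbolForm_apply, symbolForm_apply]
    exact congrArg (fun f => (R f : M → ℂ) x) (Equiv.prod_comp σ fun i => testFn x (v i))
  · have h1 := quantizeHom_testFn_pow hcov ħ Φ x α
    have h2 : Φ.1 x (fun _ => α) = c⁻¹ * (P (testFn x α ^ n) : M → ℂ) x := by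
      change c⁻¹ * symbolForm P n x (fun _ => α) = _
      rw [symbolForm_apply, Finset.prod_const, Finset.card_univ, Fintype.card_fin]
    rw [h2, ← mul_assoc, mul_inv_cancel_left₀ hc] at h1
    rw [symbolForm_apply, Finset.prod_const, Finset.card_univ, Fintype.card_fin]
    exact sub_eq_zero.2 h1.symm

/-- The exponent n is one more than an order bound, so the induction starts at n = 0: there 𝔪ₓ⁰ is
the whole ring and P is zero. -/
theorem exists_isDequantization
    (hcov : CovariantDerivative.ContMDiffCovariantDerivative cov ∞) {ħ : ℝ} (hħ : ħ ≠ 0) (n : ℕ) :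
    ∀ {P : SmoothFn E M →ₗ[ℂ] SmoothFn E M},
      (∀ x : M, ∀ f ∈ (maxIdeal x : Ideal (SmoothFn E M)) ^ n, P f ∈ maxIdeal x) →
      ∃ Φ, IsDequantization cov ħ P Φ := by
  induction n with
  | zero =>
      intro P hP
      refine ⟨0, fun f => ?_⟩
      ext x
      have h := hP x f (by simp)
      rw [mem_maxIdeal_iff] at h
      simp [h, quantize, quantizeHom, contraction]
  | succ n ih =>
      intro P hP
      obtain ⟨Φ, hΦ⟩ := exists_sub_quantizeHomOp hcov hħ (n := n) hP
      obtain ⟨Ψ, hΨ⟩ := ih hΦ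
      refine ⟨Ψ + DirectSum.of (fun k => SymTensorField E M k) n Φ, fun f => ?_⟩
      ext x
      rw [quantize_add, quantize_of, ← hΨ f]
      exact (sub_add_cancel ((P f : M → ℂ) x) _).symm

theorem isDequantization_dequantize
    (hcov : CovariantDerivative.ContMDiffCovariantDerivative cov ∞) {ħ : ℝ} (hħ : ħ ≠ 0)
    (hP : IsDiffOp P) : IsDequantization cov ħ P (dequantize cov ħ P) := by
  obtain ⟨r, hr⟩ := hP
  have h := exists_isDequantization hcov hħ (r + 1) hr
  rw [dequantize, dif_pos h]
  exact h.choose_spec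

end Symbol

/-! ### The inverse metric: index raising, gradients and smoothness of gʲᵏ. -/

section Metric

open Set Filter Topology

theorem contDiff_matrix_det {n : Type*} [Fintype n] [DecidableEq n] :
    ContDiff ℝ ∞ (fun A : n → n → ℝ => (Matrix.of A).det) := by
  simp only [Matrix.det_apply, Matrix.of_apply]
  refine ContDiff.sum fun σ _ => ContDiff.const_smul _ (contDiff_prod fun i _ => ?_)
  fun_prop

theorem contDiffAt_matrix_inv_apply {n : Type*} [Fintype n] [DecidableEq n] (j k : n)
    {A : n → n → ℝ} (hA : (Matrix.of A).det ≠ 0) :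
    ContDiffAt ℝ ∞ (fun A : n → n → ℝ => (Matrix.of A)⁻¹ j k) A := by
  have h1 : ContDiff ℝ ∞ (fun A : n → n → ℝ => (Matrix.of A).adjugate j k) := by
    simp only [Matrix.adjugate_apply]
    have h2 : ContDiff ℝ ∞ (fun A : n → n → ℝ => Function.update A k (Pi.single j (1 : ℝ))) := by
      refine contDiff_pi.2 fun i => ?_
      by_cases h : i = k
      · subst h
        simp only [Function.update_self]
        exact contDiff_const
      · simp only [Function.update_of_ne h]
        fun_prop
    exact contDiff_matrix_det.comp h2
  simp only [Matrix.inv_def, Matrix.smul_apply, smul_eq_mul, Ring.inverse_eq_inv']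
  exact (contDiff_matrix_det.contDiffAt.inv hA).mul h1.contDiffAt

variable [IsManifold 𝓘(ℝ, E) ∞ M]

namespace PseudoMetric

variable (g : PseudoMetric E M)

theorem smoothOn_inner {X Y : Π x : M, TangentSpace 𝓘(ℝ, E) x} {U : Set M}
    (hX : SmoothFieldOn X U) (hY : SmoothFieldOn Y U) :
    SmoothOn (E := E) (fun x => g.inner x (X x) (Y x)) U := by
  intro x hx
  have : ContMDiffWithinAt 𝓘(ℝ, E) (𝓘(ℝ, E).prod 𝓘(ℝ, ℝ)) ∞
      (fun m => Bundle.TotalSpace.mk' ℝ (E := Bundle.Trivial M ℝ) m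
        (g.inner m (X m) (Y m))) U x := by
    apply ContMDiffWithinAt.clm_bundle_apply₂ (F₁ := E) (F₂ := E) (b := id)
      (E₁ := (TangentSpace 𝓘(ℝ, E) : M → Type _)) (E₂ := (TangentSpace 𝓘(ℝ, E) : M → Type _))
    · exact g.contMDiff.contMDiffAt.contMDiffWithinAt
    · exact hX x hx
    · exact hY x hx
  simp only [Bundle.contMDiffWithinAt_totalSpace] at this
  exact this.2

variable [FiniteDimensional ℝ E]

theorem inner_sharp (x : M) (α : TangentSpace 𝓘(ℝ, E) x →L[ℝ] ℝ) (v : TangentSpace 𝓘(ℝ, E) x) :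
    g.inner x (g.sharp x α) v = α v :=
  congrArg (fun l : TangentSpace 𝓘(ℝ, E) x →L[ℝ] ℝ => l v) ((g.flatEquiv x).apply_symm_apply α)

theorem sharp_eq {x : M} {α : TangentSpace 𝓘(ℝ, E) x →L[ℝ] ℝ} {w : TangentSpace 𝓘(ℝ, E) x}
    (h : ∀ v, g.inner x w v = α v) : g.sharp x α = w :=
  (g.flatEquiv x).symm_apply_eq.2 (ContinuousLinearMap.ext fun v => (h v).symm)

theorem sharp_inner (x : M) (v : TangentSpace 𝓘(ℝ, E) x) : g.sharp x (g.inner x v) = v :=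
  g.sharp_eq fun _ => rfl

theorem contravariant_apply (x : M) (α : Fin 2 → (TangentSpace 𝓘(ℝ, E) x →L[ℝ] ℝ)) :
    g.contravariant x α = (α 0 (g.sharp x (α 1)) : ℂ) := by
  change ((g.inner x (g.sharp x (α 0)) (g.sharp x (α 1)) : ℝ) : ℂ) = _
  rw [inner_sharp]

end PseudoMetric

/-- The frame of the tangent bundle given by the chart at `x₀`. -/
def chartFrame [FiniteDimensional ℝ E] (x₀ : M) (j : Fin (Module.finrank ℝ E)) (x : M) :
    TangentSpace 𝓘(ℝ, E) x :=
  (trivializationAt E (TangentSpace 𝓘(ℝ, E) : M → Type _) x₀).localFrame (Module.finBasis ℝ E) j x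

variable [FiniteDimensional ℝ E]

theorem smoothFieldOn_chartFrame (x₀ : M) (j : Fin (Module.finrank ℝ E)) :
    SmoothFieldOn (chartFrame x₀ j) (chartAt E x₀).source :=
  (trivializationAt E (TangentSpace 𝓘(ℝ, E) : M → Type _) x₀).contMDiffOn_localFrame_baseSet ∞
    (Module.finBasis ℝ E) j

theorem linearIndependent_chartFrame (x₀ : M) {x : M} (hx : x ∈ (chartAt E x₀).source) :
    LinearIndependent ℝ fun j => chartFrame (E := E) x₀ j x := by
  set t := trivializationAt E (TangentSpace 𝓘(ℝ, E) : M → Type _) x₀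
  have hx' : x ∈ t.baseSet := hx
  have := (t.basisAt (Module.finBasis ℝ E) hx').linearIndependent
  have h : (fun j => chartFrame (E := E) x₀ j x) = t.basisAt (Module.finBasis ℝ E) hx' := by
    ext j
    exact t.localFrame_apply_of_mem_baseSet _ hx'
  rw [h]
  exact this

variable [T2Space M]

theorem exists_sum_smul_chartFrame (x₀ : M) {x : M} (hx : x ∈ (chartAt E x₀).source)
    (v : TangentSpace 𝓘(ℝ, E) x) :
    ∃ c : Fin (Module.finrank ℝ E) → ℝ, v = ∑ j, c j • chartFrame x₀ j x :=
  ⟨_, (extChartAt_dual_frame x₀ hx v).symm⟩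

theorem smoothFieldOn_sum {ι : Type*} (s : Finset ι) {c : ι → M → ℝ}
    {Y : ι → Π x : M, TangentSpace 𝓘(ℝ, E) x} {U : Set M} (hc : ∀ j, SmoothOn (E := E) (c j) U)
    (hY : ∀ j, SmoothFieldOn (Y j) U) : SmoothFieldOn (fun x => ∑ j ∈ s, c j x • Y j x) U := by
  classical
  induction s using Finset.induction_on with
  | empty => simpa using! smoothFieldOn_zero
  | insert a s ha ih =>
      have := (SmoothFieldOn.smul (hc a) (hY a)).add ih
      refine this.congr fun x _ => ?_
      have h : ∑ j ∈ insert a s, c j x • Y j x = c a x • Y a x + ∑ j ∈ s, c j x • Y j x :=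
        Finset.sum_insert ha
      exact congrArg (fun v => (⟨x, v⟩ : TangentBundle 𝓘(ℝ, E) M)) h

namespace PseudoMetric

variable (g : PseudoMetric E M)

/-- The matrix of the metric in the frame given by the chart at `x₀`. -/
def gram (x₀ x : M) (j k : Fin (Module.finrank ℝ E)) : ℝ :=
  g.inner x (chartFrame x₀ j x) (chartFrame x₀ k x)

/-- A vector in the kernel of the Gram matrix gives the frame coefficients of a tangent vector
orthogonal to every other. -/
theorem det_gram_ne_zero (x₀ : M) {x : M} (hx : x ∈ (chartAt E x₀).source) :
    (Matrix.of (g.gram x₀ x)).det ≠ 0 := by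
  intro h0
  obtain ⟨c, hc, hAc⟩ := Matrix.exists_mulVec_eq_zero_iff.2 h0
  refine hc ?_
  have hw : ∑ j, c j • chartFrame x₀ j x = 0 := by
    refine g.nondegenerate x _ fun w => ?_
    obtain ⟨d, rfl⟩ := exists_sum_smul_chartFrame x₀ hx w
    rw [map_sum]
    refine Finset.sum_eq_zero fun k _ => ?_
    have h1 := congrFun hAc k
    rw [map_smul, g.symm, map_sum]
    simp only [map_smul, Matrix.mulVec, dotProduct, Matrix.of_apply, Pi.zero_apply] at h1 ⊢
    have h2 : ∑ j, c j • g.inner x (chartFrame x₀ k x) (chartFrame x₀ j x) = 0 := by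
      rw [← h1]
      exact Finset.sum_congr rfl fun j _ => mul_comm _ _
    rw [h2, smul_zero]
  exact funext (Fintype.linearIndependent_iff.1 (linearIndependent_chartFrame x₀ hx) c hw)

theorem smoothOn_gram (x₀ : M) (j k : Fin (Module.finrank ℝ E)) :
    SmoothOn (E := E) (fun x => g.gram x₀ x j k) (chartAt E x₀).source :=
  g.smoothOn_inner (smoothFieldOn_chartFrame x₀ j) (smoothFieldOn_chartFrame x₀ k)

theorem smoothOn_gram_inv (x₀ : M) (j k : Fin (Module.finrank ℝ E)) :
    SmoothOn (E := E) (fun x => (Matrix.of (g.gram x₀ x))⁻¹ j k) (chartAt E x₀).source := by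
  have h : SmoothOn (E := E) (g.gram x₀) (chartAt E x₀).source :=
    contMDiffOn_pi_space.2 fun j => contMDiffOn_pi_space.2 fun k => g.smoothOn_gram x₀ j k
  intro x hx
  exact (contDiffAt_matrix_inv_apply j k (g.det_gram_ne_zero x₀ hx)).contMDiffAt
    |>.comp_contMDiffWithinAt x (h x hx)

theorem sharp_eq_sum (x₀ : M) {x : M} (hx : x ∈ (chartAt E x₀).source)
    (α : TangentSpace 𝓘(ℝ, E) x →L[ℝ] ℝ) :
    g.sharp x α = ∑ k, (∑ j, (Matrix.of (g.gram x₀ x))⁻¹ j k * α (chartFrame x₀ j x)) •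
      chartFrame x₀ k x := by
  set A := Matrix.of (g.gram x₀ x) with hA
  have hinv : A⁻¹ * A = 1 :=
    Matrix.nonsing_inv_mul _ (isUnit_iff_ne_zero.2 (g.det_gram_ne_zero x₀ hx))
  refine g.sharp_eq fun v => ?_
  obtain ⟨d, rfl⟩ := exists_sum_smul_chartFrame x₀ hx v
  refine (map_sum (g.inner x _) _ _).trans (Eq.trans ?_ (map_sum α _ _).symm)
  refine Finset.sum_congr rfl fun l _ => ?_
  rw [map_smul, map_smul, map_sum, sum_apply]
  refine congrArg (fun r : ℝ => d l • r) ?_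
  simp only [map_smul, smul_apply, smul_eq_mul, Finset.sum_mul]
  rw [Finset.sum_comm]
  have : ∀ j, ∑ k, A⁻¹ j k * α (chartFrame x₀ j x) *
      g.inner x (chartFrame x₀ k x) (chartFrame x₀ l x) =
      (A⁻¹ * A) j l * α (chartFrame x₀ j x) := fun j => by
    rw [Matrix.mul_apply, Finset.sum_mul]
    refine Finset.sum_congr rfl fun k _ => ?_
    rw [hA, Matrix.of_apply, gram]
    ring
  simp only [this, hinv, Matrix.one_apply]
  simp

theorem smoothFieldOn_sharp (x₀ : M) {η : Π x : M, TangentSpace 𝓘(ℝ, E) x →L[ℝ] ℝ}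
    (hη : ∀ j, SmoothOn (E := E) (fun x => η x (chartFrame x₀ j x)) (chartAt E x₀).source) :
    SmoothFieldOn (fun x => g.sharp x (η x)) (chartAt E x₀).source := by
  have h := smoothFieldOn_sum Finset.univ
    (c := fun k x => ∑ j, (Matrix.of (g.gram x₀ x))⁻¹ j k * η x (chartFrame x₀ j x))
    (fun k => contMDiffOn_finsetSum fun j _ => (g.smoothOn_gram_inv x₀ j k).smul (hη j))
    (smoothFieldOn_chartFrame (E := E) x₀)
  refine h.congr fun x hx => ?_
  exact congrArg (fun v => (⟨x, v⟩ : TangentBundle 𝓘(ℝ, E) M)) (g.sharp_eq_sum x₀ hx (η x))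

theorem smoothFieldOn_grad {u : M → ℝ} (hu : ContMDiff 𝓘(ℝ, E) 𝓘(ℝ, ℝ) ∞ u) (x₀ : M) :
    SmoothFieldOn (g.grad u) (chartAt E x₀).source :=
  g.smoothFieldOn_sharp x₀ fun j => SmoothOn.mvfderiv_apply (chartAt E x₀).open_source
    hu.contMDiffOn (smoothFieldOn_chartFrame x₀ j)

theorem contravariant_mem : g.contravariant ∈ SymTensorField E M 2 := by
  refine ⟨fun x α σ => ?_, fun x₀ β => ?_⟩
  · have h : ∀ α β, g.inner x (g.sharp x α) (g.sharp x β) =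
        g.inner x (g.sharp x β) (g.sharp x α) := fun α β => g.symm x _ _
    change ((g.inner x (g.sharp x (α (σ 0))) (g.sharp x (α (σ 1))) : ℝ) : ℂ) =
      (g.inner x (g.sharp x (α 0)) (g.sharp x (α 1)) : ℝ)
    have h2 : σ 0 = 0 ∧ σ 1 = 1 ∨ σ 0 = 1 ∧ σ 1 = 0 := by revert σ; decide
    rcases h2 with ⟨h0, h1⟩ | ⟨h0, h1⟩
    · rw [h0, h1]
    · rw [h0, h1, h]
  · set U := (chartAt E x₀).source
    have hU : IsOpen U := (chartAt E x₀).open_source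
    -- The component gʲᵏ is the derivative of one coordinate function along the raised differential
    -- of the other.
    have h1 : SmoothFieldOn (fun x => g.sharp x
        ((β 1).comp (mvfderiv 𝓘(ℝ, E) (extChartAt 𝓘(ℝ, E) x₀) x))) U := by
      refine g.smoothFieldOn_sharp x₀ fun j => ?_
      refine (SmoothOn.mvfderiv_apply hU (smoothOn_clm_extChartAt (β 1) 0 x₀)
        (smoothFieldOn_chartFrame x₀ j)).congr fun x hx => ?_
      rw [mvfderiv_clm_extChartAt _ _ hx]
    refine (SmoothOn.mvfderiv_apply hU (smoothOn_clm_extChartAt (ofRealComp (β 0)) 0 x₀)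
      h1).congr fun x hx => ?_
    rw [mvfderiv_clm_extChartAt _ _ hx, g.contravariant_apply]
    rfl

end PseudoMetric

end Metric

/-! ### Quantization of the metric tensor and the Laplacian. -/

section Laplacian

open Set Filter Topology

variable [IsManifold 𝓘(ℝ, E) ∞ M] [FiniteDimensional ℝ E]

theorem mvfderiv_ofReal {u : M → ℝ} {x : M} (hu : MDifferentiableAt 𝓘(ℝ, E) 𝓘(ℝ, ℝ) u x)
    (v : TangentSpace 𝓘(ℝ, E) x) :
    mvfderiv 𝓘(ℝ, E) (fun y => (u y : ℂ)) x v = (mvfderiv 𝓘(ℝ, E) u x v : ℂ) := by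
  have h := (Complex.ofRealCLM.hasFDerivAt.hasMFDerivAt.comp x hu.hasMFDerivAt).mfderiv
  exact congrArg (fun l : E →L[ℝ] ℂ => l v) h

variable [T2Space M] {cov : CovariantDerivative 𝓘(ℝ, E) E (TangentSpace 𝓘(ℝ, E) : M → Type _)}

namespace PseudoMetric

variable (g : PseudoMetric E M)

theorem inner_grad (u : M → ℝ) (x : M) (v : TangentSpace 𝓘(ℝ, E) x) :
    g.inner x (g.grad u x) v = mvfderiv 𝓘(ℝ, E) u x v :=
  g.inner_sharp x _ v

variable {g}

/-- The second covariant differential of a function is the Hessian `g(∇_v grad u, w)`. -/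
theorem covDiffAt_two (hcov : g.IsLeviCivita cov) {u : M → ℝ}
    (hu : ContMDiff 𝓘(ℝ, E) 𝓘(ℝ, ℝ) ∞ u) (x : M) (v : Fin 2 → TangentSpace 𝓘(ℝ, E) x) :
    covDiffAt cov (fun y => (u y : ℂ)) 2 x v =
      (g.inner x (cov (g.grad u) x (v 0)) (v 1) : ℝ) := by
  set U := (chartAt E x).source
  have hU : IsOpen U := (chartAt E x).open_source
  have hx : x ∈ U := mem_chart_source E x
  set X : Fin 2 → Π y : M, TangentSpace 𝓘(ℝ, E) y := fun i => FiberBundle.extend E (v i) with hXdef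
  have hX : ∀ i, SmoothFieldOn (X i) U := fun i => smoothFieldOn_extend (v i)
  have hXx : ∀ i, X i x = v i := fun i => FiberBundle.extend_apply_self E (v i)
  have hgrad : SmoothFieldOn (g.grad u) U := g.smoothFieldOn_grad hu x
  have hu' : ∀ y, MDifferentiableAt 𝓘(ℝ, E) 𝓘(ℝ, ℝ) u y := fun y =>
    (hu y).mdifferentiableAt (by simp)
  have h1 : ∀ Y : Fin 1 → Π y : M, TangentSpace 𝓘(ℝ, E) y,
      iterCovDiff cov (fun y => (u y : ℂ)) 1 Y =
        fun y => ((g.inner y (g.grad u y) (Y 0 y) : ℝ) : ℂ) := by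
    intro Y
    ext y
    simp only [iterCovDiff, Finset.univ_eq_empty, Finset.sum_empty, sub_zero]
    rw [mvfderiv_ofReal (hu' y), g.inner_grad]
  have h2 : MDifferentiableAt 𝓘(ℝ, E) 𝓘(ℝ, ℝ) (fun y => g.inner y (g.grad u y) (X 1 y)) x :=
    SmoothOn.mdifferentiableAt hU (g.smoothOn_inner hgrad (hX 1)) hx
  -- Compatibility with the metric cancels the term g(grad u, ∇_{X₀}X₁) in the definition of ∇²u.
  have h3 := hcov.metric (X 0) (g.grad u) (X 1) x (SmoothFieldOn.mdifferentiableAt hU (hX 0) hx)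
    (SmoothFieldOn.mdifferentiableAt hU hgrad hx) (SmoothFieldOn.mdifferentiableAt hU (hX 1) hx)
  change mvfderiv 𝓘(ℝ, E) (iterCovDiff cov (fun y => (u y : ℂ)) 1 (Fin.tail X)) x (X 0 x) -
    ∑ i : Fin 1, iterCovDiff cov (fun y => (u y : ℂ)) 1
      (Function.update (Fin.tail X) i fun y => cov (Fin.tail X i) y (X 0 y)) x = _
  rw [Fin.sum_univ_one, h1, h1, Function.update_self]
  change mvfderiv 𝓘(ℝ, E) (fun y => ((g.inner y (g.grad u y) (X 1 y) : ℝ) : ℂ)) x (X 0 x) -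
    ((g.inner x (g.grad u x) (cov (X 1) x (X 0 x)) : ℝ) : ℂ) = _
  rw [mvfderiv_ofReal h2, h3, ← hXx 0, ← hXx 1]
  push_cast
  ring

/-- Summing over the second index raises it, which turns the bilinear form g(L·, ·) back into the
endomorphism L; summing over the first then takes its trace. -/
theorem contraction_contravariant (g : PseudoMetric E M) (x : M)
    (L : TangentSpace 𝓘(ℝ, E) x →L[ℝ] TangentSpace 𝓘(ℝ, E) x) :
    contraction (g.contravariant x) (fun v => ((g.inner x (L (v 0)) (v 1) : ℝ) : ℂ)) =
      (LinearMap.trace ℝ (TangentSpace 𝓘(ℝ, E) x) L.toLinearMap : ℝ) := by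
  have h1 : ∀ j, ∑ k, cotangentBasis x j (g.sharp x (cotangentBasis x k)) *
      g.inner x (L (tangentBasis x j)) (tangentBasis x k) =
      cotangentBasis x j (L (tangentBasis x j)) := by
    intro j
    have h2 : ∀ k, cotangentBasis x j (g.sharp x (cotangentBasis x k)) =
        cotangentBasis x k (g.sharp x (cotangentBasis x j)) := fun k => by
      rw [← g.inner_sharp, g.symm, g.inner_sharp]
    have h3 := congrArg (g.inner x (L (tangentBasis x j)))
      (sum_cotangentBasis_smul_tangentBasis (g.sharp x (cotangentBasis x j)))
    rw [map_sum, g.symm, g.inner_sharp] at h3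
    rw [← h3]
    refine Finset.sum_congr rfl fun k _ => ?_
    rw [h2, map_smul, smul_eq_mul]
  have h4 : contraction (g.contravariant x) (fun v => ((g.inner x (L (v 0)) (v 1) : ℝ) : ℂ)) =
      ((∑ p : Fin (Module.finrank ℝ E) × Fin (Module.finrank ℝ E),
        cotangentBasis x p.1 (g.sharp x (cotangentBasis x p.2)) *
          g.inner x (L (tangentBasis x p.1)) (tangentBasis x p.2) : ℝ) : ℂ) := by
    rw [contraction, Complex.ofReal_sum]
    refine Fintype.sum_equiv (finTwoArrowEquiv _) _ _ fun J => ?_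
    rw [g.contravariant_apply, Complex.ofReal_mul]
    rfl
  rw [h4, Fintype.sum_prod_type]
  simp only [h1]
  rw [LinearMap.trace_eq_matrix_trace ℝ (tangentBasis x), Matrix.trace]
  refine congrArg _ (Finset.sum_congr rfl fun j _ => ?_)
  rw [Matrix.diag_apply, LinearMap.toMatrix_apply]
  rfl

theorem quantizeHom_contravariant (hcov : g.IsLeviCivita cov) (ħ : ℝ) (f : SmoothFn E M) (x : M) :
    quantizeHom cov ħ g.contravariant f x = -(ħ : ℂ) ^ 2 * g.laplacian cov f x := by
  have hre : ContMDiff 𝓘(ℝ, E) 𝓘(ℝ, ℝ) ∞ (fun y => ((f : M → ℂ) y).re) :=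
    Complex.reCLM.contDiff.contMDiff.comp f.2
  have him : ContMDiff 𝓘(ℝ, E) 𝓘(ℝ, ℝ) ∞ (fun y => ((f : M → ℂ) y).im) :=
    Complex.imCLM.contDiff.contMDiff.comp f.2
  have hre' : ContMDiff 𝓘(ℝ, E) 𝓘(ℝ, ℂ) ∞ (fun y => (((f : M → ℂ) y).re : ℂ)) :=
    Complex.ofRealCLM.contDiff.contMDiff.comp hre
  have him' : ContMDiff 𝓘(ℝ, E) 𝓘(ℝ, ℂ) ∞ (fun y => (((f : M → ℂ) y).im : ℂ)) :=
    Complex.ofRealCLM.contDiff.contMDiff.comp him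
  have h1 : (f : M → ℂ) = fun y => Complex.I * (((f : M → ℂ) y).im : ℂ) +
      (((f : M → ℂ) y).re : ℂ) := by
    ext y
    rw [add_comm, mul_comm, Complex.re_add_im]
  have h2 : ∀ v, covDiffAt cov (f : M → ℂ) 2 x v =
      Complex.I * (g.inner x (cov (g.grad fun y => ((f : M → ℂ) y).im) x (v 0)) (v 1) : ℝ) +
        (g.inner x (cov (g.grad fun y => ((f : M → ℂ) y).re) x (v 0)) (v 1) : ℝ) := by
    intro v
    rw [← covDiffAt_two hcov him, ← covDiffAt_two hcov hre]
    conv_lhs => rw [h1]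
    exact iterCovDiff_smul_add_fun hcov.smooth (chartAt E x).open_source Complex.I
      him'.contMDiffOn hre'.contMDiffOn 2 (fun i => smoothFieldOn_extend (v i)) x
      (mem_chart_source E x)
  have h3 : contraction (g.contravariant x) (covDiffAt cov (f : M → ℂ) 2 x) =
      g.laplacian cov f x := by
    rw [laplacian, realLaplacian, realLaplacian, ← contraction_contravariant,
      ← contraction_contravariant]
    simp only [contraction, h2, Finset.sum_mul]
    rw [← Finset.sum_add_distrib]
    exact Finset.sum_congr rfl fun J _ => by ring
  have h4 := quantizeHom_eq (cov := cov) ħ ⟨_, g.contravariant_mem⟩ f x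
  rw [h4, h3]
  congr 1
  rw [mul_pow, neg_sq, Complex.I_sq, neg_one_mul]

end PseudoMetric

end Laplacian

/-! ### Tangent vectors to the total space of a vector bundle, in Mathlib's charts. -/

section TotalSpace

open Set Filter Topology Bundle

variable {F : Type*} [NormedAddCommGroup F] [NormedSpace ℝ F] {V : M → Type*}
  [∀ x, AddCommGroup (V x)] [∀ x, Module ℝ (V x)] [∀ x, TopologicalSpace (V x)]
  [TopologicalSpace (TotalSpace F V)] [FiberBundle F V]

theorem extChartAt_totalSpace_apply {α y : TotalSpace F V}
    (hy : y.proj ∈ (trivializationAt F V α.proj).baseSet) :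
    extChartAt (𝓘(ℝ, E).prod 𝓘(ℝ, F)) α y =
      (extChartAt 𝓘(ℝ, E) α.proj y.proj, (trivializationAt F V α.proj y).2) := by
  rw [FiberBundle.extChartAt]
  have : (trivializationAt F V α.proj y).1 = y.proj :=
    (trivializationAt F V α.proj).coe_fst' hy
  simp [this]

variable [IsManifold 𝓘(ℝ, E) ∞ M]

section

variable [VectorBundle ℝ F V] [ContMDiffVectorBundle ∞ F V 𝓘(ℝ, E)]

/-- The tangent space at α is the model space seen through the chart centred at α. The first
component of this chart is the base chart, and each chart has identity derivative at its own centre.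
-/
theorem mfderiv_totalSpace_proj (α : TotalSpace F V) (u : E × F) :
    mfderiv (𝓘(ℝ, E).prod 𝓘(ℝ, F)) 𝓘(ℝ, E) (TotalSpace.proj : TotalSpace F V → M) α u = u.1 := by
  set φ := extChartAt (𝓘(ℝ, E).prod 𝓘(ℝ, F)) α
  set ψ := extChartAt 𝓘(ℝ, E) α.proj
  have hπ : MDifferentiableAt (𝓘(ℝ, E).prod 𝓘(ℝ, F)) 𝓘(ℝ, E)
      (TotalSpace.proj : TotalSpace F V → M) α :=
    (contMDiffAt_proj (n := ∞) V).mdifferentiableAt (by simp)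
  have h1 : (fun y => (φ y).1) =ᶠ[𝓝 α] fun y => ψ y.proj := by
    have : TotalSpace.proj ⁻¹' (trivializationAt F V α.proj).baseSet ∈ 𝓝 α :=
      hπ.continuousAt.preimage_mem_nhds ((trivializationAt F V α.proj).open_baseSet.mem_nhds
        (mem_baseSet_trivializationAt F V α.proj))
    filter_upwards [this] with y hy
    exact congrArg Prod.fst (extChartAt_totalSpace_apply hy)
  have : IsManifold (𝓘(ℝ, E).prod 𝓘(ℝ, F)) 1 (TotalSpace F V) :=
    .of_le (n := ∞) (by simp)
  have h2 := (mdifferentiableAt_extChartAt (I := 𝓘(ℝ, E).prod 𝓘(ℝ, F))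
    (mem_chart_source _ α)).hasMFDerivAt
  have h3 := (mdifferentiableAt_extChartAt (I := 𝓘(ℝ, E))
    (mem_chart_source E α.proj)).hasMFDerivAt
  rw [mfderiv_extChartAt_self] at h2 h3
  have h4 := ((ContinuousLinearMap.fst ℝ E F).hasFDerivAt.hasMFDerivAt.comp α h2).mfderiv
  have h5 := (h3.comp α hπ.hasMFDerivAt).mfderiv
  have h6 := h4.symm.trans (h1.mfderiv_eq.trans h5)
  exact (congrArg (fun l : E × F →L[ℝ] E => l u) h6).symm

theorem hasMFDerivAt_fiber_line {x : M} (v w : V x) :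
    HasMFDerivAt 𝓘(ℝ, ℝ) (𝓘(ℝ, E).prod 𝓘(ℝ, F))
      (fun t : ℝ => (⟨x, v + t • w⟩ : TotalSpace F V)) 0
      (ContinuousLinearMap.toSpanSingleton ℝ
        ((0, (trivializationAt F V x ⟨x, w⟩).2) : E × F)) := by
  set τ := trivializationAt F V x
  have hx : x ∈ τ.baseSet := mem_baseSet_trivializationAt F V x
  have hlin : ∀ t : ℝ, (τ ⟨x, v + t • w⟩).2 = (τ ⟨x, v⟩).2 + t • (τ ⟨x, w⟩).2 := fun t => by
    have h := (τ.linear ℝ hx).map_add v (t • w)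
    rw [(τ.linear ℝ hx).map_smul] at h
    exact h
  have hd : HasDerivAt (fun t : ℝ => (τ ⟨x, v⟩).2 + t • (τ ⟨x, w⟩).2) (τ ⟨x, w⟩).2 0 := by
    simpa using ((hasDerivAt_id (0 : ℝ)).smul_const (τ ⟨x, w⟩).2).const_add (τ ⟨x, v⟩).2
  have hι : MDifferentiableAt 𝓘(ℝ, ℝ) (𝓘(ℝ, E).prod 𝓘(ℝ, F))
      (fun t : ℝ => (⟨x, v + t • w⟩ : TotalSpace F V)) 0 := by
    rw [mdifferentiableAt_totalSpace]
    refine ⟨mdifferentiableAt_const, ?_⟩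
    exact hd.differentiableAt.mdifferentiableAt.congr_of_eventuallyEq
      (Eventually.of_forall fun t => by exact hlin t)
  have : IsManifold (𝓘(ℝ, E).prod 𝓘(ℝ, F)) 1 (TotalSpace F V) :=
    .of_le (n := ∞) (by simp)
  have h0 : (⟨x, v + (0 : ℝ) • w⟩ : TotalSpace F V) = ⟨x, v⟩ := by rw [zero_smul, add_zero]
  have h2 := (mdifferentiableAt_extChartAt (I := 𝓘(ℝ, E).prod 𝓘(ℝ, F))
    (mem_chart_source (ModelProd E F)
      (⟨x, v + (0 : ℝ) • w⟩ : TotalSpace F V))).hasMFDerivAt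
  rw [mfderiv_extChartAt_self] at h2
  have h3 := (h2.comp (0 : ℝ) hι.hasMFDerivAt).mfderiv
  have h4 : HasDerivAt (extChartAt (𝓘(ℝ, E).prod 𝓘(ℝ, F))
      (⟨x, v + (0 : ℝ) • w⟩ : TotalSpace F V) ∘ fun t : ℝ => ⟨x, v + t • w⟩)
      ((0, (τ ⟨x, w⟩).2) : E × F) 0 := by
    have h5 : (extChartAt (𝓘(ℝ, E).prod 𝓘(ℝ, F))
      (⟨x, v + (0 : ℝ) • w⟩ : TotalSpace F V) ∘ fun t : ℝ => ⟨x, v + t • w⟩) =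
      fun t => (extChartAt 𝓘(ℝ, E) x x, (τ ⟨x, v⟩).2 + t • (τ ⟨x, w⟩).2) := by
      funext t
      rw [Function.comp_apply, extChartAt_totalSpace_apply hx, ← hlin]
    rw [h5]
    exact (hasDerivAt_const (0 : ℝ) _).prodMk hd
  have h6 := h4.hasFDerivAt.hasMFDerivAt.mfderiv
  have h7 := h3.symm.trans h6
  have h8 : mfderiv 𝓘(ℝ, ℝ) (𝓘(ℝ, E).prod 𝓘(ℝ, F))
      (fun t : ℝ => (⟨x, v + t • w⟩ : TotalSpace F V)) 0 =
      ContinuousLinearMap.toSpanSingleton ℝ ((0, (τ ⟨x, w⟩).2) : E × F) := h7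
  have h9 := hι.hasMFDerivAt
  rw [h8] at h9
  exact h9

end

theorem continuousLinearMapAt_trivializationAt_self (x : M) (v : TangentSpace 𝓘(ℝ, E) x) :
    (trivializationAt E (TangentSpace 𝓘(ℝ, E) : M → Type _) x).continuousLinearMapAt ℝ x v = v :=
  congrArg (fun l => l v) ((TangentBundle.continuousLinearMapAt_trivializationAt (I := 𝓘(ℝ, E))
    (mem_chart_source E x)).trans mfderiv_extChartAt_self)

theorem tangent_trivializationAt_self (x : M) (v : TangentSpace 𝓘(ℝ, E) x) :
    (trivializationAt E (TangentSpace 𝓘(ℝ, E) : M → Type _) x ⟨x, v⟩).2 = v := by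
  set t := trivializationAt E (TangentSpace 𝓘(ℝ, E) : M → Type _) x
  have hx : x ∈ t.baseSet := mem_chart_source E x
  have h3 := congrFun (t.coe_linearMapAt_of_mem (R := ℝ) hx) v
  exact h3.symm.trans (continuousLinearMapAt_trivializationAt_self x v)

theorem cotangent_trivializationAt_apply (x₀ : M) (α : CotangentBundle E M) :
    (trivializationAt (E →L[ℝ] ℝ) (fun x : M => TangentSpace 𝓘(ℝ, E) x →L[ℝ] ℝ) x₀ α).2 =
      α.snd.comp ((trivializationAt E (TangentSpace 𝓘(ℝ, E) : M → Type _) x₀).symmL ℝ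
        α.proj) := by
  rw [hom_trivializationAt_apply]
  ext v
  simp [ContinuousLinearMap.inCoordinates]

theorem cotangent_trivializationAt_self (x : M) (β : TangentSpace 𝓘(ℝ, E) x →L[ℝ] ℝ) :
    (trivializationAt (E →L[ℝ] ℝ) (fun x : M => TangentSpace 𝓘(ℝ, E) x →L[ℝ] ℝ) x ⟨x, β⟩).2 =
      β := by
  rw [cotangent_trivializationAt_apply]
  set t := trivializationAt E (TangentSpace 𝓘(ℝ, E) : M → Type _) x
  have hx : x ∈ t.baseSet := mem_chart_source E x
  refine ContinuousLinearMap.ext fun v : TangentSpace 𝓘(ℝ, E) x => ?_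
  have h2 : t.symmL ℝ x v = v := by
    have := t.symmL_continuousLinearMapAt (R := ℝ) hx v
    exact (congrArg (t.symmL ℝ x) (continuousLinearMapAt_trivializationAt_self x v)).symm.trans
      this
  exact congrArg β h2

end TotalSpace

/-! ### The Liouville and symplectic forms in canonical coordinates; Hamiltonian fields. -/

section SymplecticForm

open Set Filter Topology Bundle

variable [IsManifold 𝓘(ℝ, E) ∞ M]

/-- This is θ = p dx. The fibre coordinate of a covector is its composition with the derivative of
the inverse base chart, and the projection becomes (x, p) ↦ x. The identity must hold near the point
since `extDerivOneForm` differentiates it. -/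
theorem liouville_chart_eventuallyEq (α : CotangentBundle E M) :
    (fun y : E × (E →L[ℝ] ℝ) =>
      (liouville E M ((extChartAt (cotangentModel E) α).symm y)).comp
        (mfderiv 𝓘(ℝ, E × (E →L[ℝ] ℝ)) (cotangentModel E)
          (extChartAt (cotangentModel E) α).symm y))
      =ᶠ[𝓝 (extChartAt (cotangentModel E) α α)]
      fun y => y.2.comp (ContinuousLinearMap.fst ℝ E (E →L[ℝ] ℝ)) := by
  set φ := extChartAt (cotangentModel E) α with hφ
  set ψ := extChartAt 𝓘(ℝ, E) α.proj with hψ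
  set t := trivializationAt E (TangentSpace 𝓘(ℝ, E) : M → Type _) α.proj
  have hφt : IsOpen φ.target := isOpen_extChartAt_target α
  have hmem : φ.target ∈ 𝓝 (φ α) := hφt.mem_nhds (mem_extChartAt_target α)
  have hsrc : ∀ y ∈ φ.target, (φ.symm y).proj ∈ (chartAt E α.proj).source := fun y hy => by
    have h := φ.map_target hy
    rw [hφ, FiberBundle.extChartAt] at h
    exact (((trivializationAt (E →L[ℝ] ℝ) (fun x : M => TangentSpace 𝓘(ℝ, E) x →L[ℝ] ℝ)
      α.proj).mem_source).1 h.1).1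
  have hval : ∀ y ∈ φ.target, y = (ψ (φ.symm y).proj, (φ.symm y).snd.comp
      (t.symmL ℝ (φ.symm y).proj)) := fun y hy => by
    have h1 := extChartAt_totalSpace_apply (E := E) (α := α) (y := φ.symm y)
      (⟨hsrc y hy, mem_univ _⟩)
    rw [cotangent_trivializationAt_apply] at h1
    exact (φ.right_inv hy).symm.trans h1
  have hproj : ∀ y ∈ φ.target, (φ.symm y).proj = ψ.symm y.1 := fun y hy => by
    have h1 : y.1 = ψ (φ.symm y).proj := congrArg Prod.fst (hval y hy)
    rw [h1, ψ.left_inv (by rw [extChartAt_source]; exact hsrc y hy)]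
  filter_upwards [hmem] with y hy
  refine ContinuousLinearMap.ext fun u => ?_
  have hy1 : y.1 = ψ (φ.symm y).proj := congrArg Prod.fst (hval y hy)
  have hy2 : y.2 = (φ.symm y).snd.comp (t.symmL ℝ (φ.symm y).proj) :=
    congrArg Prod.snd (hval y hy)
  have hIM : IsManifold (cotangentModel E) 1 (CotangentBundle E M) := .of_le (n := ∞) (by simp)
  have hφs : MDifferentiableAt 𝓘(ℝ, E × (E →L[ℝ] ℝ)) (cotangentModel E) φ.symm y :=
    ((contMDiffOn_extChartAt_symm (n := 1) α).contMDiffAt (hφt.mem_nhds hy)).mdifferentiableAt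
      (by simp)
  have hπ : MDifferentiableAt (cotangentModel E) 𝓘(ℝ, E)
      (TotalSpace.proj : CotangentBundle E M → M) (φ.symm y) :=
    (contMDiffAt_proj (n := ∞) _).mdifferentiableAt (by simp)
  have hψy : y.1 ∈ ψ.target := by
    rw [hy1]
    exact ψ.map_source (by rw [extChartAt_source]; exact hsrc y hy)
  have hψs : MDifferentiableAt 𝓘(ℝ, E) 𝓘(ℝ, E) ψ.symm y.1 :=
    ((contMDiffOn_extChartAt_symm (n := ∞) α.proj).contMDiffAt
      ((isOpen_extChartAt_target α.proj).mem_nhds hψy)).mdifferentiableAt (by simp)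
  have h1 := (hπ.hasMFDerivAt.comp y hφs.hasMFDerivAt).mfderiv
  have h2 := (hψs.hasMFDerivAt.comp y
    (ContinuousLinearMap.fst ℝ E (E →L[ℝ] ℝ)).hasFDerivAt.hasMFDerivAt).mfderiv
  have h3 : (fun y => (φ.symm y).proj) =ᶠ[𝓝 y] fun y => ψ.symm y.1 := by
    filter_upwards [hφt.mem_nhds hy] with z hz using hproj z hz
  have h4 := h1.symm.trans (h3.mfderiv_eq.trans h2)
  have h5 := congrArg (fun l : E × (E →L[ℝ] ℝ) →L[ℝ] E => l u) h4
  have h6 := TangentBundle.symmL_trivializationAt (I := 𝓘(ℝ, E)) (hsrc y hy)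
  rw [ModelWithCorners.range_eq_univ, mfderivWithin_univ] at h6
  have h7 : y.2 u.1 = (φ.symm y).snd (mfderiv 𝓘(ℝ, E) 𝓘(ℝ, E) ψ.symm y.1 u.1) := by
    rw [hy2, hy1]
    exact congrArg (φ.symm y).snd (congrArg (fun l : E →L[ℝ] E => l u.1) h6)
  exact (congrArg (φ.symm y).snd h5).trans h7.symm

theorem extDerivOneForm_eq {F H N : Type*} [NormedAddCommGroup F] [NormedSpace ℝ F]
    [TopologicalSpace H] [TopologicalSpace N] [ChartedSpace H N] {J : ModelWithCorners ℝ F H}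
    (θ : Π p : N, TangentSpace J p →L[ℝ] ℝ) (p : N) {L : F →L[ℝ] F →L[ℝ] ℝ}
    (h : (fun y : F => ((θ ((extChartAt J p).symm y)).comp
      (mfderiv 𝓘(ℝ, F) J (extChartAt J p).symm y) : F →L[ℝ] ℝ)) =ᶠ[𝓝 (extChartAt J p p)] L)
    (u v : F) : extDerivOneForm θ p u v = L u v - L v u := by
  have h1 := h.fderiv_eq.trans L.fderiv
  have h2 : extDerivOneForm θ p = (L - L.flip : F →L[ℝ] F →L[ℝ] ℝ) := by
    rw [← h1]
    rfl
  rw [h2]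
  rfl

/-- The bilinear map `(x, p), (y, q) ↦ p(y)` on `E × E^*`. -/
def canonicalPairing : E × (E →L[ℝ] ℝ) →L[ℝ] E × (E →L[ℝ] ℝ) →L[ℝ] ℝ :=
  ((ContinuousLinearMap.compL ℝ (E × (E →L[ℝ] ℝ)) E ℝ).flip
    (ContinuousLinearMap.fst ℝ E (E →L[ℝ] ℝ))).comp (ContinuousLinearMap.snd ℝ E (E →L[ℝ] ℝ))

theorem symplecticForm_apply (α : CotangentBundle E M) (u v : E × (E →L[ℝ] ℝ)) :
    symplecticForm E M α u v = u.2 v.1 - v.2 u.1 :=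
  extDerivOneForm_eq (liouville E M) α (L := canonicalPairing) (liouville_chart_eventuallyEq α) u v

theorem contractSymplectic_eq (D : ComplexField (cotangentModel E) (CotangentBundle E M))
    (α : CotangentBundle E M) (v : E × (E →L[ℝ] ℝ)) {L : TangentSpace (cotangentModel E) α →ₗ[ℝ] ℂ}
    (hL : ∀ u : E × (E →L[ℝ] ℝ), L u = (u.2 v.1 - v.2 u.1 : ℝ)) :
    contractSymplectic D α v = LinearMap.liftBaseChange ℂ L (D α) := by
  refine congrArg (fun l => LinearMap.liftBaseChange ℂ l (D α)) (LinearMap.ext fun u => ?_)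
  refine Eq.trans ?_ (hL u).symm
  exact congrArg Complex.ofReal (symplecticForm_apply α u v)

theorem exists_liftBaseChange_eq {V : Type*} [AddCommGroup V] [Module ℝ V] (a b : V) :
    ∃ d : ℂ ⊗[ℝ] V, ∀ L : V →ₗ[ℝ] ℂ,
      LinearMap.liftBaseChange ℂ L d = L a + Complex.I * L b :=
  ⟨(1 : ℂ) ⊗ₜ a + Complex.I ⊗ₜ b, fun L => by simp⟩

variable [FiniteDimensional ℝ E]

/-- The fibre part of u is the restriction of l to E; its base part is the vector representing -l on
E*, which exists because E is reflexive. -/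
theorem exists_symplecticForm_eq (α : CotangentBundle E M) (l : E × (E →L[ℝ] ℝ) →L[ℝ] ℝ) :
    ∃ u : E × (E →L[ℝ] ℝ), ∀ v : E × (E →L[ℝ] ℝ), symplecticForm E M α u v = l v := by
  let e : (E →L[ℝ] ℝ) ≃ₗ[ℝ] Module.Dual ℝ E := LinearMap.toContinuousLinearMap.symm
  let m : Module.Dual ℝ (Module.Dual ℝ E) :=
    -(l.toLinearMap.comp (LinearMap.inr ℝ E (E →L[ℝ] ℝ))).comp e.symm.toLinearMap
  refine ⟨((Module.evalEquiv ℝ E).symm m, l.comp (ContinuousLinearMap.inl ℝ E (E →L[ℝ] ℝ))),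
    fun v => ?_⟩
  have h1 : v.2 ((Module.evalEquiv ℝ E).symm m) = -l (0, v.2) := by
    have h := congrArg (fun d => d (e v.2)) ((Module.evalEquiv ℝ E).apply_symm_apply m)
    have h2 : m (e v.2) = -l (0, v.2) := by
      change -l (0, e.symm (e v.2)) = _
      rw [e.symm_apply_apply]
    exact h.trans h2
  rw [symplecticForm_apply, h1, sub_neg_eq_add]
  change l (v.1, 0) + l (0, v.2) = l v
  rw [← map_add]
  simp

/-- Solve the real and the imaginary equation separately and recombine as a + ib in the complexified
tangent space. This puts the definition by cases in its meaningful branch. -/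
theorem hamiltonianField_spec (F : CotangentBundle E M → ℂ) :
    IsHamiltonianField F (hamiltonianField F) := by
  have h : ∃ D, IsHamiltonianField F D := by
    have h1 : ∀ α : CotangentBundle E M, ∃ d : ℂ ⊗[ℝ] TangentSpace (cotangentModel E) α,
        ∀ (v : E × (E →L[ℝ] ℝ)) (L : TangentSpace (cotangentModel E) α →ₗ[ℝ] ℂ),
          (∀ u : E × (E →L[ℝ] ℝ), L u = (u.2 v.1 - v.2 u.1 : ℝ)) →
          LinearMap.liftBaseChange ℂ L d = -mvfderiv (cotangentModel E) F α v := by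
      intro α
      let l : E × (E →L[ℝ] ℝ) →L[ℝ] ℂ := mvfderiv (cotangentModel E) F α
      obtain ⟨a, ha⟩ := exists_symplecticForm_eq α (Complex.reCLM.comp l)
      obtain ⟨b, hb⟩ := exists_symplecticForm_eq α (Complex.imCLM.comp l)
      obtain ⟨d, hd⟩ := exists_liftBaseChange_eq (V := TangentSpace (cotangentModel E) α) a b
      refine ⟨-d, fun v L hL => ?_⟩
      have h2 : L a = ((l v).re : ℂ) := by
        rw [hL a, ← symplecticForm_apply α, ha]
        rfl
      have h3 : L b = ((l v).im : ℂ) := by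
        rw [hL b, ← symplecticForm_apply α, hb]
        rfl
      rw [map_neg, hd, h2, h3, mul_comm, Complex.re_add_im]
      rfl
    choose d hd using h1
    refine ⟨d, fun α v => ?_⟩
    let B : E × (E →L[ℝ] ℝ) →L[ℝ] E × (E →L[ℝ] ℝ) →L[ℝ] ℝ := symplecticForm E M α
    let L : TangentSpace (cotangentModel E) α →ₗ[ℝ] ℂ :=
      (Complex.ofRealCLM.comp (B.flip v)).toLinearMap
    have hL : ∀ u : E × (E →L[ℝ] ℝ), L u =
        (u.2 (v : E × (E →L[ℝ] ℝ)).1 - (v : E × (E →L[ℝ] ℝ)).2 u.1 : ℝ) := fun u =>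
      congrArg Complex.ofReal (symplecticForm_apply α u v)
    rw [contractSymplectic_eq d α v hL, hd α v L hL]
    exact neg_add_cancel _
  rw [hamiltonianField, dif_pos h]
  exact h.choose_spec

/-- For a Hamiltonian field `D`, the value of `β ∘ dπ` on `D` is the derivative of the Hamiltonian
along the vertical vector `β`. -/
theorem IsHamiltonianField.liftBaseChange_vertical {F : CotangentBundle E M → ℂ}
    {D : ComplexField (cotangentModel E) (CotangentBundle E M)} (hD : IsHamiltonianField F D)
    (α : CotangentBundle E M) (β : E →L[ℝ] ℝ) {L : TangentSpace (cotangentModel E) α →ₗ[ℝ] ℂ}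
    (hL : ∀ u : E × (E →L[ℝ] ℝ), L u = (β u.1 : ℂ)) :
    LinearMap.liftBaseChange ℂ L (D α) =
      mvfderiv (cotangentModel E) F α ((0, β) : E × (E →L[ℝ] ℝ)) := by
  have h := hD α ((0, β) : E × (E →L[ℝ] ℝ))
  -- Against the vertical vector (0, β), dp ∧ dx reduces to minus β of the base component.
  have hneg : ∀ u : E × (E →L[ℝ] ℝ), (-L) u = (u.2 ((0, β) : E × (E →L[ℝ] ℝ)).1 -
      ((0, β) : E × (E →L[ℝ] ℝ)).2 u.1 : ℝ) := fun u => by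
    refine (congrArg Neg.neg (hL u)).trans ?_
    rw [map_zero, zero_sub, Complex.ofReal_neg]
  rw [contractSymplectic_eq D α (0, β) (L := -L) hneg] at h
  have h2 : LinearMap.liftBaseChange ℂ (-L) (D α) = -LinearMap.liftBaseChange ℂ L (D α) := by
    have h3 : LinearMap.liftBaseChange ℂ (-L) = -LinearMap.liftBaseChange ℂ L := by
      ext u
      simp
    rw [h3]
    rfl
  rw [h2] at h
  exact (neg_add_eq_zero.1 h)

end SymplecticForm

/-! ### Second order equations and vertical derivatives of the Hamiltonian. -/

section SecondOrderEquation

open Set Filter Topology Bundle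

variable [IsManifold 𝓘(ℝ, E) ∞ M]

theorem hasMFDerivAt_cotangent_line {x : M} (α β : TangentSpace 𝓘(ℝ, E) x →L[ℝ] ℝ) :
    HasMFDerivAt 𝓘(ℝ, ℝ) (cotangentModel E)
      (fun t : ℝ => (⟨x, α + t • β⟩ : CotangentBundle E M)) 0
      (ContinuousLinearMap.toSpanSingleton ℝ ((0, β) : E × (E →L[ℝ] ℝ))) := by
  have h := hasMFDerivAt_fiber_line (E := E) (F := E →L[ℝ] ℝ)
    (V := fun x : M => TangentSpace 𝓘(ℝ, E) x →L[ℝ] ℝ) α β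
  rw [cotangent_trivializationAt_self] at h
  exact h

theorem hasMFDerivAt_tangent_line {x : M} (v w : TangentSpace 𝓘(ℝ, E) x) :
    HasMFDerivAt 𝓘(ℝ, ℝ) 𝓘(ℝ, E).tangent
      (fun t : ℝ => (⟨x, v + t • w⟩ : TangentBundle 𝓘(ℝ, E) M)) 0
      (ContinuousLinearMap.toSpanSingleton ℝ ((0, w) : E × E)) := by
  have h := hasMFDerivAt_fiber_line (E := E) (F := E)
    (V := (TangentSpace 𝓘(ℝ, E) : M → Type _)) v w
  rw [tangent_trivializationAt_self] at h
  exact h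

theorem hasDerivAt_fiber_line {F : CotangentBundle E M → ℂ} {x : M}
    {α : TangentSpace 𝓘(ℝ, E) x →L[ℝ] ℝ}
    (hF : MDifferentiableAt (cotangentModel E) 𝓘(ℝ, ℂ) F ⟨x, α⟩)
    (β : TangentSpace 𝓘(ℝ, E) x →L[ℝ] ℝ) :
    HasDerivAt (fun t : ℝ => F ⟨x, α + t • β⟩)
      (mvfderiv (cotangentModel E) F ⟨x, α⟩ ((0, β) : E × (E →L[ℝ] ℝ))) 0 := by
  have h0 : (⟨x, α + (0 : ℝ) • β⟩ : CotangentBundle E M) = ⟨x, α⟩ := by rw [zero_smul, add_zero]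
  have h1 : HasMFDerivAt (cotangentModel E) 𝓘(ℝ, ℂ) F ⟨x, α + (0 : ℝ) • β⟩
      (mfderiv (cotangentModel E) 𝓘(ℝ, ℂ) F ⟨x, α + (0 : ℝ) • β⟩) := by
    rw [h0]
    exact hF.hasMFDerivAt
  let A : CotangentBundle E M → E × (E →L[ℝ] ℝ) →L[ℝ] ℂ := fun γ =>
    mfderiv (cotangentModel E) 𝓘(ℝ, ℂ) F γ
  have h2 : HasFDerivAt (fun t : ℝ => F ⟨x, α + t • β⟩)
      ((A ⟨x, α + (0 : ℝ) • β⟩).comp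
        (ContinuousLinearMap.toSpanSingleton ℝ ((0, β) : E × (E →L[ℝ] ℝ)))) 0 :=
    (h1.comp (0 : ℝ) (hasMFDerivAt_cotangent_line α β)).hasFDerivAt
  rw [h0] at h2
  refine h2.hasDerivAt.congr_deriv ?_
  exact congrArg (A ⟨x, α⟩) (one_smul ℝ ((0, β) : E × (E →L[ℝ] ℝ)))

theorem liftBaseChange_baseChange {V W : Type*} [AddCommGroup V] [Module ℝ V] [AddCommGroup W]
    [Module ℝ W] (L : V →ₗ[ℝ] ℂ) (A : W →ₗ[ℝ] V) (d : ℂ ⊗[ℝ] W) :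
    LinearMap.liftBaseChange ℂ L (LinearMap.baseChange ℂ A d) =
      LinearMap.liftBaseChange ℂ (L.comp A) d := by
  induction d using TensorProduct.induction_on with
  | zero => simp
  | tmul c w => simp
  | add a b ha hb => rw [map_add, map_add, map_add, ha, hb]

theorem liftBaseChange_add_I_smul {V : Type*} [AddCommGroup V] [Module ℝ V] (L L' : V →ₗ[ℝ] ℂ)
    (d : ℂ ⊗[ℝ] V) :
    LinearMap.liftBaseChange ℂ (L + Complex.I • L') d =
      LinearMap.liftBaseChange ℂ L d + Complex.I * LinearMap.liftBaseChange ℂ L' d := by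
  induction d using TensorProduct.induction_on with
  | zero => simp
  | tmul c w => simp
  | add a b ha hb => rw [map_add, map_add, map_add, ha, hb]; ring

namespace PseudoMetric

variable (g : PseudoMetric E M)

theorem contMDiff_flat : ContMDiff 𝓘(ℝ, E).tangent (cotangentModel E) ∞ g.flat := by
  intro u
  have h1 : ContMDiffAt 𝓘(ℝ, E).tangent 𝓘(ℝ, E) ∞
      (TotalSpace.proj : TangentBundle 𝓘(ℝ, E) M → M) u := contMDiffAt_proj _
  exact ContMDiffAt.clm_bundle_apply (F₁ := E) (F₂ := E →L[ℝ] ℝ)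
    (E₁ := (TangentSpace 𝓘(ℝ, E) : M → Type _))
    (E₂ := fun x : M => TangentSpace 𝓘(ℝ, E) x →L[ℝ] ℝ)
    (b := fun u : TangentBundle 𝓘(ℝ, E) M => u.proj) (v := fun u => u.snd)
    (ϕ := fun u => g.inner u.proj) (g.contMDiff.contMDiffAt.comp u h1) contMDiffAt_id

theorem mfderiv_flat_fst (u : TangentBundle 𝓘(ℝ, E) M) (w : E × E) :
    (mfderiv 𝓘(ℝ, E).tangent (cotangentModel E) g.flat u w : E × (E →L[ℝ] ℝ)).1 = w.1 := by
  have hflat : MDifferentiableAt 𝓘(ℝ, E).tangent (cotangentModel E) g.flat u :=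
    (g.contMDiff_flat u).mdifferentiableAt (by simp)
  have hπ : MDifferentiableAt (cotangentModel E) 𝓘(ℝ, E)
      (TotalSpace.proj : CotangentBundle E M → M) (g.flat u) :=
    (contMDiffAt_proj (n := ∞) _).mdifferentiableAt (by simp)
  have h := (hπ.hasMFDerivAt.comp u hflat.hasMFDerivAt).mfderiv
  have h1 := congrArg (fun l : E × E →L[ℝ] E => l w) h
  refine (mfderiv_totalSpace_proj (g.flat u) _).symm.trans (h1.symm.trans ?_)
  exact mfderiv_totalSpace_proj (E := E) u w

theorem mfderiv_flat_vertical (u : TangentBundle 𝓘(ℝ, E) M)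
    (e : TangentSpace 𝓘(ℝ, E) u.proj) :
    (mfderiv 𝓘(ℝ, E).tangent (cotangentModel E) g.flat u ((0, e) : E × E) : E × (E →L[ℝ] ℝ)) =
      (0, g.inner u.proj e) := by
  obtain ⟨x, v⟩ := u
  change TangentSpace 𝓘(ℝ, E) x at e
  have h0 : (⟨x, v + (0 : ℝ) • e⟩ : TangentBundle 𝓘(ℝ, E) M) = ⟨x, v⟩ := by
    have : v + (0 : ℝ) • e = v := by rw [zero_smul, add_zero]
    exact congrArg _ this
  have h1 : HasMFDerivAt 𝓘(ℝ, E).tangent (cotangentModel E) g.flat ⟨x, v + (0 : ℝ) • e⟩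
      (mfderiv 𝓘(ℝ, E).tangent (cotangentModel E) g.flat ⟨x, v + (0 : ℝ) • e⟩) :=
    ((g.contMDiff_flat _).mdifferentiableAt (by simp)).hasMFDerivAt
  have h2 := (h1.comp (0 : ℝ) (hasMFDerivAt_tangent_line v e)).mfderiv
  have h3 : g.flat ∘ (fun t : ℝ => (⟨x, v + t • e⟩ : TangentBundle 𝓘(ℝ, E) M)) =
      fun t : ℝ => ⟨x, g.inner x v + t • g.inner x e⟩ := by
    funext t
    have : g.inner x (v + t • e) =
        g.inner x v + t • g.inner x e := by rw [map_add, map_smul]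
    exact congrArg (TotalSpace.mk x) this
  have h4 := (hasMFDerivAt_cotangent_line (g.inner x v) (g.inner x e)).mfderiv
  let A : TangentBundle 𝓘(ℝ, E) M → E × E →L[ℝ] E × (E →L[ℝ] ℝ) := fun γ =>
    mfderiv 𝓘(ℝ, E).tangent (cotangentModel E) g.flat γ
  rw [h3] at h2
  have h6 : (1 : ℝ) • ((0, g.inner x e) : E × (E →L[ℝ] ℝ)) =
      A ⟨x, v + (0 : ℝ) • e⟩ ((1 : ℝ) • ((0, e) : E × E)) :=
    congrArg (fun l : ℝ →L[ℝ] E × (E →L[ℝ] ℝ) => l 1) (h4.symm.trans h2)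
  rw [h0, one_smul, one_smul] at h6
  exact h6.symm

variable [FiniteDimensional ℝ E]

/-- `ContinuousLinearMap.inverse` is zero on a non-invertible map, so invertibility matters. The
derivative of `flat` is block triangular, with the identity on the base and the metric on the fibre;
non-degeneracy makes it injective, and dimensions agree. -/
theorem mfderiv_flat_inverse_apply (u : TangentBundle 𝓘(ℝ, E) M) (w : E × (E →L[ℝ] ℝ)) :
    mfderiv 𝓘(ℝ, E).tangent (cotangentModel E) g.flat u
      ((mfderiv 𝓘(ℝ, E).tangent (cotangentModel E) g.flat u).inverse w) = w := by
  let A : E × E →L[ℝ] E × (E →L[ℝ] ℝ) := mfderiv 𝓘(ℝ, E).tangent (cotangentModel E) g.flat u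
  have hinj : Function.Injective A.toLinearMap := by
    refine (injective_iff_map_eq_zero _).2 fun w hw => ?_
    have h1 : w.1 = 0 := by
      rw [← g.mfderiv_flat_fst u w]
      exact congrArg Prod.fst hw
    have h2 : w = (0, w.2) := Prod.ext h1 rfl
    have h3 : (A (0, w.2)).2 = 0 := by
      rw [← h2]
      exact congrArg Prod.snd hw
    have h4 : g.inner u.proj w.2 = 0 := by
      have := congrArg Prod.snd (g.mfderiv_flat_vertical u w.2)
      exact this.symm.trans h3
    have h5 : w.2 = 0 := g.nondegenerate u.proj w.2 fun z => congrArg (fun l => l z) h4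
    rw [h2, h5]
    rfl
  have hdim : Module.finrank ℝ (E × E) = Module.finrank ℝ (E × (E →L[ℝ] ℝ)) := by
    have h := (LinearMap.toContinuousLinearMap : (E →ₗ[ℝ] ℝ) ≃ₗ[ℝ] E →L[ℝ] ℝ).finrank_eq
    rw [Module.finrank_prod, Module.finrank_prod, ← h, Subspace.dual_finrank_eq (K := ℝ) (V := E)]
  let e : (E × E) ≃L[ℝ] E × (E →L[ℝ] ℝ) := (LinearEquiv.ofBijective A.toLinearMap
    ⟨hinj, (LinearMap.injective_iff_surjective_of_finrank_eq_finrank hdim).1 hinj⟩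
    ).toContinuousLinearEquiv
  have h : A (A.inverse w) = w := by
    have he : (e : E × E →L[ℝ] E × (E →L[ℝ] ℝ)) = A := rfl
    rw [← he, ContinuousLinearMap.inverse_equiv]
    exact e.apply_symm_apply w
  exact h

/-- As `flat` covers the identity of M, transporting D does not alter its base component, and that
is all a function pulled back from M can see. -/
theorem deriv_transport {D : ComplexField (cotangentModel E) (CotangentBundle E M)}
    (f : SmoothFn E M) (u : TangentBundle 𝓘(ℝ, E) M)
    {L : TangentSpace (cotangentModel E) (g.flat u) →ₗ[ℝ] ℂ}
    (hL : ∀ w : E × (E →L[ℝ] ℝ), L w = mvfderiv 𝓘(ℝ, E) (f : M → ℂ) u.proj w.1) :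
    (g.transport D).deriv (fun w => (f : M → ℂ) w.proj) u =
      LinearMap.liftBaseChange ℂ L (D (g.flat u)) := by
  rw [ComplexField.deriv, transport, liftBaseChange_baseChange]
  refine congrArg (fun l => LinearMap.liftBaseChange ℂ l (D (g.flat u)))
    (LinearMap.ext fun w => ?_)
  refine Eq.trans ?_ (hL w).symm
  have hπ : MDifferentiableAt 𝓘(ℝ, E).tangent 𝓘(ℝ, E)
      (TotalSpace.proj : TangentBundle 𝓘(ℝ, E) M → M) u :=
    (contMDiffAt_proj (n := ∞) _).mdifferentiableAt (by simp)
  have h := ((SmoothFn.mdifferentiableAt f u.proj).hasMFDerivAt.comp u hπ.hasMFDerivAt).mfderiv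
  set z : E × E := (mfderiv 𝓘(ℝ, E).tangent (cotangentModel E) g.flat u).inverse w with hz
  have h1 := congrArg (fun l : E × E →L[ℝ] ℂ => l z) h
  refine h1.trans ?_
  have h2 : z.1 = (w : E × (E →L[ℝ] ℝ)).1 := by
    rw [← g.mfderiv_flat_fst u z]
    exact congrArg Prod.fst (g.mfderiv_flat_inverse_apply u w)
  rw [← h2]
  exact congrArg (mvfderiv 𝓘(ℝ, E) (f : M → ℂ) u.proj) (mfderiv_totalSpace_proj (E := E) u z)

variable [T2Space M]

/-- The transport of a Hamiltonian field is a second order differential equation exactly when the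
vertical derivative of the Hamiltonian is given by the metric. -/
theorem isSecondOrder_transport_iff {F : CotangentBundle E M → ℂ}
    {D : ComplexField (cotangentModel E) (CotangentBundle E M)} (hD : IsHamiltonianField F D) :
    IsSecondOrder (g.transport D) ↔
      ∀ (x : M) (α β : TangentSpace 𝓘(ℝ, E) x →L[ℝ] ℝ),
        mvfderiv (cotangentModel E) F ⟨x, α⟩ ((0, β) : E × (E →L[ℝ] ℝ)) = β (g.sharp x α) := by
  constructor
  · intro h x α β
    -- A function with differential β at x, tested at u = α♯, isolates the vertical derivative along
    -- β.
    have h1 := h (testFn x β) ⟨x, g.sharp x α⟩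
    have hα : g.flat ⟨x, g.sharp x α⟩ = ⟨x, α⟩ :=
      congrArg (TotalSpace.mk x) (ContinuousLinearMap.ext fun v => g.inner_sharp x α v)
    let l : TangentSpace (cotangentModel E) (g.flat ⟨x, g.sharp x α⟩) →ₗ[ℝ] ℂ :=
      ((ofRealComp (E := E) β).comp (ContinuousLinearMap.fst ℝ E (E →L[ℝ] ℝ))).toLinearMap
    rw [g.deriv_transport (testFn x β) ⟨x, g.sharp x α⟩ (L := l)
      fun w => (mvfderiv_testFn x β w.1).symm, hD.liftBaseChange_vertical _ β fun u => rfl, hα,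
      mvfderiv_testFn] at h1
    exact h1
  · rintro h f ⟨x, v⟩
    -- The hypothesis concerns real covectors, so the complex differential is split into two of
    -- them.
    let df : E →L[ℝ] ℂ := mvfderiv 𝓘(ℝ, E) (f : M → ℂ) x
    let a : E →L[ℝ] ℝ := Complex.reCLM.comp df
    let b : E →L[ℝ] ℝ := Complex.imCLM.comp df
    let la : TangentSpace (cotangentModel E) (g.flat ⟨x, v⟩) →ₗ[ℝ] ℂ :=
      ((ofRealComp (E := E) a).comp (ContinuousLinearMap.fst ℝ E (E →L[ℝ] ℝ))).toLinearMap
    let lb : TangentSpace (cotangentModel E) (g.flat ⟨x, v⟩) →ₗ[ℝ] ℂ :=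
      ((ofRealComp (E := E) b).comp (ContinuousLinearMap.fst ℝ E (E →L[ℝ] ℝ))).toLinearMap
    have hdf : ∀ w : E, df w = (a w : ℂ) + Complex.I * (b w : ℂ) := fun w => by
      conv_lhs => rw [← Complex.re_add_im (df w), mul_comm]
      rfl
    have hL : ∀ w : E × (E →L[ℝ] ℝ), (la + Complex.I • lb) w =
        mvfderiv 𝓘(ℝ, E) (f : M → ℂ) x w.1 := fun w => (hdf w.1).symm
    rw [g.deriv_transport f ⟨x, v⟩ hL, liftBaseChange_add_I_smul,
      hD.liftBaseChange_vertical _ a fun u => rfl, hD.liftBaseChange_vertical _ b fun u => rfl]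
    have ha := h x (g.inner x v) a
    have hb := h x (g.inner x v) b
    rw [g.sharp_inner] at ha hb
    refine Eq.trans ?_ (hdf v).symm
    exact congrArg₂ (fun p q => p + Complex.I * q) ha hb

end PseudoMetric

end SecondOrderEquation

/-! ### Regularity of the Hamiltonian and its restriction to rays. -/

section Hamiltonian

open Set Filter Topology Bundle

variable [FiniteDimensional ℝ E]

theorem finite_support_hamiltonian (Φ : SymTensor E M) (α : CotangentBundle E M) :
    (Function.support fun k =>
      (Φ k : ContravariantField E M k) α.proj (fun _ => α.snd)).Finite := by
  refine (DFinsupp.finite_support Φ).subset fun k hk h0 => hk ?_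
  change Φ k = 0 at h0
  simp [h0]

theorem hamiltonian_add (Φ Ψ : SymTensor E M) (α : CotangentBundle E M) :
    hamiltonian (Φ + Ψ) α = hamiltonian Φ α + hamiltonian Ψ α := by
  rw [hamiltonian, hamiltonian, hamiltonian, ← finsum_add_distrib (finite_support_hamiltonian Φ α)
    (finite_support_hamiltonian Ψ α)]
  exact finsum_congr fun k => by simp

theorem hamiltonian_of {k : ℕ} (Φ : SymTensorField E M k) (α : CotangentBundle E M) :
    hamiltonian (DirectSum.of (fun k => SymTensorField E M k) k Φ) α =
      Φ.1 α.proj (fun _ => α.snd) := by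
  rw [hamiltonian, finsum_eq_single _ k, DirectSum.of_eq_same]
  intro l hl
  rw [DirectSum.of_eq_of_ne _ _ _ hl]
  simp

theorem hamiltonian_eq_sum (Φ : SymTensor E M) :
    ∃ S : Finset ℕ, (∀ k ∉ S, Φ k = 0) ∧ ∀ α : CotangentBundle E M,
      hamiltonian Φ α = ∑ k ∈ S, (Φ k).1 α.proj (fun _ => α.snd) := by
  classical
  refine ⟨DFinsupp.support Φ, fun k hk => DFinsupp.notMem_support_iff.1 hk, fun α => ?_⟩
  refine finsum_eq_sum_of_support_subset _ fun k hk => ?_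
  by_contra h
  have h0 : Φ k = 0 := DFinsupp.notMem_support_iff.1 h
  exact hk (by simp [h0])

variable [IsManifold 𝓘(ℝ, E) ∞ M] [T2Space M]

theorem contMDiffAt_apply_chartFrame (α : CotangentBundle E M)
    (j : Fin (Module.finrank ℝ E)) :
    ContMDiffAt (cotangentModel E) 𝓘(ℝ, ℝ) ∞
      (fun γ : CotangentBundle E M => γ.snd (chartFrame α.proj j γ.proj)) α := by
  have h1 : ContMDiffAt (cotangentModel E) (cotangentModel E) ∞
      (fun γ : CotangentBundle E M => γ) α := contMDiffAt_id
  have h2 := (contMDiffAt_totalSpace.1 h1).2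
  have h3 := h2.clm_apply (contMDiffAt_const (c := Module.finBasis ℝ E j))
  refine h3.congr_of_eventuallyEq ?_
  have hπ : ContinuousAt (TotalSpace.proj : CotangentBundle E M → M) α :=
    (contMDiffAt_proj (n := ∞) (IB := 𝓘(ℝ, E)) _).continuousAt
  filter_upwards [hπ.preimage_mem_nhds ((chartAt E α.proj).open_source.mem_nhds
    (mem_chart_source E α.proj))] with γ hγ
  set t := trivializationAt E (TangentSpace 𝓘(ℝ, E) : M → Type _) α.proj
  have hγ' : γ.proj ∈ t.baseSet := hγ
  rw [cotangent_trivializationAt_apply]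
  refine congrArg γ.snd ?_
  exact (t.localFrame_apply_of_mem_baseSet (Module.finBasis ℝ E) (i := j) hγ').trans
    (t.symmL_apply hγ' (Module.finBasis ℝ E j)).symm

theorem contMDiffAt_apply_diagonal {k : ℕ} (Φ : SymTensorField E M k) (α : CotangentBundle E M) :
    ContMDiffAt (cotangentModel E) 𝓘(ℝ, ℂ) ∞
      (fun γ : CotangentBundle E M => Φ.1 γ.proj (fun _ => γ.snd)) α := by
  set U := (chartAt E α.proj).source
  have hU : IsOpen U := (chartAt E α.proj).open_source
  set ε : Fin (Module.finrank ℝ E) → Π x : M, TangentSpace 𝓘(ℝ, E) x →L[ℝ] ℝ := fun j x =>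
    (LinearMap.toContinuousLinearMap ((Module.finBasis ℝ E).coord j) : E →L[ℝ] ℝ).comp
      (mvfderiv 𝓘(ℝ, E) (extChartAt 𝓘(ℝ, E) α.proj) x) with hε
  have hπ : ContMDiffAt (cotangentModel E) 𝓘(ℝ, E) ∞
      (TotalSpace.proj : CotangentBundle E M → M) α := contMDiffAt_proj _
  have hUα : U ∈ 𝓝 α.proj := hU.mem_nhds (mem_chart_source E α.proj)
  -- In canonical coordinates the function is the polynomial Σ Φ^{j₁…j_k} p_{j₁}⋯p_{j_k}, with
  -- smooth components.
  have h1 : ContMDiffAt (cotangentModel E) 𝓘(ℝ, ℂ) ∞ (fun γ : CotangentBundle E M =>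
      ∑ J : Fin k → Fin (Module.finrank ℝ E),
        (∏ i, γ.snd (chartFrame α.proj (J i) γ.proj)) •
          Φ.1 γ.proj (fun i => ε (J i) γ.proj)) α := by
    refine contMDiffAt_finsetSum fun J _ => ContMDiffAt.smul
      (contMDiffAt_finsetProd fun i _ => contMDiffAt_apply_chartFrame α (J i)) ?_
    exact ((Φ.2.2 α.proj fun i => LinearMap.toContinuousLinearMap
      ((Module.finBasis ℝ E).coord (J i))).contMDiffAt hUα).comp α hπ
  refine h1.congr_of_eventuallyEq ?_
  filter_upwards [hπ.continuousAt.preimage_mem_nhds hUα] with γ hγ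
  rw [← map_sum_smul_univ (Φ.1 γ.proj) (fun _ j => γ.snd (chartFrame α.proj j γ.proj))
    (fun j => ε j γ.proj)]
  have h2 : ∑ j, γ.snd (chartFrame α.proj j γ.proj) • ε j γ.proj = γ.snd := by
    ext v
    have h3 := congrArg γ.snd (extChartAt_dual_frame α.proj hγ v)
    rw [map_sum] at h3
    refine Eq.trans ?_ h3
    rw [sum_apply]
    refine Finset.sum_congr rfl fun j _ => ?_
    rw [map_smul, smul_apply, smul_eq_mul, smul_eq_mul, mul_comm]
    rfl
  rw [h2]

theorem mdifferentiableAt_hamiltonian (Φ : SymTensor E M) (α : CotangentBundle E M) :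
    MDifferentiableAt (cotangentModel E) 𝓘(ℝ, ℂ) (hamiltonian Φ) α := by
  obtain ⟨S, -, hS⟩ := hamiltonian_eq_sum Φ
  have h : ContMDiffAt (cotangentModel E) 𝓘(ℝ, ℂ) ∞ (hamiltonian Φ) α := by
    rw [funext hS]
    exact contMDiffAt_finsetSum fun k _ => contMDiffAt_apply_diagonal (Φ k) α
  exact h.mdifferentiableAt (by simp)

/-- The homogeneous components of a Hamiltonian which satisfies Euler's identity for a quadratic
form. -/
theorem diagonal_of_hasDerivAt (Φ : SymTensor E M) {x : M}
    {α : TangentSpace 𝓘(ℝ, E) x →L[ℝ] ℝ} {q : ℝ}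
    (h : ∀ s : ℝ, HasDerivAt (fun t : ℝ => hamiltonian Φ ⟨x, s • α + t • α⟩) (s * q : ℂ) 0) :
    (∀ k, k ≠ 0 → k ≠ 2 → (Φ k).1 x (fun _ => α) = 0) ∧ (Φ 2).1 x (fun _ => α) = q / 2 := by
  obtain ⟨S, hS0, hS⟩ := hamiltonian_eq_sum Φ
  set c : ℕ → ℂ := fun k => (Φ k).1 x (fun _ => α) with hc
  -- By homogeneity the Hamiltonian at sα is p(s), so the hypothesis reads p′(s) = qs for every real
  -- s.
  set p : Polynomial ℂ := ∑ k ∈ S, Polynomial.monomial k (c k) with hp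
  have hcoeff : ∀ k, p.coeff k = c k := fun k => by
    simp only [hp, Polynomial.finsetSum_coeff, Polynomial.coeff_monomial]
    rw [Finset.sum_ite_eq']
    split_ifs with hk
    · rfl
    · simp [hc, hS0 k hk]
  have heval : ∀ s : ℝ, hamiltonian Φ ⟨x, s • α⟩ = p.eval (s : ℂ) := fun s => by
    rw [hS, hp, Polynomial.eval_finsetSum]
    refine Finset.sum_congr rfl fun k _ => ?_
    rw [Polynomial.eval_monomial]
    have := (Φ k).1 x |>.map_smul_univ (fun _ => s) (fun _ => α)
    refine this.trans ?_
    rw [Finset.prod_const, Finset.card_univ, Fintype.card_fin, Complex.real_smul, mul_comm]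
    push_cast
    rfl
  have hder : ∀ s : ℝ, p.derivative.eval (s : ℂ) = s * q := fun s => by
    have h1 : HasDerivAt (fun t : ℝ => p.eval ((s + t : ℝ) : ℂ)) (p.derivative.eval (s : ℂ)) 0 := by
      have h2 : HasDerivAt (fun t : ℝ => ((s + t : ℝ) : ℂ)) 1 0 := by
        simpa using ((hasDerivAt_id (0 : ℝ)).const_add s).ofReal_comp
      have h3 := p.hasDerivAt ((s + (0 : ℝ) : ℝ) : ℂ)
      have h4 := HasDerivAt.scomp (h := fun t : ℝ => ((s + t : ℝ) : ℂ)) (0 : ℝ) h3 h2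
      simpa using! h4
    have h5 := h s
    simp only [← add_smul, heval] at h5
    exact h1.unique h5
  -- Agreement at the infinitely many real points forces equality of polynomials. Comparing
  -- coefficients leaves the constant term free, which is where the potential U comes from.
  have hpoly : p.derivative = Polynomial.C (q : ℂ) * Polynomial.X := by
    refine Polynomial.eq_of_infinite_eval_eq _ _
      ((infinite_range_of_injective Complex.ofReal_injective).mono ?_)
    rintro _ ⟨s, rfl⟩
    change Polynomial.eval (s : ℂ) _ = Polynomial.eval (s : ℂ) _
    rw [hder, Polynomial.eval_mul, Polynomial.eval_C, Polynomial.eval_X, mul_comm]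
  have hk : ∀ k : ℕ, c (k + 1) * (k + 1) = if k = 1 then (q : ℂ) else 0 := fun k => by
    rw [← hcoeff, ← Polynomial.coeff_derivative, hpoly, Polynomial.coeff_C_mul,
      Polynomial.coeff_X]
    simp [eq_comm]
  refine ⟨fun k h0 h2 => ?_, ?_⟩
  · obtain ⟨l, rfl⟩ := Nat.exists_eq_succ_of_ne_zero h0
    have h1 := hk l
    rw [if_neg (by omega)] at h1
    exact (mul_eq_zero.1 h1).resolve_right (by exact_mod_cast l.succ_ne_zero)
  · have h1 := hk 1
    rw [if_pos rfl] at h1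
    rw [← h1]
    change c 2 = _
    push_cast
    ring

end Hamiltonian

/-! ### Schrödinger operators and conclusion. -/

section SchrodingerOperator

open Set Filter Topology Bundle

/-- A smooth function, as a tensor field of order `0`. -/
def scalarTensor (U : SmoothFn E M) : SymTensorField E M 0 :=
  ⟨fun x => MultilinearMap.constOfIsEmpty ℝ _ ((U : M → ℂ) x), fun _ _ _ => rfl,
    fun _ _ => U.2.contMDiffOn⟩

theorem exists_scalarTensor_eq (Φ : SymTensorField E M 0) : ∃ U, scalarTensor U = Φ := by
  refine ⟨⟨fun x => Φ.1 x Fin.elim0, fun x => ?_⟩, ?_⟩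
  · have h := (Φ.2.2 x Fin.elim0).contMDiffAt
      ((chartAt E x).open_source.mem_nhds (mem_chart_source E x))
    convert h using 3
  · ext x α
    change Φ.1 x Fin.elim0 = Φ.1 x α
    exact congrArg _ (Subsingleton.elim _ _)

variable [FiniteDimensional ℝ E] [IsManifold 𝓘(ℝ, E) ∞ M] [T2Space M]
  {cov : CovariantDerivative 𝓘(ℝ, E) E (TangentSpace 𝓘(ℝ, E) : M → Type _)}

namespace PseudoMetric

variable (g : PseudoMetric E M)

/-- The tensor `g/2 + U`, whose quantization is a Schrödinger operator. -/
def schrodingerTensor (U : SmoothFn E M) : SymTensor E M :=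
  DirectSum.of (fun k => SymTensorField E M k) 2 ((1 / 2 : ℂ) • ⟨_, g.contravariant_mem⟩) +
    DirectSum.of (fun k => SymTensorField E M k) 0 (scalarTensor U)

theorem hamiltonian_schrodingerTensor (U : SmoothFn E M) (x : M)
    (α : TangentSpace 𝓘(ℝ, E) x →L[ℝ] ℝ) :
    hamiltonian (g.schrodingerTensor U) ⟨x, α⟩ = (α (g.sharp x α) : ℂ) / 2 + (U : M → ℂ) x := by
  rw [schrodingerTensor, hamiltonian_add, hamiltonian_of, hamiltonian_of]
  refine congrArg₂ (· + ·) ?_ rfl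
  change (1 / 2 : ℂ) * g.contravariant x (fun _ => α) = _
  rw [g.contravariant_apply]
  ring

variable {g}

theorem quantize_schrodingerTensor (hcov : g.IsLeviCivita cov) (ħ : ℝ) (U f : SmoothFn E M)
    (x : M) : quantize cov ħ (g.schrodingerTensor U) f x =
      -((ħ : ℂ) ^ 2 / 2) * g.laplacian cov f x + (U : M → ℂ) x * (f : M → ℂ) x := by
  rw [schrodingerTensor, quantize_add, quantize_of, quantize_of]
  refine congrArg₂ (· + ·) ?_ ?_
  · have h1 : quantizeHom cov ħ (((1 / 2 : ℂ) • ⟨_, g.contravariant_mem⟩ : SymTensorField E M 2) :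
        ContravariantField E M 2) f x = 1 / 2 * quantizeHom cov ħ g.contravariant f x := by
      simp only [quantizeHom, contraction, Finset.mul_sum]
      refine Finset.sum_congr rfl fun J _ => ?_
      change _ * ((1 / 2 : ℂ) * g.contravariant x _ * _) = _
      ring
    rw [h1, quantizeHom_contravariant hcov]
    ring
  · rw [quantizeHom_eq, contraction, pow_zero, one_mul, Fintype.sum_unique]
    rfl

/-- A statement about the tensor alone: its Hamiltonian has vertical derivative β(α♯) exactly when
it is the metric's kinetic energy plus a function of the base point. -/
theorem isSecondOrder_iff_exists (ħ : ℝ) (P : SmoothFn E M →ₗ[ℂ] SmoothFn E M) :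
    IsSecondOrder (g.transport (associatedField cov ħ P)) ↔
      ∃ U : SmoothFn E M, dequantize cov ħ P = g.schrodingerTensor U := by
  rw [associatedField, g.isSecondOrder_transport_iff (hamiltonianField_spec _)]
  set Φ := dequantize cov ħ P
  have hline := fun (x : M) (α β : TangentSpace 𝓘(ℝ, E) x →L[ℝ] ℝ) =>
    hasDerivAt_fiber_line (mdifferentiableAt_hamiltonian Φ ⟨x, α⟩) β
  constructor
  · intro h
    -- Only radial derivatives are needed: at sα along α the condition gives s·α(α♯). The diagonal
    -- values so obtained determine each symmetric component.
    have hdiag := fun (x : M) (α : TangentSpace 𝓘(ℝ, E) x →L[ℝ] ℝ) =>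
      diagonal_of_hasDerivAt Φ (α := α) (q := α (g.sharp x α)) fun s => by
        have h1 := hline x (s • α) α
        rw [h] at h1
        have h2 : α (g.sharp x (s • α)) = s * α (g.sharp x α) := by
          rw [sharp, map_smul, map_smul]
          rfl
        rw [h2, Complex.ofReal_mul] at h1
        exact h1
    obtain ⟨U, hU⟩ := exists_scalarTensor_eq (Φ 0)
    refine ⟨U, DFinsupp.ext fun k => ?_⟩
    change Φ k = g.schrodingerTensor U k
    by_cases h0 : k = 0
    · subst h0
      rw [schrodingerTensor, DirectSum.add_apply, DirectSum.of_eq_same,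
        DirectSum.of_eq_of_ne _ _ _ (by decide), zero_add, hU]
    by_cases h2 : k = 2
    · subst h2
      rw [schrodingerTensor, DirectSum.add_apply, DirectSum.of_eq_same,
        DirectSum.of_eq_of_ne _ _ _ (by decide), add_zero, ← sub_eq_zero]
      refine SymTensorField.eq_zero_of_diagonal _ fun x α => ?_
      change (Φ 2).1 x (fun _ => α) - (1 / 2 : ℂ) * g.contravariant x (fun _ => α) = 0
      rw [(hdiag x α).2, g.contravariant_apply]
      ring
    · rw [schrodingerTensor, DirectSum.add_apply, DirectSum.of_eq_of_ne _ _ _ h0,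
        DirectSum.of_eq_of_ne _ _ _ h2, add_zero]
      exact SymTensorField.eq_zero_of_diagonal _ fun x α => (hdiag x α).1 k h0 h2
  · rintro ⟨U, hU⟩ x α β
    refine (hline x α β).unique ?_
    have hsymm : α (g.sharp x β) = β (g.sharp x α) := by
      rw [← g.inner_sharp, g.symm, g.inner_sharp]
    -- On the line α + tβ the Hamiltonian is quadratic in t; by symmetry of the metric the two cross
    -- terms agree, so the linear coefficient is β(α♯).
    have h1 : (fun t : ℝ => hamiltonian Φ ⟨x, α + t • β⟩) = fun t : ℝ =>
        (((α (g.sharp x α) + t * (2 * β (g.sharp x α)) + t ^ 2 * β (g.sharp x β)) / 2 : ℝ) : ℂ) +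
          (U : M → ℂ) x := by
      funext t
      rw [hU, hamiltonian_schrodingerTensor]
      congr 1
      have h2 : (α + t • β) (g.sharp x (α + t • β)) =
          α (g.sharp x α) + t * (2 * β (g.sharp x α)) + t ^ 2 * β (g.sharp x β) := by
        have h3 : g.sharp x (α + t • β) = g.sharp x α + t • g.sharp x β := by
          rw [sharp, map_add, map_smul]
          rfl
        rw [h3, add_apply, smul_apply, map_add, map_add, map_smul, map_smul, hsymm]
        simp only [smul_eq_mul]
        ring
      rw [h2]
      push_cast
      rfl
    rw [h1]
    have h4 : HasDerivAt (fun t : ℝ =>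
        (α (g.sharp x α) + t * (2 * β (g.sharp x α)) + t ^ 2 * β (g.sharp x β)) / 2)
        (β (g.sharp x α)) 0 := by
      have h5 := (((hasDerivAt_id (0 : ℝ)).mul_const (2 * β (g.sharp x α))).const_add
        (α (g.sharp x α))).add ((hasDerivAt_pow 2 (0 : ℝ)).mul_const (β (g.sharp x β)))
      refine (h5.div_const 2).congr_deriv ?_
      simp
    exact h4.ofReal_comp.add_const _

theorem isSecondOrder_iff (hcov : g.IsLeviCivita cov) {ħ : ℝ} (hħ : ħ ≠ 0)
    {P : SmoothFn E M →ₗ[ℂ] SmoothFn E M} (hP : IsDiffOp P) :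
    IsSecondOrder (g.transport (associatedField cov ħ P)) ↔
      ∃ U : SmoothFn E M, ∀ (f : SmoothFn E M) (x : M), (P f : M → ℂ) x =
        -((ħ : ℂ) ^ 2 / 2) * g.laplacian cov f x + (U : M → ℂ) x * (f : M → ℂ) x := by
  rw [isSecondOrder_iff_exists]
  have hdeq := isDequantization_dequantize hcov.smooth hħ hP
  refine exists_congr fun U => ⟨fun h f x => ?_, fun h => ?_⟩
  · rw [← quantize_schrodingerTensor hcov, ← h, hdeq f]
  · refine IsDequantization.unique hcov.smooth hħ hdeq fun f => funext fun x => ?_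
    rw [h f x, quantize_schrodingerTensor hcov]

end PseudoMetric

end SchrodingerOperator

end Dequantization

end

theorem mainTheorem3 {E : Type*} [NormedAddCommGroup E] [NormedSpace ℝ E] [FiniteDimensional ℝ E]
    {M : Type*} [TopologicalSpace M] [T2Space M] [ChartedSpace E M] [IsManifold 𝓘(ℝ, E) ∞ M]
    (g : Dequantization.PseudoMetric E M)
    (cov : CovariantDerivative 𝓘(ℝ, E) E (TangentSpace 𝓘(ℝ, E) : M → Type _))
    (hcov : g.IsLeviCivita cov) (ħ : ℝ) (hħ : ħ ≠ 0) :
    (g.contravariant ∈ Dequantization.SymTensorField E M 2 ∧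
      ∀ (f : Dequantization.SmoothFn E M) (x : M),
        Dequantization.quantizeHom cov ħ g.contravariant f x = -(ħ : ℂ) ^ 2 * g.laplacian cov f x) ∧
    ∀ P : Dequantization.SmoothFn E M →ₗ[ℂ] Dequantization.SmoothFn E M,
      Dequantization.IsDiffOp P →
      (Dequantization.IsSecondOrder (g.transport (Dequantization.associatedField cov ħ P)) ↔
        ∃ U : Dequantization.SmoothFn E M, ∀ (f : Dequantization.SmoothFn E M) (x : M),
          (P f : M → ℂ) x =
            -((ħ : ℂ) ^ 2 / 2) * g.laplacian cov f x + (U : M → ℂ) x * (f : M → ℂ) x) := by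
  exact ⟨⟨g.contravariant_mem, Dequantization.PseudoMetric.quantizeHom_contravariant hcov ħ⟩,
    fun _ hP => Dequantization.PseudoMetric.isSecondOrder_iff hcov hħ hP⟩
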